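/- Let $\mathbb k$ be a field of characteristic zero and $\mathfrak g=\bigoplus_i\mathfrak g^i$ a finite-dimensional $\mathbb Z$-graded vector space over $\mathbb k$. **Unimodular $L_\infty$-structures.** A unimodular $L_\infty$-structure on $\mathfrak g$ consists of a differential $d$ on $\mathfrak g$ (of degree $1$, $d^2=0$) and of graded skew-symmetric maps $\ell_n:\wedge^n\mathfrak g\to\mathfrak g$ of degree $2-n$ ($n\ge 2$) and $q_n:\wedge^n\mathfrak g\to\mathbb k$ of degree $-n$ ($n\ge 1$) such that $$\partial\ell_n=\sum_{I\sqcup J=[n],\ |I|\ge 1,\ |J|\ge 2}(-1)^{\sigma_{I,J}+|I||J|}\,\ell_{|I|+1}(\mathrm{id}\otimes\cdots\otimes\mathrm{id}\otimes\ell_{|J|})\,\sigma_{I,J}\qquad(n\ge2),$$ $$\partial q_n=\sum_{I\sqcup J=[n],\ |J|\ge 2}(-1)^{\sigma_{I,J}+|I||J|}\,q_{|I|+1}(\mathrm{id}\otimes\cdots\otimes\mathrm{id}\otimes\ell_{|J|})\,\sigma_{I,J}+\mathrm{tr}_{n+1}\,\ell_{n+1}\qquad(n\ge1).$$ Here $\sigma_{I,J}$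 is the shuffle listing first $I$ and then $J$, $(-1)^{\sigma_{I,J}}$ is its sign, Koszul signs are understood, $\partial\varphi=d\varphi-(-1)^{|\varphi|}\varphi d$, and $\mathrm{tr}_{n+1}\ell_{n+1}(v_1,\dots,v_n)$ is the graded trace (supertrace) of $\ell_{n+1}(v_1,\dots,v_n,-)$. The triple $(d,\{\ell_n\})$ alone, with $d^2=0$ and the first family of equations, is an $L_\infty$-structure. **Geometry of $\mathfrak g[1]$.** Let $s:\mathfrak g[1]\to\mathfrak g$ be the degree $1$ identification. Let $\{e_\alpha\}$ be a homogeneous basis of $\mathfrak g$, $x_\alpha=s^{-1}e_\alpha$, and let $x^\alpha$ be the dual coordinates, $|x^\alpha|=1-|e_\alpha|$. Let $\mathcal O=\prod_{n\ge0}\odot^n\mathfrak g[1]^*\cong\mathbb k[[x^\alpha]]$ be the ring of formal graded commutative power series. A vector field of degree $p$ is a linear map $V:\mathcal O\to\mathcal O$ of degree $p$ with $V(gh)=V(g)h+(-1)^{p|g|}gV(h)$. It is homological if $p=1$, $V|_0=0$ and $V^2=0$. Let $\partial_\alpha=\partial/\partial x^\alpha$ be the left partial derivatives. Volume forms are elements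 of the free rank one $\mathcal O$-module $\mathcal O\cdot\Delta_x$ on the constant volume form $\Delta_x$ of the coordinates. For $V=\sum_\alpha V^\alpha\partial_\alpha$ the Lie derivative is $$L_V(g\Delta_x)=\sum_\alpha(-1)^{|x^\alpha||V^\alpha|}\partial_\alpha(V^\alpha g)\,\Delta_x,$$ and $\operatorname{div}V$ is defined by $L_V(\Delta_x)=\operatorname{div}V\cdot\Delta_x$. For $f\in\mathcal O$ of degree $0$ with $f(0)=0$ put $\rho_f=e^f\Delta_x$. **The correspondence.** Let $\tilde\ell_n=s^{-1}\ell_n(s\otimes\cdots\otimes s)$ for $n\ge2$, $\tilde\ell_1=-s^{-1}ds$, and $\tilde q_n=q_n(s\otimes\cdots\otimes s)$. To $(d,\{\ell_n\},\{q_n\})$ one associates the pair $(Q,f)$, where $f\in\mathcal O$ is the function with components $\tilde q_n$ and $Q$ is the vector field with $Q(x^\alpha)=(-1)^{|x^\alpha|}\sum_{n\ge1}x^\alpha\circ\tilde\ell_n$. A graded symmetric form $\varphi$ on $\mathfrak g[1]^{\otimes n}$ is regarded here as the function $$\frac1{n!}\sum_{\beta_1,\dots,\beta_n}(-1)^{\sum_{i<j}|x^{\beta_i}||x^{\beta_j}|}\varphi(x_{\beta_1},\dots,x_{\beta_n})\,x^{\beta_1}\cdots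 x^{\beta_n}.$$ **Theorem.** 1. The assignment $(d,\{\ell_n\},\{q_n\})\mapsto(Q,f)$ is a bijection from the unimodular $L_\infty$-structures on $\mathfrak g$ to the pairs $(Q,f)$ consisting of a homological vector field $Q$ and a degree $0$ function $f$ with $f(0)=0$ such that $$\operatorname{div}Q+Q(f)=0.$$ The same holds with this equation replaced by $L_Q(\rho_f)=0$, i.e. by the condition that $\rho_f$ is $Q$-invariant. 2. More precisely, the assignment is a bijection from all families $(d,\{\ell_n\},\{q_n\})$ of the stated degrees and symmetry (no equations imposed) to all pairs $(Q,f)$ with $Q$ a degree $1$ vector field with $Q|_0=0$ and $f$ of degree $0$ with $f(0)=0$. For such families, $(d,\{\ell_n\})$ is an $L_\infty$-structure if and only if $Q$ is homological. Moreover $(d,\{\ell_n\},\{q_n\})$ is a unimodular $L_\infty$-structure if and only if $Q$ is homological and $\operatorname{div}Q+Q(f)=0$, equivalently if and only if $Q$ is homological and $L_Q(\rho_f)=0$. The coefficient of $x^\beta$ in $Q(x^\alpha)$ is $-(-1)^{|x^\alpha|}$ times the $e_\alpha$-component of $d e_\beta$, so the linear part of $Q$ is given by $d$. 3. For every degree $1$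 vector field $Q$ and every $f$ of degree $0$ with $f(0)=0$, $L_Q(\rho_f)=(\operatorname{div}Q+Q(f))\rho_f$, and $\operatorname{div}Q+Q(f)=0$ if and only if $L_Q(\rho_f)=0$. 4. $L$ is additive in the vector field, satisfies $L_V(g\rho)=V(g)\rho+(-1)^{|V||g|}gL_V(\rho)$, $L_{gV}(\rho)=(-1)^{|g||V|}L_V(g\rho)$ and $L_{\partial_\alpha}(\Delta_x)=0$, and is the only action of homogeneous vector fields on volume forms with these properties. -/

import Mathlib

namespace UnimodularLInfty

noncomputable section

open Finset.HasAntidiagonal (antidiagonal mem_antidiagonal)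

/-! ### Signs -/

/-- The sign `(-1)^z`, as an element of `R`. -/
def sgn (R : Type*) [Ring R] (z : ℤ) : R := ((Int.negOnePow z : ℤ) : R)

theorem sgn_add (R : Type*) [Ring R] (a b : ℤ) : sgn R (a + b) = sgn R a * sgn R b := by
  simp [sgn, Int.negOnePow_add]

theorem sgn_zero (R : Type*) [Ring R] : sgn R 0 = 1 := by
  simp [sgn]

/-! ### Unimodular L-infinity structures on a finite dimensional graded vector space

The homogeneous part of degree `i` of the graded vector space `V` is `𝒱 i`. -/

section Algebraic

variable {k V : Type*} [Field k] [AddCommGroup V] [Module k V]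

/-- The operations `d`, `ℓ n`, `q n` on `V`. The brackets `ℓ n` are meaningful for `n ≥ 2` and the
operations `q n` for `n ≥ 1`; the remaining ones are required to be zero in `IsGraded` below. -/
@[ext]
structure Operations (k V : Type*) [Field k] [AddCommGroup V] [Module k V] where
  d : V →ₗ[k] V
  ℓ : ∀ n : ℕ, MultilinearMap k (fun _ : Fin n => V) V
  q : ∀ n : ℕ, MultilinearMap k (fun _ : Fin n => V) k

/-- The exponent of the Koszul sign of rearranging `v 0, …, v (n-1)` (of degrees `p`) as
`v (σ 0), …, v (σ (n-1))`. -/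
def koszul {n : ℕ} (σ : Equiv.Perm (Fin n)) (p : Fin n → ℤ) : ℤ :=
  ∑ x : Fin n × Fin n with x.1 < x.2 ∧ σ x.2 < σ x.1, p (σ x.1) * p (σ x.2)

/-- `d` has degree `1`, `ℓ n : ∧ⁿ V → V` has degree `2 - n`, `q n : ∧ⁿ V → k` has degree `-n`
(where `k` sits in degree `0`), and `ℓ n`, `q n` are skew-symmetric in the graded sense. -/
structure IsGraded (𝒱 : ℤ → Submodule k V) (s : Operations k V) : Prop where
  d_mem : ∀ (i : ℤ), ∀ v ∈ 𝒱 i, s.d v ∈ 𝒱 (i + 1)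
  ℓ_zero : s.ℓ 0 = 0
  ℓ_one : s.ℓ 1 = 0
  q_zero : s.q 0 = 0
  ℓ_mem : ∀ (n : ℕ) (v : Fin n → V) (p : Fin n → ℤ), (∀ i, v i ∈ 𝒱 (p i)) →
    s.ℓ n v ∈ 𝒱 (2 - n + ∑ i, p i)
  q_deg : ∀ (n : ℕ) (v : Fin n → V) (p : Fin n → ℤ), (∀ i, v i ∈ 𝒱 (p i)) →
    -(n : ℤ) + ∑ i, p i ≠ 0 → s.q n v = 0
  ℓ_skew : ∀ (n : ℕ) (v : Fin n → V) (p : Fin n → ℤ), (∀ i, v i ∈ 𝒱 (p i)) →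
    ∀ σ : Equiv.Perm (Fin n),
      s.ℓ n (v ∘ σ) = (((Equiv.Perm.sign σ : ℤ) : k) * sgn k (koszul σ p)) • s.ℓ n v
  q_skew : ∀ (n : ℕ) (v : Fin n → V) (p : Fin n → ℤ), (∀ i, v i ∈ 𝒱 (p i)) →
    ∀ σ : Equiv.Perm (Fin n),
      s.q n (v ∘ σ) = (((Equiv.Perm.sign σ : ℤ) : k) * sgn k (koszul σ p)) • s.q n v

/-- The entries of `v` with index in `I`, in increasing order. -/
def restrict {X : Type*} {n : ℕ} (v : Fin n → X) (I : Finset (Fin n)) : Fin I.card → X :=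
  fun a => v (I.orderEmbOfFin rfl a)

/-- For `I ⊔ J = [n]` with `J = Iᶜ`: the exponent of the sign `(-1)^{σ_{I,J}}` of the shuffle
`σ_{I,J}` which lists first `I`, then `J`. -/
def shuffleExp {n : ℕ} (I : Finset (Fin n)) : ℤ :=
  ∑ x : Fin n × Fin n with x.1 ∈ I ∧ x.2 ∉ I ∧ x.2 < x.1, 1

/-- The exponent of the Koszul sign of rearranging `v` (of degrees `p`) as `v_I, v_J`. -/
def shuffleKoszul {n : ℕ} (p : Fin n → ℤ) (I : Finset (Fin n)) : ℤ :=
  ∑ x : Fin n × Fin n with x.1 ∈ I ∧ x.2 ∉ I ∧ x.2 < x.1, p x.1 * p x.2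

/-- The exponent of the total sign in front of `φ (v_I, ℓ_{|J|} (v_J))` in the value at `v` of
`(-1)^{σ_{I,J} + |I||J|} φ (id ⊗ ⋯ ⊗ id ⊗ ℓ_{|J|}) σ_{I,J}`: the last summand is the Koszul sign of
moving `ℓ_{|J|}`, of degree `2 - |J|`, past `v_I`. -/
def insertExp {n : ℕ} (p : Fin n → ℤ) (I : Finset (Fin n)) : ℤ :=
  shuffleExp I + (I.card : ℤ) * (Iᶜ.card : ℤ) + shuffleKoszul p I
    + (2 - (Iᶜ.card : ℤ)) * ∑ i ∈ I, p i

/-- The value at `v` (of degrees `p`) of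
`∑_{I ⊔ J = [n]} (-1)^{σ_{I,J} + |I||J|} φ_{|I|+1} (id ⊗ ⋯ ⊗ id ⊗ ℓ_{|J|}) σ_{I,J}`.
Since `ℓ 0`, `ℓ 1` vanish, only `|J| ≥ 2` (and `|I| ≥ 1` for `φ = ℓ`) contributes. -/
def insertSum (s : Operations k V) {W : Type*} [AddCommGroup W] [Module k W]
    (φ : ∀ n : ℕ, MultilinearMap k (fun _ : Fin n => V) W)
    {n : ℕ} (v : Fin n → V) (p : Fin n → ℤ) : W :=
  ∑ I : Finset (Fin n), sgn k (insertExp p I) •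
    φ (I.card + 1) (Fin.snoc (α := fun _ => V) (restrict v I) (s.ℓ Iᶜ.card (restrict v Iᶜ)))

/-- The value at `v` (of degrees `p`) of `φ ∘ (∑ id ⊗ ⋯ ⊗ d ⊗ ⋯ ⊗ id)`. -/
def precompD (s : Operations k V) {W : Type*} [AddCommGroup W] [Module k W] {n : ℕ}
    (φ : MultilinearMap k (fun _ : Fin n => V) W) (v : Fin n → V) (p : Fin n → ℤ) : W :=
  ∑ j : Fin n, sgn k (∑ i with i < j, p i) • φ (Function.update v j (s.d (v j)))

/-- The parity operator of a graded vector space, `(-1)^i` on the part of degree `i`. -/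
def parity (𝒱 : ℤ → Submodule k V) [DirectSum.Decomposition 𝒱] : V →ₗ[k] V :=
  (DirectSum.toModule k ℤ V fun i => sgn k i • (𝒱 i).subtype) ∘ₗ
    (DirectSum.decomposeLinearEquiv 𝒱).toLinearMap

/-- The trace of an endomorphism in the category of graded vector spaces. -/
def gradedTrace (𝒱 : ℤ → Submodule k V) [DirectSum.Decomposition 𝒱] (F : V →ₗ[k] V) : k :=
  LinearMap.trace k V (parity 𝒱 ∘ₗ F)

/-- The map `tr_{n+1} φ`, the trace of `φ (v 0, …, v (n-1), -)`. -/
def traceLast (𝒱 : ℤ → Submodule k V) [DirectSum.Decomposition 𝒱] {n : ℕ}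
    (φ : MultilinearMap k (fun _ : Fin (n + 1) => V) V) (v : Fin n → V) : k :=
  gradedTrace 𝒱
    (φ.toLinearMap (Fin.snoc (α := fun _ => V) v 0) (Fin.last n))

/-- `(V, d, {ℓ n})` is an L-infinity algebra: `d² = 0` and
`∂ ℓ_n = ∑ (-1)^{σ_{I,J} + |I||J|} ℓ_{|I|+1} (id ⊗ ⋯ ⊗ id ⊗ ℓ_{|J|}) σ_{I,J}` for `n ≥ 2`, where
`∂ φ = d ∘ φ - (-1)^{|φ|} φ ∘ d`. -/
structure IsLInfty (𝒱 : ℤ → Submodule k V) (s : Operations k V) : Prop where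
  graded : IsGraded 𝒱 s
  d_sq : s.d ∘ₗ s.d = 0
  jacobi : ∀ (n : ℕ), 2 ≤ n → ∀ (v : Fin n → V) (p : Fin n → ℤ), (∀ i, v i ∈ 𝒱 (p i)) →
    s.d (s.ℓ n v) - sgn k (2 - n) • precompD s (s.ℓ n) v p = insertSum s s.ℓ v p

/-- `(V, d, {ℓ n}, {q n})` is a unimodular L-infinity algebra: moreover, for `n ≥ 1`,
`∂ q_n = ∑ (-1)^{σ_{I,J} + |I||J|} q_{|I|+1} (id ⊗ ⋯ ⊗ id ⊗ ℓ_{|J|}) σ_{I,J} + tr_{n+1} ℓ_{n+1}`. -/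
structure IsUnimodular (𝒱 : ℤ → Submodule k V) [DirectSum.Decomposition 𝒱]
    (s : Operations k V) : Prop extends IsLInfty 𝒱 s where
  unimodular : ∀ (n : ℕ), 1 ≤ n → ∀ (v : Fin n → V) (p : Fin n → ℤ), (∀ i, v i ∈ 𝒱 (p i)) →
    - (sgn k (-n) • precompD s (s.q n) v p) =
      insertSum s s.q v p + traceLast 𝒱 (s.ℓ (n + 1)) v

end Algebraic

/-! ### Functions on a formal graded manifold -/

section Geometric

variable (k : Type*) [Field k] {N : ℕ} (w : Fin N → ℤ)

/-- A monomial is nonzero if no coordinate of odd degree is repeated. -/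
def Admissible {N : ℕ} (w : Fin N → ℤ) (m : Fin N →₀ ℕ) : Prop := ∀ α, Odd (w α) → m α ≤ 1

theorem Admissible.left {N : ℕ} {w : Fin N → ℤ} {a b : Fin N →₀ ℕ} (h : Admissible w (a + b)) :
    Admissible w a := fun α hα => le_trans (by simp) (h α hα)

theorem Admissible.right {N : ℕ} {w : Fin N → ℤ} {a b : Fin N →₀ ℕ} (h : Admissible w (a + b)) :
    Admissible w b := fun α hα => le_trans (by simp) (h α hα)

/-- The coefficient families of formal graded commutative power series. -/
def coeffModule : Submodule k ((Fin N →₀ ℕ) → k) where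
  carrier := {g | ∀ m, ¬ Admissible w m → g m = 0}
  zero_mem' := fun _ _ => rfl
  add_mem' := fun ha hb m hm => by simp [ha m hm, hb m hm]
  smul_mem' := fun c g hg m hm => by simp [hg m hm]

/-- The ring `k[[x^α]]` of formal graded commutative power series in coordinates `x^α` of degrees
`w α`, so that `x^α x^β = (-1)^{w α w β} x^β x^α`. The element `g` stands for
`∑_m g_m (x^0)^{m 0} (x^1)^{m 1} ⋯`. -/
def FormalFun : Type _ := coeffModule k w

variable {k w}

namespace FormalFun

instance : AddCommGroup (FormalFun k w) := inferInstanceAs (AddCommGroup (coeffModule k w))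

instance : Module k (FormalFun k w) := inferInstanceAs (Module k (coeffModule k w))

/-- The coefficient at a monomial. -/
def coeff (g : FormalFun k w) (m : Fin N →₀ ℕ) : k := g.1 m

open scoped Classical in
/-- The series with given coefficients (at the nonzero monomials). -/
def mk (c : (Fin N →₀ ℕ) → k) : FormalFun k w :=
  ⟨fun m => if Admissible w m then c m else 0, fun _ hm => if_neg hm⟩

@[ext]
theorem ext {g h : FormalFun k w} (H : ∀ m, g.coeff m = h.coeff m) : g = h :=
  Subtype.ext (funext H)

theorem coeff_of_not {g : FormalFun k w} {m : Fin N →₀ ℕ} (hm : ¬ Admissible w m) :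
    g.coeff m = 0 := g.2 m hm

theorem coeff_mk {c : (Fin N →₀ ℕ) → k} {m : Fin N →₀ ℕ} (hm : Admissible w m) :
    (mk c : FormalFun k w).coeff m = c m := if_pos hm

theorem ext_admissible {g h : FormalFun k w}
    (H : ∀ m, Admissible w m → g.coeff m = h.coeff m) : g = h := by
  ext m
  by_cases hm : Admissible w m
  · exact H m hm
  · rw [coeff_of_not hm, coeff_of_not hm]

@[simp] theorem coeff_add (g h : FormalFun k w) (m : Fin N →₀ ℕ) :
    (g + h).coeff m = g.coeff m + h.coeff m := rfl

@[simp] theorem coeff_zero (m : Fin N →₀ ℕ) : (0 : FormalFun k w).coeff m = 0 := rfl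

@[simp] theorem coeff_smul (c : k) (g : FormalFun k w) (m : Fin N →₀ ℕ) :
    (c • g).coeff m = c * g.coeff m := rfl

/-- `x^a x^b = (-1)^{mulExp a b} x^{a+b}`, where `x^a = (x^0)^{a 0} (x^1)^{a 1} ⋯`. -/
def mulExp (w : Fin N → ℤ) (a b : Fin N →₀ ℕ) : ℤ :=
  ∑ i, ∑ j with j < i, (w i * a i) * (w j * b j)

theorem mulExp_add_left (a b c : Fin N →₀ ℕ) :
    mulExp w (a + b) c = mulExp w a c + mulExp w b c := by
  simp [mulExp, mul_add, add_mul, Finset.sum_add_distrib]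

theorem mulExp_add_right (a b c : Fin N →₀ ℕ) :
    mulExp w a (b + c) = mulExp w a b + mulExp w a c := by
  simp [mulExp, mul_add, Finset.sum_add_distrib]

instance : Mul (FormalFun k w) :=
  ⟨fun g h => mk fun m => ∑ x ∈ antidiagonal m,
    sgn k (mulExp w x.1 x.2) * g.coeff x.1 * h.coeff x.2⟩

open scoped Classical in
instance : One (FormalFun k w) := ⟨mk fun m => if m = 0 then 1 else 0⟩

theorem coeff_mul {g h : FormalFun k w} {m : Fin N →₀ ℕ} (hm : Admissible w m) :
    (g * h).coeff m = ∑ x ∈ antidiagonal m,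
      sgn k (mulExp w x.1 x.2) * g.coeff x.1 * h.coeff x.2 := coeff_mk hm

open scoped Classical in
theorem coeff_one {m : Fin N →₀ ℕ} (hm : Admissible w m) :
    (1 : FormalFun k w).coeff m = if m = 0 then 1 else 0 := coeff_mk hm

protected theorem mul_assoc (f g h : FormalFun k w) : f * g * h = f * (g * h) := by
  refine ext_admissible fun m hm => ?_
  rw [coeff_mul hm, coeff_mul hm]
  have h1 : ∀ x ∈ antidiagonal m,
      sgn k (mulExp w x.1 x.2) * (f * g).coeff x.1 * h.coeff x.2 =
      ∑ y ∈ antidiagonal x.1, sgn k (mulExp w x.1 x.2 + mulExp w y.1 y.2) *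
        (f.coeff y.1 * g.coeff y.2 * h.coeff x.2) := by
    intro x hx
    rw [mem_antidiagonal] at hx
    rw [coeff_mul (Admissible.left (hx ▸ hm)), Finset.mul_sum, Finset.sum_mul]
    exact Finset.sum_congr rfl fun y _ => by rw [sgn_add]; ring
  have h2 : ∀ x ∈ antidiagonal m,
      sgn k (mulExp w x.1 x.2) * f.coeff x.1 * (g * h).coeff x.2 =
      ∑ y ∈ antidiagonal x.2, sgn k (mulExp w x.1 x.2 + mulExp w y.1 y.2) *
        (f.coeff x.1 * g.coeff y.1 * h.coeff y.2) := by
    intro x hx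
    rw [mem_antidiagonal] at hx
    rw [coeff_mul (Admissible.right (hx ▸ hm)), Finset.mul_sum]
    exact Finset.sum_congr rfl fun y _ => by rw [sgn_add]; ring
  rw [Finset.sum_congr rfl h1, Finset.sum_congr rfl h2, Finset.sum_sigma', Finset.sum_sigma']
  apply Finset.sum_nbij' (fun ⟨⟨_i, j⟩, ⟨a, b⟩⟩ => ⟨(a, b + j), (b, j)⟩)
    (fun ⟨⟨i, _j⟩, ⟨a, b⟩⟩ => ⟨(i + a, b), (i, a)⟩)
  · rintro ⟨⟨i, j⟩, ⟨a, b⟩⟩ hx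
    simp only [Finset.mem_sigma, mem_antidiagonal] at hx ⊢
    exact ⟨by rw [← add_assoc, hx.2, hx.1], trivial⟩
  · rintro ⟨⟨i, j⟩, ⟨a, b⟩⟩ hx
    simp only [Finset.mem_sigma, mem_antidiagonal] at hx ⊢
    exact ⟨by rw [add_assoc, hx.2, hx.1], trivial⟩
  · rintro ⟨⟨i, j⟩, ⟨a, b⟩⟩ hx
    simp only [Finset.mem_sigma, mem_antidiagonal] at hx
    obtain ⟨-, rfl⟩ := hx
    rfl
  · rintro ⟨⟨i, j⟩, ⟨a, b⟩⟩ hx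
    simp only [Finset.mem_sigma, mem_antidiagonal] at hx
    obtain ⟨-, rfl⟩ := hx
    rfl
  · rintro ⟨⟨i, j⟩, ⟨a, b⟩⟩ hx
    simp only [Finset.mem_sigma, mem_antidiagonal] at hx
    obtain ⟨-, rfl⟩ := hx
    simp only [mulExp_add_left, mulExp_add_right]
    congr 2
    ring

protected theorem one_mul (g : FormalFun k w) : 1 * g = g := by
  refine ext_admissible fun m hm => ?_
  rw [coeff_mul hm, Finset.sum_eq_single (0, m)]
  · rw [coeff_one (fun α _ => by simp)]
    simp [mulExp, sgn_zero]
  · rintro ⟨a, b⟩ hx hne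
    rw [mem_antidiagonal] at hx
    have ha : a ≠ 0 := by
      rintro rfl
      exact hne (by simpa using hx)
    rw [coeff_one (Admissible.left (b := b) (hx ▸ hm)), if_neg ha]
    simp
  · intro hx
    exact absurd (by simp) hx

protected theorem mul_one (g : FormalFun k w) : g * 1 = g := by
  refine ext_admissible fun m hm => ?_
  rw [coeff_mul hm, Finset.sum_eq_single (m, 0)]
  · rw [coeff_one (fun α _ => by simp)]
    simp [mulExp, sgn_zero]
  · rintro ⟨a, b⟩ hx hne
    rw [mem_antidiagonal] at hx
    have hb : b ≠ 0 := by
      rintro rfl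
      exact hne (by simpa using hx)
    rw [coeff_one (Admissible.right (a := a) (hx ▸ hm)), if_neg hb]
    simp
  · intro hx
    exact absurd (by simp) hx

protected theorem left_distrib (f g h : FormalFun k w) : f * (g + h) = f * g + f * h := by
  refine ext_admissible fun m hm => ?_
  simp [coeff_mul hm, mul_add, Finset.sum_add_distrib]

protected theorem right_distrib (f g h : FormalFun k w) : (f + g) * h = f * h + g * h := by
  refine ext_admissible fun m hm => ?_
  simp [coeff_mul hm, mul_add, add_mul, Finset.sum_add_distrib]

protected theorem zero_mul (g : FormalFun k w) : 0 * g = 0 := by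
  refine ext_admissible fun m hm => ?_
  simp [coeff_mul hm]

protected theorem mul_zero (g : FormalFun k w) : g * 0 = 0 := by
  refine ext_admissible fun m hm => ?_
  simp [coeff_mul hm]

instance : Ring (FormalFun k w) where
  __ := (inferInstance : AddCommGroup (FormalFun k w))
  mul_assoc := FormalFun.mul_assoc
  one_mul := FormalFun.one_mul
  mul_one := FormalFun.mul_one
  left_distrib := FormalFun.left_distrib
  right_distrib := FormalFun.right_distrib
  zero_mul := FormalFun.zero_mul
  mul_zero := FormalFun.mul_zero

protected theorem smul_mul (c : k) (g h : FormalFun k w) : c • g * h = c • (g * h) := by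
  refine ext_admissible fun m hm => ?_
  simp only [coeff_mul hm, coeff_smul, Finset.mul_sum]
  exact Finset.sum_congr rfl fun _ _ => by ring

protected theorem mul_smul (c : k) (g h : FormalFun k w) : g * c • h = c • (g * h) := by
  refine ext_admissible fun m hm => ?_
  simp only [coeff_mul hm, coeff_smul, Finset.mul_sum]
  exact Finset.sum_congr rfl fun _ _ => by ring

instance : Algebra k (FormalFun k w) := Algebra.ofModule FormalFun.smul_mul FormalFun.mul_smul

open scoped Classical in
/-- The coordinate function `x^α`. -/
def X (α : Fin N) : FormalFun k w := mk fun m => if m = Finsupp.single α 1 then 1 else 0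

/-- The degree of the monomial `x^m`. -/
def mdeg (w : Fin N → ℤ) (m : Fin N →₀ ℕ) : ℤ := ∑ α, m α * w α

/-- `g` is homogeneous of degree `p`. -/
def IsHomogeneous (g : FormalFun k w) (p : ℤ) : Prop := ∀ m, g.coeff m ≠ 0 → mdeg w m = p

/-- The linear map that sends a homogeneous `g` to `(-1)^{p |g|} g`. -/
def twist (p : ℤ) (g : FormalFun k w) : FormalFun k w :=
  mk fun m => sgn k (p * mdeg w m) * g.coeff m

/-- The left partial derivative `∂_α = ∂/∂x^α`; the sign is that of moving `x^α` to the front of a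
monomial. -/
def pd (α : Fin N) : FormalFun k w →ₗ[k] FormalFun k w where
  toFun g := mk fun m => sgn k (w α * ∑ j with j < α, m j * w j) * (m α + 1) *
    g.coeff (m + Finsupp.single α 1)
  map_add' g h := ext_admissible fun m hm => by
    rw [coeff_add, coeff_mk hm, coeff_mk hm, coeff_mk hm, coeff_add]; ring
  map_smul' c g := ext_admissible fun m hm => by
    rw [RingHom.id_apply, coeff_smul, coeff_mk hm, coeff_mk hm, coeff_smul]; ring

/-- The exponential `e^f = ∑_r f^r / r!` of a function vanishing at `0` (then `f^r` has no monomial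
of length less than `r`, so each coefficient is a finite sum). -/
def exp (f : FormalFun k w) : FormalFun k w :=
  mk fun m => ∑ r ∈ Finset.range (m.degree + 1), (r.factorial : k)⁻¹ * (f ^ r).coeff m

end FormalFun

open FormalFun

/-! ### Vector fields, volume forms, Lie derivative, divergence -/

/-- `Q` is a (homogeneous) vector field of degree `p`: a linear map of degree `p` with
`Q (g h) = Q(g) h + (-1)^{p |g|} g Q(h)`. -/
structure IsVectorField (p : ℤ) (Q : FormalFun k w →ₗ[k] FormalFun k w) : Prop where
  degree : ∀ (r : ℤ) (g : FormalFun k w), IsHomogeneous g r → IsHomogeneous (Q g) (r + p)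
  leibniz : ∀ g h : FormalFun k w, Q (g * h) = Q g * h + twist p g * Q h

/-- `Q|₀ = 0`. -/
def VanishesAtZero (Q : FormalFun k w →ₗ[k] FormalFun k w) : Prop :=
  ∀ g : FormalFun k w, (Q g).coeff 0 = 0

/-- `Q` is a homological vector field: of degree `1`, vanishing at `0`, and of square zero. -/
structure IsHomological (Q : FormalFun k w →ₗ[k] FormalFun k w) : Prop where
  vectorField : IsVectorField 1 Q
  vanishes : VanishesAtZero Q
  square : Q ∘ₗ Q = 0

/-- `f` is of degree `0` and lies in the ideal of the base point `0`. -/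
structure IsPotential (f : FormalFun k w) : Prop where
  homogeneous : IsHomogeneous f 0
  vanishes : f.coeff 0 = 0

variable (k w) in
/-- The Berezinian module of the free module of vector fields: the free module of rank one over the
ring of functions on the generator `Δ` determined by the coordinates `x^α`. -/
def Ber : Type _ := FormalFun k w

namespace Ber

instance : AddCommGroup (Ber k w) := inferInstanceAs (AddCommGroup (FormalFun k w))

instance : Module (FormalFun k w) (Ber k w) :=
  inferInstanceAs (Module (FormalFun k w) (FormalFun k w))

instance : Module k (Ber k w) := inferInstanceAs (Module k (FormalFun k w))

/-- The coordinate of `g Δ` is `g`. -/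
def coord : Ber k w ≃ₗ[FormalFun k w] FormalFun k w :=
  LinearEquiv.refl (FormalFun k w) (FormalFun k w)

/-- The constant volume form `Δ_x`. -/
def Δ : Ber k w := coord.symm 1

end Ber

/-- The Lie derivative of volume forms along a vector field `Q = ∑ Q^α ∂_α` of degree `p`, where
`Q^α = Q (x^α)` has degree `p + w α`:
`L_Q (g Δ) = ∑_α (-1)^{|x^α| |Q^α|} ∂_α (Q^α g) Δ`. -/
def lieDer (p : ℤ) (Q : FormalFun k w →ₗ[k] FormalFun k w) (ρ : Ber k w) : Ber k w :=
  (∑ α, sgn k (w α * (p + w α)) • pd α (Q (X α) * Ber.coord ρ)) • Ber.Δ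

/-- The conditions which determine the action `L` of vector fields on volume forms (the first
argument of `L` is the degree of the vector field). -/
structure IsLieAction
    (L : ℤ → (FormalFun k w →ₗ[k] FormalFun k w) → Ber k w → Ber k w) : Prop where
  add : ∀ p Q Q', IsVectorField p Q → IsVectorField p Q' → ∀ ρ,
    L p (Q + Q') ρ = L p Q ρ + L p Q' ρ
  smul_form : ∀ p Q, IsVectorField p Q → ∀ (g : FormalFun k w) (ρ : Ber k w),
    L p Q (g • ρ) = Q g • ρ + twist p g • L p Q ρ
  smul_field : ∀ p Q, IsVectorField p Q → ∀ (r : ℤ) (g : FormalFun k w), IsHomogeneous g r →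
    ∀ ρ : Ber k w, L (r + p) (LinearMap.mulLeft k g ∘ₗ Q) ρ =
      sgn k (r * p) • L p Q (g • ρ)
  pd : ∀ α, L (-w α) (FormalFun.pd α) Ber.Δ = 0

/-- The divergence `div Q` with respect to `Δ`, defined by `L_Q Δ = div Q · Δ`. -/
def divergence (p : ℤ) (Q : FormalFun k w →ₗ[k] FormalFun k w) : FormalFun k w :=
  Ber.coord (lieDer p Q Ber.Δ)

/-- The volume form `ρ_f = e^f Δ`. -/
def volumeForm (f : FormalFun k w) : Ber k w := FormalFun.exp f • Ber.Δ

/-- The vector field `∑_α c^α ∂_α`. -/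
def vectorFieldOf (c : Fin N → FormalFun k w) : FormalFun k w →ₗ[k] FormalFun k w :=
  ∑ α, LinearMap.mulLeft k (c α) ∘ₗ pd α

/-! ### From operations on `V` to functions and vector fields on `V[1]`

Let `e` be a homogeneous basis of `V`, `deg α` the degree of `e α`. The basis `x_α = s⁻¹ e_α` of
`V[1]` has degrees `deg α - 1`, and the dual coordinates `x^α` have degrees `1 - deg α`. -/

/-- The degrees of the coordinates `x^α` on `V[1]`. -/
def coordDeg {N : ℕ} (deg : Fin N → ℤ) : Fin N → ℤ := fun α => 1 - deg α

/-- The exponent of the Koszul sign in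
`(s ⊗ ⋯ ⊗ s)(x_{β 0}, …, x_{β (n-1)}) = ± (e_{β 0}, …, e_{β (n-1)})`. -/
def shiftExp {N : ℕ} (deg : Fin N → ℤ) {n : ℕ} (β : Fin n → Fin N) : ℤ :=
  ∑ i : Fin n, ((n : ℤ) - 1 - (i : ℕ)) * (deg (β i) - 1)

/-- The function on `V[1]` given by a graded symmetric multilinear form on `V[1]` with values
`φ β` at `(x_{β 0}, …, x_{β (n-1)})`. It is
`1/n! ∑_β (-1)^{∑_{i<j} |x_{β i}| |x_{β j}|} φ(β) x^{β 0} ⋯ x^{β (n-1)}`, the sign being the value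
of `x^{β 0} ⊗ ⋯ ⊗ x^{β (n-1)}` at `x_{β 0} ⊗ ⋯ ⊗ x_{β (n-1)}`. -/
def homogeneousPart (w : Fin N → ℤ) (n : ℕ) (φ : (Fin n → Fin N) → k) : FormalFun k w :=
  (n.factorial : k)⁻¹ • ∑ β : Fin n → Fin N,
    (sgn k (∑ x : Fin n × Fin n with x.1 < x.2, w (β x.1) * w (β x.2)) * φ β) •
      (List.ofFn fun i => X (k := k) (w := w) (β i)).prod

/-- The sum over all `n` of the homogeneous functions above. -/
def totalFunction (w : Fin N → ℤ) (φ : ∀ n : ℕ, (Fin n → Fin N) → k) : FormalFun k w :=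
  FormalFun.mk fun m => (homogeneousPart w m.degree (φ m.degree)).coeff m

section Correspondence

variable {V : Type*} [AddCommGroup V] [Module k V]

/-- All brackets of the structure; the unary one is the differential of `V[1]`, which is
`-s⁻¹ d s`. -/
def bracket (s : Operations k V) : ∀ n : ℕ, (Fin n → V) → V
  | 1, v => -s.d (v 0)
  | n, v => s.ℓ n v

/-- The component along `x_α` of `ℓ̃_n (x_{β 0}, …, x_{β (n-1)})`, where
`ℓ̃_n = s⁻¹ ∘ ℓ_n ∘ (s ⊗ ⋯ ⊗ s)`. -/
def shiftedBracket (e : Module.Basis (Fin N) k V) (deg : Fin N → ℤ) (s : Operations k V)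
    (α : Fin N) (n : ℕ) (β : Fin n → Fin N) : k :=
  sgn k (shiftExp deg β) * e.repr (bracket s n (e ∘ β)) α

/-- The value `q̃_n (x_{β 0}, …, x_{β (n-1)})`, where `q̃_n = q_n ∘ (s ⊗ ⋯ ⊗ s)`. -/
def shiftedQ (e : Module.Basis (Fin N) k V) (deg : Fin N → ℤ) (s : Operations k V)
    (n : ℕ) (β : Fin n → Fin N) : k :=
  sgn k (shiftExp deg β) * s.q n (e ∘ β)

/-- The vector field `Q` on `V[1]` dual to the coderivation with components `ℓ̃_n`. Dualising
follows the Koszul sign rule, `Q g = (-1)^{|g|} g ∘ ∑ ℓ̃_n`, so that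
`Q (x^α) = (-1)^{|x^α|} ∑_n x^α ∘ ℓ̃_n`. -/
def assocField (e : Module.Basis (Fin N) k V) (deg : Fin N → ℤ) (s : Operations k V) :
    FormalFun k (coordDeg deg) →ₗ[k] FormalFun k (coordDeg deg) :=
  vectorFieldOf fun α => sgn k (coordDeg deg α) •
    totalFunction (coordDeg deg) (shiftedBracket e deg s α)

/-- The function `f` on `V[1]` with components `q̃_n`. -/
def assocFunction (e : Module.Basis (Fin N) k V) (deg : Fin N → ℤ) (s : Operations k V) :
    FormalFun k (coordDeg deg) :=
  totalFunction (coordDeg deg) (shiftedQ e deg s)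

end Correspondence

end Geometric

end

end UnimodularLInfty

/-! In characteristic zero a formal series is the same thing as its family of derivatives at the
origin, and these derivatives form a graded symmetric function of lists of indices. This is the
dictionary `taylor` / `ofTaylor`, inverse to each other by `taylor_ofTaylor` and `ofTaylor_taylor`.
On the algebraic side, a multilinear operation is the same as its values on basis vectors, and the
sign `shiftExp` turns graded skew-symmetry on `V` into graded symmetry on `V[1]` (`IsSkew.isSymm`,
`IsSymm.isSkew`). A vector field is determined by its values on the coordinates
(`IsVectorField.eq_vectorFieldOf`). Hence families of operations of the right degrees and symmetry
correspond to pairs `(Q, f)` before any equation is imposed.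

The equations are then compared one Taylor coefficient at a time. By the Leibniz rule (`iterPd_mul`,
`taylor_vectorFieldOf`) a Taylor coefficient of `Q g` is a sum over the subsets `I` of the
arguments: the derivatives in the complement fall on a component of `Q`, those in `I` on a
derivative of `g`. This is the sum over shuffles of insertions of a bracket into the form belonging
to `g`, and `sgn_shuffleKoszul_mul` identifies its signs with those on `V`. The subsets with
one-element complement produce the differential (`sum_insert_bracket`, `snoc_eq_update`).

For `g = Q (x^α)` the result is, up to sign, a component of the failure of the L-infinity equations.
Since `Q` is odd, `Q²` is again a derivation, so testing it on coordinates suffices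
(`IsVectorField.square_eq`). For `g = f` the result is the part of the unimodularity equation that
involves `q`; the divergence differentiates `Q^α` by `x^α`, which closes the last slot of the
bracket into a supertrace (`taylor_divergence`).

The invariant form of the equation follows from `L_Q (g Δ) = (div Q · g + Q g) Δ` and `Q (e^f) =
Q(f) e^f`, together with the fact that `e^f` has constant term `1` and can be cancelled. Uniqueness
of the Lie derivative holds because its axioms force a formula on `g Δ` along `∑ Q^α ∂_α`. -/

namespace UnimodularLInfty

open Finset.HasAntidiagonal (antidiagonal mem_antidiagonal)

/-! ### Signs -/

section Signs

variable {R : Type*} [Ring R]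

theorem sgn_two_mul (c : ℤ) : sgn R (2 * c) = 1 := by
  simp [sgn, Int.negOnePow_two_mul]

theorem sgn_of_even {a : ℤ} (h : Even a) : sgn R a = 1 := by
  simp [sgn, Int.negOnePow_even a h]

theorem sgn_of_odd {a : ℤ} (h : Odd a) : sgn R a = -1 := by
  simp [sgn, Int.negOnePow_odd a h]

theorem sgn_one : sgn R 1 = -1 := sgn_of_odd odd_one

theorem sgn_eq_of_even {a b : ℤ} (h : Even (a - b)) : sgn R a = sgn R b := by
  have := sgn_add R (a - b) b
  rwa [sub_add_cancel, sgn_of_even h, one_mul] at this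

/-- Most sign comparisons below end here: both sides are collected into one exponent and half of the
difference is supplied explicitly, so that `ring` replaces a discussion of parities. -/
theorem sgn_eq_of_eq {a b : ℤ} (c : ℤ) (h : a = b + 2 * c) : sgn R a = sgn R b :=
  sgn_eq_of_even ⟨c, by rw [h]; ring⟩

theorem sgn_neg (a : ℤ) : sgn R (-a) = sgn R a := sgn_eq_of_eq (-a) (by ring)

theorem sgn_sub (a b : ℤ) : sgn R (a - b) = sgn R a * sgn R b := by
  rw [sub_eq_add_neg, sgn_add, sgn_neg]

theorem sgn_mul_self (a : ℤ) : sgn R a * sgn R a = 1 := by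
  rw [← sgn_add, ← two_mul, sgn_two_mul]

theorem sgn_mul_sgn_mul (a : ℤ) (x : R) : sgn R a * (sgn R a * x) = x := by
  rw [← mul_assoc, sgn_mul_self, one_mul]

theorem sgn_mul_succ (a : ℤ) : sgn R (a * (1 + a)) = 1 :=
  sgn_of_even (by rw [add_comm]; exact Int.even_mul_succ_self a)

theorem sgn_ne_zero [Nontrivial R] (a : ℤ) : sgn R a ≠ 0 := fun h => by
  simpa [h] using sgn_mul_self (R := R) a

end Signs

/-! ### Differential calculus on formal graded power series -/

namespace FormalFun

variable {k : Type*} [Field k] {N : ℕ} {w : Fin N → ℤ}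

theorem Admissible_zero : Admissible w (0 : Fin N →₀ ℕ) := fun _ _ => by simp

theorem coeff_sum {ι : Type*} (s : Finset ι) (g : ι → FormalFun k w) (m : Fin N →₀ ℕ) :
    (∑ i ∈ s, g i).coeff m = ∑ i ∈ s, (g i).coeff m := by
  classical
  induction s using Finset.induction_on with
  | empty => simp
  | insert a s ha ih => rw [Finset.sum_insert ha, Finset.sum_insert ha, coeff_add, ih]

theorem coeff_pd (α : Fin N) (g : FormalFun k w) (m : Fin N →₀ ℕ) :
    (pd α g).coeff m = sgn k (w α * ∑ j with j < α, m j * w j) * (m α + 1) *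
      g.coeff (m + Finsupp.single α 1) := by
  by_cases hm : Admissible w m
  · exact coeff_mk hm
  · rw [coeff_of_not hm, coeff_of_not (fun h => hm h.left), mul_zero]

theorem coeff_twist (p : ℤ) (g : FormalFun k w) (m : Fin N →₀ ℕ) :
    (twist p g).coeff m = sgn k (p * mdeg w m) * g.coeff m := by
  by_cases hm : Admissible w m
  · exact coeff_mk hm
  · rw [coeff_of_not hm, coeff_of_not hm, mul_zero]

theorem coeff_mul_zero (g h : FormalFun k w) : (g * h).coeff 0 = g.coeff 0 * h.coeff 0 := by
  rw [coeff_mul Admissible_zero]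
  simp [mulExp, sgn_zero]

theorem coeff_one_zero : (1 : FormalFun k w).coeff 0 = 1 := by
  rw [coeff_one Admissible_zero, if_pos rfl]

theorem coeff_X (α : Fin N) (m : Fin N →₀ ℕ) [Decidable (m = Finsupp.single α 1)] :
    (X α : FormalFun k w).coeff m = if m = Finsupp.single α 1 then 1 else 0 := by
  classical
  by_cases hm : Admissible w m
  · rw [X, coeff_mk hm]; congr
  · rw [coeff_of_not hm, if_neg]
    rintro rfl
    refine hm fun β _ => ?_
    rw [Finsupp.single_apply]
    split_ifs <;> simp

/-! ### The degree of monomials -/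

theorem mdeg_zero : mdeg w (0 : Fin N →₀ ℕ) = 0 := by simp [mdeg]

theorem mdeg_add (a b : Fin N →₀ ℕ) : mdeg w (a + b) = mdeg w a + mdeg w b := by
  simp [mdeg, add_mul, Finset.sum_add_distrib]

theorem mdeg_single (α : Fin N) : mdeg w (Finsupp.single α 1) = w α := by
  simp [mdeg, Finsupp.single_apply]

/-! ### The parity twist -/

theorem twist_sum (p : ℤ) {ι : Type*} (s : Finset ι) (g : ι → FormalFun k w) :
    twist p (∑ i ∈ s, g i) = ∑ i ∈ s, twist p (g i) := by
  ext m; simp [coeff_twist, coeff_sum, Finset.mul_sum]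

theorem twist_zero_left (g : FormalFun k w) : twist 0 g = g := by
  ext m; simp [coeff_twist, sgn_zero]

theorem twist_twist (p q : ℤ) (g : FormalFun k w) : twist p (twist q g) = twist (p + q) g := by
  ext m; rw [coeff_twist, coeff_twist, coeff_twist, add_mul, sgn_add, mul_assoc]

theorem twist_mul (p : ℤ) (g h : FormalFun k w) : twist p (g * h) = twist p g * twist p h := by
  refine ext_admissible fun m hm => ?_
  rw [coeff_twist, coeff_mul hm, coeff_mul hm, Finset.mul_sum]
  refine Finset.sum_congr rfl fun x hx => ?_
  rw [mem_antidiagonal] at hx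
  rw [← hx, mdeg_add, mul_add, sgn_add, coeff_twist, coeff_twist]
  ring

theorem twist_of_homogeneous {g : FormalFun k w} {r : ℤ} (hg : IsHomogeneous g r) (p : ℤ) :
    twist p g = sgn k (p * r) • g := by
  ext m
  rw [coeff_twist, coeff_smul]
  by_cases h : g.coeff m = 0
  · simp [h]
  · rw [hg m h]

theorem twist_pd (p : ℤ) (α : Fin N) (g : FormalFun k w) :
    twist p (pd α g) = sgn k (p * w α) • pd α (twist p g) := by
  ext m
  rw [coeff_twist, coeff_smul, coeff_pd, coeff_pd, coeff_twist, mdeg_add, mdeg_single,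
    mul_add p, sgn_add]
  have := sgn_mul_self (R := k) (p * w α)
  linear_combination (-(sgn k (p * mdeg w m)) * sgn k (w α * ∑ j with j < α, (m j : ℤ) * w j) *
    (m α + 1) * g.coeff (m + Finsupp.single α 1)) * this

/-! ### Homogeneous functions -/

theorem IsHomogeneous.add {g h : FormalFun k w} {r : ℤ} (hg : IsHomogeneous g r)
    (hh : IsHomogeneous h r) : IsHomogeneous (g + h) r := fun m hm => by
  by_cases h0 : g.coeff m = 0
  · refine hh m fun h1 => hm ?_
    rw [coeff_add, h0, h1, add_zero]
  · exact hg m h0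

theorem isHomogeneous_zero (r : ℤ) : IsHomogeneous (0 : FormalFun k w) r :=
  fun _ hm => absurd rfl hm

theorem IsHomogeneous.sum {ι : Type*} {s : Finset ι} {g : ι → FormalFun k w} {r : ℤ}
    (h : ∀ i ∈ s, IsHomogeneous (g i) r) : IsHomogeneous (∑ i ∈ s, g i) r := fun m hm => by
  rw [coeff_sum] at hm
  obtain ⟨i, hi, hne⟩ := Finset.exists_ne_zero_of_sum_ne_zero hm
  exact h i hi m hne

theorem IsHomogeneous.smul {g : FormalFun k w} {r : ℤ} (hg : IsHomogeneous g r) (c : k) :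
    IsHomogeneous (c • g) r := fun m hm => hg m fun h => hm (by rw [coeff_smul, h, mul_zero])

theorem IsHomogeneous.mul {g h : FormalFun k w} {r t : ℤ} (hg : IsHomogeneous g r)
    (hh : IsHomogeneous h t) : IsHomogeneous (g * h) (r + t) := fun m hm => by
  have hadm : Admissible w m := by
    by_contra hn; exact hm (coeff_of_not hn)
  rw [coeff_mul hadm] at hm
  obtain ⟨x, hx, hne⟩ := Finset.exists_ne_zero_of_sum_ne_zero hm
  rw [mem_antidiagonal] at hx
  rw [← hx, mdeg_add, hg _ (right_ne_zero_of_mul (left_ne_zero_of_mul hne)),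
    hh _ (right_ne_zero_of_mul hne)]

theorem isHomogeneous_one : IsHomogeneous (1 : FormalFun k w) 0 := fun m hm => by
  classical
  have hadm : Admissible w m := by
    by_contra hn; exact hm (coeff_of_not hn)
  rw [coeff_one hadm] at hm
  rw [of_not_not fun h => hm (if_neg h), mdeg_zero]

theorem isHomogeneous_X (α : Fin N) : IsHomogeneous (X α : FormalFun k w) (w α) := fun m hm => by
  classical
  rw [coeff_X] at hm
  rw [of_not_not fun h => hm (if_neg h), mdeg_single]

theorem IsHomogeneous.pd {g : FormalFun k w} {r : ℤ} (hg : IsHomogeneous g r) (α : Fin N) :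
    IsHomogeneous (pd α g) (r - w α) := fun m hm => by
  rw [coeff_pd] at hm
  have := hg _ (right_ne_zero_of_mul hm)
  rw [mdeg_add, mdeg_single] at this
  omega

/-! ### Graded commutativity -/

theorem sum_lt_comm {n : ℕ} (F : Fin n → Fin n → ℤ) :
    ∑ i, ∑ j with j < i, F i j = ∑ j, ∑ i with j < i, F i j := by
  simp only [Finset.sum_filter]
  exact Finset.sum_comm

theorem sum_split_lt {n : ℕ} (α : Fin n) (F : Fin n → ℤ) :
    ∑ i, F i = (∑ i with i < α, F i) + F α + ∑ i with α < i, F i := by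
  have h : ∀ i, F i = (if i < α then F i else 0) + (if i = α then F i else 0) +
      if α < i then F i else 0 := by
    intro i
    rcases lt_trichotomy i α with h | h | h
    · simp [h, h.ne, h.not_gt]
    · simp [h]
    · simp [h, h.ne', h.not_gt]
  rw [Finset.sum_congr rfl fun i _ => h i, Finset.sum_add_distrib, Finset.sum_add_distrib,
    Finset.sum_filter, Finset.sum_filter]
  simp

/-- The product of the two degrees is a sum over all pairs of positions. The pairs off the diagonal
are shared between the two multiplication exponents, and the diagonal remains. -/
theorem mulExp_add_comm (a b : Fin N →₀ ℕ) :
    mulExp w a b + mulExp w b a + ∑ i, w i * w i * (a i * b i) = mdeg w a * mdeg w b := by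
  have h2 : mulExp w b a = ∑ i, ∑ j with i < j, (w i * a i) * (w j * b j) := by
    rw [mulExp, sum_lt_comm]
    exact Finset.sum_congr rfl fun i _ => Finset.sum_congr rfl fun j _ => by ring
  rw [h2, mulExp, mdeg, mdeg, Finset.sum_mul, ← Finset.sum_add_distrib, ← Finset.sum_add_distrib]
  refine Finset.sum_congr rfl fun i _ => ?_
  rw [sum_split_lt i (fun j => (b j : ℤ) * w j), mul_add, mul_add, Finset.mul_sum, Finset.mul_sum]
  have h3 : ∀ s : Finset (Fin N), ∑ j ∈ s, (w i * a i) * (w j * b j) =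
      ∑ j ∈ s, (a i : ℤ) * w i * ((b j : ℤ) * w j) := fun s =>
    Finset.sum_congr rfl fun j _ => by ring
  rw [h3, h3]
  ring

/-- Graded commutativity depends on this: an odd coordinate cannot occur in both factors of a
nonzero monomial, so the diagonal pairs contribute no sign. -/
theorem even_of_admissible {a b : Fin N →₀ ℕ} (h : Admissible w (a + b)) :
    Even (∑ i, w i * w i * ((a i : ℤ) * b i)) := by
  refine Finset.even_sum _ fun i _ => ?_
  rcases Int.even_or_odd (w i) with hw | hw
  · exact (hw.mul_right _).mul_right _
  · have := h i hw
    rw [Finsupp.add_apply] at this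
    have h0 : (a i : ℤ) * b i = 0 := by
      rcases Nat.eq_zero_or_pos (a i) with h | h
      · simp [h]
      · have : b i = 0 := by omega
        simp [this]
    rw [h0, mul_zero]; exact Even.zero

theorem sgn_mulExp_comm {a b : Fin N →₀ ℕ} (h : Admissible w (a + b)) :
    sgn k (mulExp w a b) = sgn k (mdeg w a * mdeg w b) * sgn k (mulExp w b a) := by
  rw [← sgn_add]
  refine sgn_eq_of_even ?_
  have h1 := mulExp_add_comm (w := w) a b
  have h2 := even_of_admissible h
  have h3 : mulExp w a b - (mdeg w a * mdeg w b + mulExp w b a) =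
    -(∑ i, w i * w i * ((a i : ℤ) * b i)) - 2 * mulExp w b a := by rw [← h1]; ring
  rw [h3]
  exact h2.neg.sub (even_two_mul _)

/-- Only `g` is homogeneous; the sign depends on the degree of each monomial of `h` and is therefore
carried by `twist`. -/
theorem mul_comm_of_homogeneous {g : FormalFun k w} {r : ℤ} (hg : IsHomogeneous g r)
    (h : FormalFun k w) : g * h = twist r h * g := by
  refine ext_admissible fun m hm => ?_
  rw [coeff_mul hm, coeff_mul hm]
  refine Finset.sum_nbij' Prod.swap Prod.swap ?_ ?_ ?_ ?_ ?_
  · intro x hx; rw [mem_antidiagonal] at hx ⊢; rw [← hx, add_comm]; rfl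
  · intro x hx; rw [mem_antidiagonal] at hx ⊢; rw [← hx, add_comm]; rfl
  · intro x _; rfl
  · intro x _; rfl
  · intro x hx
    rw [mem_antidiagonal] at hx
    rw [sgn_mulExp_comm (hx ▸ hm), coeff_twist]
    by_cases h0 : g.coeff x.1 = 0
    · simp [h0]
    · rw [hg _ h0]
      simp only [Prod.fst_swap, Prod.snd_swap]
      ring

/-! ### Partial derivatives -/

/-- The factor `x.1 α` kills the splittings whose left part does not contain `α`; every other
splitting arises by adding `α` to the left part of a splitting of `m`. -/
theorem sum_antidiagonal_single_left (α : Fin N) (m : Fin N →₀ ℕ)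
    (F : (Fin N →₀ ℕ) → (Fin N →₀ ℕ) → k) :
    ∑ x ∈ antidiagonal (m + Finsupp.single α 1), ((x.1 : Fin N →₀ ℕ) α : k) * F x.1 x.2 =
      ∑ x ∈ antidiagonal m, (x.1 α + 1 : k) * F (x.1 + Finsupp.single α 1) x.2 := by
  symm
  refine Finset.sum_of_injOn (fun x => (x.1 + Finsupp.single α 1, x.2)) ?_ ?_ ?_ ?_
  · rintro ⟨a, b⟩ _ ⟨a', b'⟩ _ h
    simpa using h
  · rintro ⟨a, b⟩ h
    simp only [Finset.mem_coe, mem_antidiagonal] at h ⊢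
    rw [← h]; abel
  · rintro ⟨a, b⟩ h hn
    rw [mem_antidiagonal] at h
    have : a α = 0 := by
      by_contra ha
      have hle : Finsupp.single α 1 ≤ a := by
        rw [Finsupp.single_le_iff]; omega
      refine hn ⟨(a - Finsupp.single α 1, b), ?_, ?_⟩
      · simp only [Finset.mem_coe, mem_antidiagonal]
        have : (a - Finsupp.single α 1) + b + Finsupp.single α 1 = m + Finsupp.single α 1 := by
          rw [← h]
          nth_rewrite 2 [← tsub_add_cancel_of_le hle]
          exact add_right_comm _ _ _
        exact add_right_cancel this
      · simp [tsub_add_cancel_of_le hle]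
    simp [this]
  · rintro ⟨a, b⟩ _
    simp

theorem sum_antidiagonal_single_right (α : Fin N) (m : Fin N →₀ ℕ)
    (F : (Fin N →₀ ℕ) → (Fin N →₀ ℕ) → k) :
    ∑ x ∈ antidiagonal (m + Finsupp.single α 1), ((x.2 : Fin N →₀ ℕ) α : k) * F x.1 x.2 =
      ∑ x ∈ antidiagonal m, (x.2 α + 1 : k) * F x.1 (x.2 + Finsupp.single α 1) := by
  have := sum_antidiagonal_single_left α m fun a b => F b a
  rw [Finsupp.sum_antidiagonal_swap (m + Finsupp.single α 1) fun a b => (a α : k) * F b a,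
    Finsupp.sum_antidiagonal_swap m fun a b => (a α + 1 : k) * F b (a + Finsupp.single α 1)] at this
  exact this

theorem mulExp_single_left (α : Fin N) (b : Fin N →₀ ℕ) :
    mulExp w (Finsupp.single α 1) b = w α * ∑ j with j < α, b j * w j := by
  rw [mulExp, Finset.sum_eq_single α]
  · rw [Finset.mul_sum]
    refine Finset.sum_congr rfl fun j _ => ?_
    rw [Finsupp.single_eq_same, Nat.cast_one, mul_one]
    ring
  · intro i _ hi
    simp [hi.symm]
  · simp

theorem mulExp_single_right (α : Fin N) (a : Fin N →₀ ℕ) :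
    mulExp w a (Finsupp.single α 1) = w α * ∑ i with α < i, a i * w i := by
  rw [mulExp, sum_lt_comm, Finset.sum_eq_single α]
  · rw [Finset.mul_sum]
    refine Finset.sum_congr rfl fun j _ => ?_
    rw [Finsupp.single_eq_same, Nat.cast_one, mul_one]
    ring
  · intro i _ hi
    simp [hi.symm]
  · simp

theorem sgn_pd_left (α : Fin N) (a b : Fin N →₀ ℕ) :
    sgn k (w α * ∑ j with j < α, ((a + b) j : ℤ) * w j) *
      sgn k (mulExp w (a + Finsupp.single α 1) b) =
    sgn k (mulExp w a b) * sgn k (w α * ∑ j with j < α, (a j : ℤ) * w j) := by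
  rw [← sgn_add, ← sgn_add]
  refine sgn_eq_of_eq (w α * ∑ j with j < α, (b j : ℤ) * w j) ?_
  rw [mulExp_add_left, mulExp_single_left]
  simp only [Finsupp.add_apply, Nat.cast_add, add_mul, Finset.sum_add_distrib]
  ring

/-- The factor `sgn k (w α * a α)` records the passage of `x^α` past the copies of itself in the
left monomial, which neither `mulExp` nor the sum over `j < α` sees. It takes the form required by
the degree because `w²` and `w` have the same parity. -/
theorem sgn_pd_right (α : Fin N) (a b : Fin N →₀ ℕ) :
    sgn k (w α * ∑ j with j < α, ((a + b) j : ℤ) * w j) *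
      (sgn k (w α * a α) * sgn k (mulExp w a (b + Finsupp.single α 1))) =
    sgn k (mulExp w a b) * (sgn k (-w α * mdeg w a) *
      sgn k (w α * ∑ j with j < α, (b j : ℤ) * w j)) := by
  have h1 : sgn k (w α * a α) = sgn k (w α * (a α * w α)) :=
    sgn_eq_of_even (by
      have : w α * a α - w α * (a α * w α) = -(a α * (w α * (w α - 1))) := by ring
      rw [this]
      exact ((Int.even_mul_pred_self (w α)).mul_left _).neg)
  rw [h1]
  simp only [← sgn_add]
  refine sgn_eq_of_eq (w α * mdeg w a) ?_
  rw [mulExp_add_right, mulExp_single_right, mdeg, sum_split_lt α (fun i => (a i : ℤ) * w i)]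
  simp only [Finsupp.add_apply, Nat.cast_add, add_mul, Finset.sum_add_distrib]
  ring

theorem pd_mul (α : Fin N) (g h : FormalFun k w) :
    pd α (g * h) = pd α g * h + twist (-w α) g * pd α h := by
  refine ext_admissible fun m hm => ?_
  -- The exponent of `α` is distributed over the two factors. The extra sign in the second summand
  -- is harmless if the monomial is admissible: for odd `w α` one of the two exponents is zero. If
  -- it is not admissible, then `α` is odd with exponent `2`; the splittings `1 + 1` cancel because
  -- of the extra sign, and the others contain a square of `x^α`.
  have key : ((m α : k) + 1) * (g * h).coeff (m + Finsupp.single α 1) =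
      ∑ x ∈ antidiagonal (m + Finsupp.single α 1), (((x.1 : Fin N →₀ ℕ) α : k) * (sgn k (mulExp w x.1 x.2) *
        g.coeff x.1 * h.coeff x.2) + (x.2 α : k) * (sgn k (w α * x.1 α) *
        sgn k (mulExp w x.1 x.2) * g.coeff x.1 * h.coeff x.2)) := by
    have hsum : ∀ x ∈ antidiagonal (m + Finsupp.single α 1),
        (x.1 : Fin N →₀ ℕ) α + (x.2 : Fin N →₀ ℕ) α = m α + 1 := by
      intro x hx
      rw [mem_antidiagonal] at hx
      simpa using DFunLike.congr_fun hx α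
    by_cases hm' : Admissible w (m + Finsupp.single α 1)
    · rw [coeff_mul hm', Finset.mul_sum]
      refine Finset.sum_congr rfl fun x hx => ?_
      have hs : (m α : k) + 1 = x.1 α + x.2 α := by
        rw [← Nat.cast_add, hsum x hx, Nat.cast_add, Nat.cast_one]
      have h2 : (x.2 α : k) * sgn k (w α * x.1 α) = x.2 α := by
        rcases Int.even_or_odd (w α) with he | ho
        · rw [sgn_of_even (he.mul_right _), mul_one]
        · have h1 := hm' α ho
          have h3 := hsum x hx
          simp only [Finsupp.add_apply, Finsupp.single_eq_same] at h1
          rcases Nat.eq_zero_or_pos (x.2 α) with h | h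
          · simp [h]
          · have : x.1 α = 0 := by omega
            simp [this, sgn_zero]
      rw [hs]
      linear_combination (-(sgn k (mulExp w x.1 x.2) * g.coeff x.1 * h.coeff x.2)) * h2
    · rw [coeff_of_not hm', mul_zero]
      symm
      refine Finset.sum_eq_zero fun x hx => ?_
      have h3 := hsum x hx
      obtain ⟨ho, h1⟩ : Odd (w α) ∧ m α = 1 := by
        simp only [Admissible, not_forall] at hm'
        obtain ⟨β, hβ, h⟩ := hm'
        have h4 := hm β hβ
        rw [Finsupp.add_apply, Finsupp.single_apply] at h
        split_ifs at h with hc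
        · subst hc; exact ⟨hβ, by omega⟩
        · omega
      by_cases h5 : x.1 α = 1
      · have h6 : x.2 α = 1 := by omega
        rw [h5, h6, Nat.cast_one, Nat.cast_one, mul_one, sgn_of_odd ho]
        ring
      · have : g.coeff x.1 = 0 ∨ h.coeff x.2 = 0 := by
          rcases Nat.lt_or_gt_of_ne h5 with h | h
          · exact Or.inr (coeff_of_not fun hA => by have := hA α ho; omega)
          · exact Or.inl (coeff_of_not fun hA => by have := hA α ho; omega)
        rcases this with h | h <;> simp [h]
  rw [coeff_pd, mul_assoc, key, Finset.sum_add_distrib,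
    sum_antidiagonal_single_left α m fun a b => sgn k (mulExp w a b) * g.coeff a * h.coeff b,
    sum_antidiagonal_single_right α m fun a b => sgn k (w α * a α) * sgn k (mulExp w a b) *
      g.coeff a * h.coeff b, mul_add, coeff_add, coeff_mul hm, coeff_mul hm,
    Finset.mul_sum (antidiagonal m), Finset.mul_sum (antidiagonal m)]
  congr 1
  · refine Finset.sum_congr rfl fun x hx => ?_
    rw [mem_antidiagonal] at hx
    have := sgn_pd_left (k := k) (w := w) α x.1 x.2
    rw [hx] at this
    rw [coeff_pd]
    linear_combination ((x.1 α + 1 : k) * g.coeff (x.1 + Finsupp.single α 1) * h.coeff x.2) * this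
  · refine Finset.sum_congr rfl fun x hx => ?_
    rw [mem_antidiagonal] at hx
    have := sgn_pd_right (k := k) (w := w) α x.1 x.2
    rw [hx] at this
    rw [coeff_pd, coeff_twist]
    linear_combination ((x.2 α + 1 : k) * g.coeff x.1 * h.coeff (x.2 + Finsupp.single α 1)) * this

theorem pd_one (α : Fin N) : pd α (1 : FormalFun k w) = 0 := by
  have h := pd_mul α (1 : FormalFun k w) 1
  rw [mul_one, mul_one, twist_of_homogeneous isHomogeneous_one, mul_zero, sgn_zero, one_smul,
    one_mul] at h
  simpa using h

theorem pd_X (α β : Fin N) : pd α (X β : FormalFun k w) = if α = β then 1 else 0 := by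
  classical
  refine ext_admissible fun m hm => ?_
  rw [coeff_pd, coeff_X]
  have h1 : (if α = β then (1 : FormalFun k w) else 0).coeff m =
      if α = β ∧ m = 0 then 1 else 0 := by
    by_cases h : α = β
    · simp only [h, if_true, true_and]; rw [coeff_one hm]
    · simp [h]
  rw [h1]
  by_cases h : α = β ∧ m = 0
  · obtain ⟨rfl, rfl⟩ := h
    simp [sgn_zero]
  · rw [if_neg h, if_neg, mul_zero]
    intro h2
    have hdeg := congrArg Finsupp.degree h2
    simp only [map_add, Finsupp.degree_single] at hdeg
    have hm0 : m = 0 := (Finsupp.degree_eq_zero_iff m).1 (by omega)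
    subst hm0
    rw [zero_add] at h2
    exact h ⟨Finsupp.single_left_injective one_ne_zero h2, rfl⟩

theorem pd_comm (α β : Fin N) (g : FormalFun k w) :
    pd α (pd β g) = sgn k (w α * w β) • pd β (pd α g) := by
  wlog h : α < β generalizing α β
  · rcases (not_lt.1 h).lt_or_eq with h | rfl
    · rw [this β α h, smul_smul, mul_comm (w α), sgn_mul_self, one_smul]
    · ext m
      rw [coeff_smul]
      rcases Int.even_or_odd (w β) with he | ho
      · rw [sgn_of_even (he.mul_right _), one_mul]
      · have : (pd β (pd β g)).coeff m = 0 := by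
          -- An odd derivative squares to zero, since it reads off a coefficient at a monomial
          -- containing `x^β` twice.
          rw [coeff_pd, coeff_pd, coeff_of_not (fun hA => ?_), mul_zero, mul_zero]
          have := hA β ho
          simp at this
        rw [this, mul_zero]
  · ext m
    rw [coeff_smul, coeff_pd, coeff_pd, coeff_pd, coeff_pd,
      add_right_comm m (Finsupp.single α 1)]
    have h1 : ∑ j with j < β, ((m + Finsupp.single α 1 : Fin N →₀ ℕ) j : ℤ) * w j =
        (∑ j with j < β, (m j : ℤ) * w j) + w α := by
      simp only [Finsupp.add_apply, Nat.cast_add, add_mul, Finset.sum_add_distrib]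
      congr 1
      rw [Finset.sum_eq_single α] <;> simp +contextual [h, eq_comm]
    have h2 : ∑ j with j < α, ((m + Finsupp.single β 1 : Fin N →₀ ℕ) j : ℤ) * w j =
        ∑ j with j < α, (m j : ℤ) * w j := by
      refine Finset.sum_congr rfl fun j hj => ?_
      have : β ≠ j := by
        rintro rfl
        exact absurd (Finset.mem_filter.1 hj).2 h.not_gt
      simp [this]
    rw [h1, h2, mul_add (w β), sgn_add]
    simp only [Finsupp.add_apply, Finsupp.single_apply, h.ne, h.ne', if_false, add_zero]
    rw [mul_comm (w β) (w α)]
    ring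

/-! ### Multiplication by coordinates and the Euler identity -/

theorem coeff_X_mul (α : Fin N) (g : FormalFun k w) (m : Fin N →₀ ℕ)
    (hm : Admissible w (m + Finsupp.single α 1)) :
    (X α * g).coeff (m + Finsupp.single α 1) =
      sgn k (w α * ∑ j with j < α, (m j : ℤ) * w j) * g.coeff m := by
  classical
  rw [coeff_mul hm, Finset.sum_eq_single (Finsupp.single α 1, m)]
  · rw [coeff_X, if_pos rfl, mulExp_single_left, mul_one]
  · rintro ⟨a, b⟩ hx hne
    rw [mem_antidiagonal] at hx
    simp only at hx ⊢
    rw [coeff_X, if_neg, mul_zero, zero_mul]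
    rintro rfl
    rw [add_comm] at hx
    exact hne (by rw [add_right_cancel hx])
  · intro h
    exact absurd (by rw [mem_antidiagonal, add_comm]) h

theorem coeff_X_mul_of_eq_zero (α : Fin N) (g : FormalFun k w) {m : Fin N →₀ ℕ} (h : m α = 0) :
    (X α * g).coeff m = 0 := by
  classical
  by_cases hm : Admissible w m
  · rw [coeff_mul hm]
    refine Finset.sum_eq_zero fun x hx => ?_
    rw [mem_antidiagonal] at hx
    rw [coeff_X, if_neg, mul_zero, zero_mul]
    intro h1
    rw [← hx, h1] at h
    simp at h
  · exact coeff_of_not hm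

theorem exists_eq_add_single {m : Fin N →₀ ℕ} {α : Fin N} (h : m α ≠ 0) :
    ∃ m', m = m' + Finsupp.single α 1 :=
  ⟨m - Finsupp.single α 1, (tsub_add_cancel_of_le (by rw [Finsupp.single_le_iff]; omega)).symm⟩

theorem coeff_X_mul_pd (α : Fin N) (g : FormalFun k w) (m : Fin N →₀ ℕ) :
    (X α * pd α g).coeff m = m α * g.coeff m := by
  by_cases h : m α = 0
  · rw [coeff_X_mul_of_eq_zero α _ h, h, Nat.cast_zero, zero_mul]
  · obtain ⟨m, rfl⟩ := exists_eq_add_single h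
    by_cases hm : Admissible w (m + Finsupp.single α 1)
    · rw [coeff_X_mul _ _ _ hm, coeff_pd]
      have := sgn_mul_self (R := k) (w α * ∑ j with j < α, (m j : ℤ) * w j)
      simp only [Finsupp.add_apply, Finsupp.single_eq_same, Nat.cast_add, Nat.cast_one]
      linear_combination ((m α + 1 : k) * g.coeff (m + Finsupp.single α 1)) * this
    · rw [coeff_of_not hm, coeff_of_not hm, mul_zero]

theorem euler (g : FormalFun k w) (m : Fin N →₀ ℕ) :
    (∑ α, X α * pd α g).coeff m = m.degree * g.coeff m := by
  rw [coeff_sum, Finset.sum_congr rfl fun α _ => coeff_X_mul_pd α g m, ← Finset.sum_mul,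
    Finsupp.degree_eq_sum, Nat.cast_sum]

/-- A formal Hadamard lemma: dividing each coefficient by its polynomial degree inverts the Euler
operator away from the constant term. -/
theorem exists_eq_add_sum_X_mul [CharZero k] (g : FormalFun k w) :
    ∃ h : Fin N → FormalFun k w, g = g.coeff 0 • (1 : FormalFun k w) + ∑ α, X α * h α := by
  classical
  -- At `m = 0` the inverse is the default value `0`; the constant term is supplied separately.
  let u : FormalFun k w := mk fun m => (m.degree : k)⁻¹ * g.coeff m
  refine ⟨fun α => pd α u, ext_admissible fun m hm => ?_⟩
  rw [coeff_add, euler, coeff_smul, coeff_one hm, coeff_mk hm]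
  by_cases h : m = 0
  · subst h; simp
  · have : (m.degree : k) ≠ 0 := by
      rw [Nat.cast_ne_zero]
      exact fun h' => h ((Finsupp.degree_eq_zero_iff m).1 h')
    rw [if_neg h, mul_zero, zero_add, ← mul_assoc, mul_inv_cancel₀ this, one_mul]

end FormalFun

end UnimodularLInfty

/-! ### Derivations, divergence and invariant volume forms -/

namespace UnimodularLInfty

open Finset.HasAntidiagonal (antidiagonal mem_antidiagonal)

open FormalFun

variable {k : Type*} [Field k] {N : ℕ} {w : Fin N → ℤ}

/-! ### Vector fields -/

theorem vectorFieldOf_apply (c : Fin N → FormalFun k w) (g : FormalFun k w) :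
    vectorFieldOf c g = ∑ α, c α * pd α g := by
  simp [vectorFieldOf]

theorem vectorFieldOf_X (c : Fin N → FormalFun k w) (α : Fin N) : vectorFieldOf c (X α) = c α := by
  simp [vectorFieldOf_apply, pd_X]

theorem isVectorField_zero (p : ℤ) : IsVectorField p (0 : FormalFun k w →ₗ[k] FormalFun k w) where
  degree _ _ _ := isHomogeneous_zero _
  leibniz g h := by simp

theorem IsVectorField.add {p : ℤ} {Q Q' : FormalFun k w →ₗ[k] FormalFun k w}
    (hQ : IsVectorField p Q) (hQ' : IsVectorField p Q') : IsVectorField p (Q + Q') where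
  degree r g hg := (hQ.degree r g hg).add (hQ'.degree r g hg)
  leibniz g h := by
    simp only [LinearMap.add_apply, hQ.leibniz, hQ'.leibniz, add_mul, mul_add]
    abel

theorem IsVectorField.sum {ι : Type*} {s : Finset ι} {p : ℤ}
    {Q : ι → FormalFun k w →ₗ[k] FormalFun k w} (h : ∀ i, IsVectorField p (Q i)) :
    IsVectorField p (∑ i ∈ s, Q i) := by
  classical
  induction s using Finset.induction_on with
  | empty => exact isVectorField_zero p
  | insert a s ha ih => rw [Finset.sum_insert ha]; exact (h a).add ih

theorem isVectorField_pd (α : Fin N) : IsVectorField (-w α) (pd α : FormalFun k w →ₗ[k] _) where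
  degree r g hg := by rw [← sub_eq_add_neg]; exact hg.pd α
  leibniz := pd_mul α

theorem IsVectorField.mulLeft {p r : ℤ} {Q : FormalFun k w →ₗ[k] FormalFun k w}
    (hQ : IsVectorField p Q) {c : FormalFun k w} (hc : IsHomogeneous c r) :
    IsVectorField (r + p) (LinearMap.mulLeft k c ∘ₗ Q) where
  degree t g hg := by
    have := hc.mul (hQ.degree t g hg)
    rwa [show r + (t + p) = t + (r + p) by ring] at this
  leibniz g h := by
    simp only [LinearMap.comp_apply, LinearMap.mulLeft_apply, hQ.leibniz, mul_add]
    rw [← mul_assoc c (Q g), ← mul_assoc c (twist p g), mul_comm_of_homogeneous hc (twist p g),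
      twist_twist, mul_assoc (twist (r + p) g)]

theorem isVectorField_mulLeft_pd {p : ℤ} {α : Fin N} {c : FormalFun k w}
    (hc : IsHomogeneous c (p + w α)) :
    IsVectorField p (LinearMap.mulLeft k c ∘ₗ pd α) := by
  have := (isVectorField_pd (k := k) (w := w) α).mulLeft hc
  rwa [add_neg_cancel_right] at this

theorem isVectorField_vectorFieldOf {p : ℤ} {c : Fin N → FormalFun k w}
    (hc : ∀ α, IsHomogeneous (c α) (p + w α)) : IsVectorField p (vectorFieldOf c) :=
  IsVectorField.sum fun α => isVectorField_mulLeft_pd (hc α)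

theorem IsVectorField.homogeneous {p : ℤ} {Q : FormalFun k w →ₗ[k] FormalFun k w}
    (hQ : IsVectorField p Q) (α : Fin N) : IsHomogeneous (Q (X α)) (p + w α) := by
  rw [add_comm]; exact hQ.degree _ _ (isHomogeneous_X α)

/-- A derivation which kills the coordinates is zero. -/
theorem eq_zero_of_leibniz [CharZero k] (p : ℤ) (R : FormalFun k w →ₗ[k] FormalFun k w)
    (hR : ∀ g h, R (g * h) = R g * h + twist p g * R h) (hX : ∀ α, R (X α) = 0) : R = 0 := by
  have h1 : R 1 = 0 := by
    have h := hR 1 1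
    rw [mul_one, mul_one, twist_of_homogeneous isHomogeneous_one, mul_zero, sgn_zero, one_smul,
      one_mul] at h
    simpa using h
  -- No continuity of `R` is assumed. Writing `g = g(0) + ∑ x^α h_α` as a finite sum gives `R g = ∑
  -- ± x^α R h_α`, so a coefficient of `R g` comes from coefficients of lower degree of the `R h_α`;
  -- hence the induction is over all `g` at once.
  have key : ∀ (n : ℕ) (g : FormalFun k w) (m : Fin N →₀ ℕ), m.degree = n →
      (R g).coeff m = 0 := by
    intro n
    induction n using Nat.strong_induction_on with
    | _ n ih =>
      intro g m hm
      obtain ⟨h, hh⟩ := exists_eq_add_sum_X_mul g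
      rw [hh, map_add, map_smul, h1, smul_zero, zero_add, map_sum, coeff_sum]
      refine Finset.sum_eq_zero fun α _ => ?_
      rw [hR, hX, zero_mul, zero_add, twist_of_homogeneous (isHomogeneous_X α),
        smul_mul_assoc, coeff_smul]
      by_cases h0 : m α = 0
      · rw [coeff_X_mul_of_eq_zero α _ h0, mul_zero]
      · obtain ⟨m, rfl⟩ := exists_eq_add_single h0
        by_cases ha : Admissible w (m + Finsupp.single α 1)
        · rw [coeff_X_mul _ _ _ ha, ih m.degree _ _ m rfl, mul_zero, mul_zero]
          rw [← hm, map_add, Finsupp.degree_single]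
          omega
        · rw [coeff_of_not ha, mul_zero]
  exact LinearMap.ext fun g => FormalFun.ext fun m => key _ g m rfl

/-- The difference of the two sides satisfies the Leibniz rule and kills the coordinates. -/
theorem IsVectorField.eq_vectorFieldOf [CharZero k] {p : ℤ}
    {Q : FormalFun k w →ₗ[k] FormalFun k w} (hQ : IsVectorField p Q) :
    Q = vectorFieldOf fun α => Q (X α) := by
  have hV := isVectorField_vectorFieldOf hQ.homogeneous
  refine sub_eq_zero.1 (eq_zero_of_leibniz p _ (fun g h => ?_) fun α => ?_)
  · simp only [LinearMap.sub_apply, hQ.leibniz, hV.leibniz, sub_mul, mul_sub]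
    abel
  · rw [LinearMap.sub_apply, vectorFieldOf_X, sub_self]

theorem IsVectorField.twist_apply [CharZero k] {p : ℤ} {Q : FormalFun k w →ₗ[k] FormalFun k w}
    (hQ : IsVectorField p Q) (q : ℤ) (g : FormalFun k w) :
    twist q (Q g) = sgn k (q * p) • Q (twist q g) := by
  rw [hQ.eq_vectorFieldOf, vectorFieldOf_apply, vectorFieldOf_apply, twist_sum, Finset.smul_sum]
  refine Finset.sum_congr rfl fun α _ => ?_
  rw [twist_mul, twist_of_homogeneous (hQ.homogeneous α), twist_pd, smul_mul_smul_comm,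
    ← sgn_add]
  congr 1
  exact sgn_eq_of_eq (q * w α) (by ring)

/-- For odd `p` the two cross terms in `Q (Q (g h))` cancel, because `twist p` anticommutes with
`Q`. So `Q²` is a derivation of degree `2p`, determined by its values on the coordinates. -/
theorem IsVectorField.square_eq [CharZero k] {p : ℤ} (hp : Odd p)
    {Q : FormalFun k w →ₗ[k] FormalFun k w} (hQ : IsVectorField p Q) :
    Q ∘ₗ Q = 0 ↔ ∀ α, Q (Q (X α)) = 0 := by
  refine ⟨fun h α => LinearMap.congr_fun h (X α), fun h => ?_⟩
  refine eq_zero_of_leibniz (p + p) _ (fun g h => ?_) h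
  simp only [LinearMap.comp_apply, hQ.leibniz, map_add, hQ.twist_apply, twist_twist]
  rw [sgn_of_odd (hp.mul hp), neg_one_smul, neg_mul]
  abel

theorem vanishesAtZero_iff {c : Fin N → FormalFun k w} :
    VanishesAtZero (vectorFieldOf c) ↔ ∀ α, (c α).coeff 0 = 0 := by
  refine ⟨fun h α => ?_, fun h g => ?_⟩
  · rw [← vectorFieldOf_X c α]; exact h _
  · rw [vectorFieldOf_apply, coeff_sum]
    exact Finset.sum_eq_zero fun α _ => by rw [coeff_mul_zero, h, zero_mul]

/-! ### The Lie derivative -/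

theorem Ber.coord_smul (g : FormalFun k w) (ρ : Ber k w) :
    Ber.coord (g • ρ) = g * Ber.coord ρ := by
  rw [map_smul, smul_eq_mul]

theorem Ber.coord_Δ : Ber.coord (Ber.Δ : Ber k w) = 1 := rfl

theorem Ber.eq_coord_smul (ρ : Ber k w) : ρ = Ber.coord ρ • Ber.Δ :=
  Ber.coord.injective (by rw [Ber.coord_smul, Ber.coord_Δ, mul_one])

theorem coord_lieDer (p : ℤ) (Q : FormalFun k w →ₗ[k] FormalFun k w) (ρ : Ber k w) :
    Ber.coord (lieDer p Q ρ) =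
      ∑ α, sgn k (w α * (p + w α)) • pd α (Q (X α) * Ber.coord ρ) := by
  rw [lieDer, Ber.coord_smul, Ber.coord_Δ, mul_one]

theorem divergence_eq (p : ℤ) (Q : FormalFun k w →ₗ[k] FormalFun k w) :
    divergence p Q = ∑ α, sgn k (w α * (p + w α)) • pd α (Q (X α)) := by
  simp only [divergence, coord_lieDer, Ber.coord_Δ, mul_one]

theorem IsVectorField.divergence_homogeneous {p : ℤ} {Q : FormalFun k w →ₗ[k] FormalFun k w}
    (hQ : IsVectorField p Q) : IsHomogeneous (divergence p Q) p := by
  rw [divergence_eq]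
  refine IsHomogeneous.sum fun α _ => IsHomogeneous.smul ?_ _
  have := (hQ.homogeneous α).pd α
  rwa [add_sub_cancel_right] at this

/-- In `∂_α (Q^α g)` the term in which `∂_α` passes `Q^α` acquires exactly the sign put in front in
the definition of `lieDer`; the two cancel and leave `∑ Q^α ∂_α g`. -/
theorem IsVectorField.coord_lieDer_eq [CharZero k] {p : ℤ}
    {Q : FormalFun k w →ₗ[k] FormalFun k w} (hQ : IsVectorField p Q) (ρ : Ber k w) :
    Ber.coord (lieDer p Q ρ) = divergence p Q * Ber.coord ρ + Q (Ber.coord ρ) := by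
  rw [coord_lieDer, divergence_eq, Finset.sum_mul]
  conv_rhs => rw [hQ.eq_vectorFieldOf, vectorFieldOf_apply]
  rw [← Finset.sum_add_distrib]
  refine Finset.sum_congr rfl fun α _ => ?_
  rw [pd_mul, twist_of_homogeneous (hQ.homogeneous α), vectorFieldOf_X, smul_add,
    smul_mul_assoc, smul_mul_assoc, smul_smul, ← sgn_add,
    sgn_of_even (a := w α * (p + w α) + -w α * (p + w α)) ⟨0, by ring⟩, one_smul]

theorem isLieAction_lieDer [CharZero k] : IsLieAction (lieDer (k := k) (w := w)) where
  add p Q Q' _ _ ρ := by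
    apply Ber.coord.injective
    simp only [map_add, coord_lieDer, LinearMap.add_apply, add_mul, smul_add,
      Finset.sum_add_distrib]
  smul_form p Q hQ g ρ := by
    apply Ber.coord.injective
    rw [map_add, Ber.coord_smul, Ber.coord_smul, hQ.coord_lieDer_eq, hQ.coord_lieDer_eq,
      Ber.coord_smul, hQ.leibniz, mul_add, ← mul_assoc, ← mul_assoc,
      mul_comm_of_homogeneous hQ.divergence_homogeneous g]
    abel
  smul_field p Q hQ r g hg ρ := by
    apply Ber.coord.injective
    have hs : Ber.coord (sgn k (r * p) • lieDer p Q (g • ρ)) =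
      sgn k (r * p) • Ber.coord (lieDer p Q (g • ρ)) := rfl
    rw [hs, coord_lieDer, coord_lieDer, Finset.smul_sum]
    refine Finset.sum_congr rfl fun α _ => ?_
    rw [Ber.coord_smul, LinearMap.comp_apply, LinearMap.mulLeft_apply,
      mul_comm_of_homogeneous hg, twist_of_homogeneous (hQ.homogeneous α), smul_mul_assoc,
      smul_mul_assoc, map_smul, smul_smul, smul_smul, mul_assoc, ← sgn_add, ← sgn_add]
    congr 1
    exact sgn_eq_of_eq (r * w α) (by ring)
  pd α := by
    apply Ber.coord.injective
    rw [coord_lieDer, map_zero]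
    refine Finset.sum_eq_zero fun β _ => ?_
    rw [Ber.coord_Δ, mul_one, pd_X]
    split_ifs
    · rw [pd_one, smul_zero]
    · rw [map_zero, smul_zero]

/-- The right-hand side does not mention `L`, so any two actions agree. The Leibniz axiom reduces
`ρ` to `Δ`, additivity reduces `Q` to the fields `Q^α ∂_α`, and the rule for `L_{gV}` moves `Q^α`
onto the form, where `L_{∂_α} Δ = 0` applies. -/
theorem IsLieAction.apply_eq [CharZero k]
    {L : ℤ → (FormalFun k w →ₗ[k] FormalFun k w) → Ber k w → Ber k w} (hL : IsLieAction L)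
    {p : ℤ} {Q : FormalFun k w →ₗ[k] FormalFun k w} (hQ : IsVectorField p Q) (ρ : Ber k w) :
    L p Q ρ = Q (Ber.coord ρ) • Ber.Δ + twist p (Ber.coord ρ) •
      ∑ α, sgn k ((p + w α) * -w α) • (FormalFun.pd α (Q (X α)) • (Ber.Δ : Ber k w)) := by
  -- Linearity in the field is not an axiom; the value at `0` comes from additivity applied to `0 +
  -- 0`.
  have hzero : L p 0 Ber.Δ = 0 := by
    have := hL.add p 0 0 (isVectorField_zero p) (isVectorField_zero p) Ber.Δ
    simpa using this
  have hsum : ∀ s : Finset (Fin N), ∀ Q' : Fin N → FormalFun k w →ₗ[k] FormalFun k w,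
      (∀ α, IsVectorField p (Q' α)) → L p (∑ α ∈ s, Q' α) Ber.Δ = ∑ α ∈ s, L p (Q' α) Ber.Δ := by
    intro s Q' h
    induction s using Finset.induction_on with
    | empty => simpa using hzero
    | insert a s ha ih =>
      rw [Finset.sum_insert ha, Finset.sum_insert ha, hL.add _ _ _ (h a) (IsVectorField.sum h), ih]
  conv_lhs => rw [Ber.eq_coord_smul ρ, hL.smul_form p Q hQ]
  congr 2
  conv_lhs => rw [hQ.eq_vectorFieldOf, vectorFieldOf]
  rw [hsum _ _ fun α => isVectorField_mulLeft_pd (hQ.homogeneous α)]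
  refine Finset.sum_congr rfl fun α _ => ?_
  have := hL.smul_field (-w α) (FormalFun.pd α) (isVectorField_pd α) (p + w α) (Q (X α))
    (hQ.homogeneous α) Ber.Δ
  rw [add_neg_cancel_right] at this
  rw [this, hL.smul_form _ _ (isVectorField_pd α), hL.pd, smul_zero, add_zero]

/-! ### The exponential -/

theorem coeff_eq_zero_of_degree_lt {f : FormalFun k w} (hf : f.coeff 0 = 0) :
    ∀ (r : ℕ) (m : Fin N →₀ ℕ), m.degree < r → (f ^ r).coeff m = 0 := by
  intro r
  induction r with
  | zero => intro m hm; omega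
  | succ r ih =>
    intro m hm
    by_cases hA : Admissible w m
    · rw [pow_succ', coeff_mul hA]
      refine Finset.sum_eq_zero fun x hx => ?_
      rw [mem_antidiagonal] at hx
      by_cases h0 : x.1 = 0
      · rw [h0, hf, mul_zero, zero_mul]
      · rw [ih, mul_zero]
        have h1 : x.1.degree ≠ 0 := fun h => h0 ((Finsupp.degree_eq_zero_iff _).1 h)
        rw [← hx, map_add] at hm
        omega
    · exact coeff_of_not hA

/-- The truncation may be lengthened freely, so coefficients at monomials of different degrees can
be expanded over a common range. -/
theorem coeff_exp {f : FormalFun k w} (hf : f.coeff 0 = 0) (m : Fin N →₀ ℕ) {n : ℕ}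
    (hn : m.degree < n) :
    (exp f).coeff m = ∑ r ∈ Finset.range n, (r.factorial : k)⁻¹ * (f ^ r).coeff m := by
  by_cases hA : Admissible w m
  · rw [exp, coeff_mk hA]
    refine Finset.sum_subset (Finset.range_subset_range.2 hn) fun r _ hr => ?_
    rw [Finset.mem_range, not_lt] at hr
    rw [coeff_eq_zero_of_degree_lt hf r m (by omega), mul_zero]
  · rw [coeff_of_not hA]
    exact (Finset.sum_eq_zero fun r _ => by rw [coeff_of_not hA, mul_zero]).symm

theorem coeff_exp_zero (f : FormalFun k w) : (exp f).coeff 0 = 1 := by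
  rw [exp, coeff_mk Admissible_zero]
  simp [coeff_one_zero]

theorem FormalFun.IsHomogeneous.pow {f : FormalFun k w} (hf : IsHomogeneous f 0) (r : ℕ) :
    IsHomogeneous (f ^ r) 0 := by
  induction r with
  | zero => rw [pow_zero]; exact isHomogeneous_one
  | succ r ih => rw [pow_succ]; simpa using ih.mul hf

/-- A function of degree `0` commutes with everything, so the ordinary power rule holds without
signs. -/
theorem pd_pow {f : FormalFun k w} (hf : IsHomogeneous f 0) (α : Fin N) (r : ℕ) :
    pd α (f ^ (r + 1)) = ((r : k) + 1) • (pd α f * f ^ r) := by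
  induction r with
  | zero => simp
  | succ r ih =>
    have hc : ∀ h, f * h = h * f := fun h => by
      rw [mul_comm_of_homogeneous hf, twist_zero_left]
    rw [pow_succ, pd_mul, ih, twist_of_homogeneous (hf.pow (r + 1)), mul_zero, sgn_zero, one_smul,
      smul_mul_assoc, mul_assoc, ← pow_succ,
      ← ((show Commute f (pd α f) from hc _).symm.pow_right (r + 1)).eq]
    push_cast
    module

theorem pd_exp [CharZero k] {f : FormalFun k w} (hf : IsPotential f) (α : Fin N) :
    pd α (exp f) = pd α f * exp f := by
  refine ext_admissible fun m hm => ?_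
  -- The derivative reads a coefficient of degree `m.degree + 1`, which requires the range `m.degree
  -- + 2`. The term `r = 0` is then removed because `∂_α 1 = 0`.
  have h1 : (pd α (exp f)).coeff m =
      ∑ r ∈ Finset.range (m.degree + 2), (r.factorial : k)⁻¹ * (pd α (f ^ r)).coeff m := by
    rw [coeff_pd, coeff_exp hf.vanishes _ (n := m.degree + 2), Finset.mul_sum]
    · refine Finset.sum_congr rfl fun r _ => ?_
      rw [coeff_pd]; ring
    · rw [map_add, Finsupp.degree_single]; omega
  rw [h1, Finset.sum_range_succ', pow_zero, pd_one, coeff_zero, mul_zero, add_zero, coeff_mul hm]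
  have h2 : ∀ x ∈ antidiagonal m,
      sgn k (mulExp w x.1 x.2) * (pd α f).coeff x.1 * (exp f).coeff x.2 =
      ∑ r ∈ Finset.range (m.degree + 1), (r.factorial : k)⁻¹ * (sgn k (mulExp w x.1 x.2) *
        (pd α f).coeff x.1 * (f ^ r).coeff x.2) := by
    intro x hx
    rw [mem_antidiagonal] at hx
    rw [coeff_exp hf.vanishes x.2 (n := m.degree + 1) (by rw [← hx, map_add]; omega),
      Finset.mul_sum]
    exact Finset.sum_congr rfl fun r _ => by ring
  rw [Finset.sum_congr rfl h2, Finset.sum_comm]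
  refine Finset.sum_congr rfl fun r _ => ?_
  rw [← Finset.mul_sum, ← coeff_mul hm, pd_pow hf.homogeneous, coeff_smul, Nat.factorial_succ,
    Nat.cast_mul, mul_inv, ← mul_assoc]
  congr 1
  have : ((r : k) + 1) ≠ 0 := by exact_mod_cast Nat.succ_ne_zero r
  push_cast
  field_simp

theorem IsVectorField.apply_exp [CharZero k] {p : ℤ} {Q : FormalFun k w →ₗ[k] FormalFun k w}
    (hQ : IsVectorField p Q) {f : FormalFun k w} (hf : IsPotential f) :
    Q (exp f) = Q f * exp f := by
  rw [hQ.eq_vectorFieldOf, vectorFieldOf_apply, vectorFieldOf_apply, Finset.sum_mul]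
  exact Finset.sum_congr rfl fun α _ => by rw [pd_exp hf, mul_assoc]

/-- If the coefficients of `g` of lower degree vanish, then the coefficient of `g u` at `m` is `g_m
u_0`. This allows `e^f` to be cancelled without constructing its inverse. -/
theorem eq_zero_of_mul_eq_zero {g u : FormalFun k w} (hu : u.coeff 0 ≠ 0) (h : g * u = 0) :
    g = 0 := by
  have key : ∀ (n : ℕ) (m : Fin N →₀ ℕ), m.degree = n → g.coeff m = 0 := by
    intro n
    induction n using Nat.strong_induction_on with
    | _ n ih =>
      intro m hmn
      by_cases hm : Admissible w m
      · have h1 : (g * u).coeff m = 0 := by rw [h, coeff_zero]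
        rw [coeff_mul hm, Finset.sum_eq_single (m, 0)] at h1
        · simpa [sgn_ne_zero, hu] using h1
        · rintro ⟨a, b⟩ hx hne
          rw [mem_antidiagonal] at hx
          simp only at hx ⊢
          have hb : b.degree ≠ 0 := fun hb => hne (by
            rw [Finsupp.degree_eq_zero_iff] at hb
            subst hb
            rw [← hx, add_zero])
          have : m.degree = a.degree + b.degree := by rw [← hx, map_add]
          rw [ih a.degree (by omega) a rfl, mul_zero, zero_mul]
        · intro hx
          exact absurd (by rw [mem_antidiagonal, add_zero]) hx
      · exact coeff_of_not hm
  exact FormalFun.ext fun m => key _ m rfl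

theorem IsVectorField.lieDer_volumeForm [CharZero k] {p : ℤ}
    {Q : FormalFun k w →ₗ[k] FormalFun k w} (hQ : IsVectorField p Q) {f : FormalFun k w}
    (hf : IsPotential f) :
    lieDer p Q (volumeForm f) = (divergence p Q + Q f) • volumeForm f := by
  apply Ber.coord.injective
  rw [hQ.coord_lieDer_eq, Ber.coord_smul, volumeForm, Ber.coord_smul, Ber.coord_Δ, mul_one,
    hQ.apply_exp hf, add_mul]

theorem IsVectorField.lieDer_volumeForm_eq_zero_iff [CharZero k] {p : ℤ}
    {Q : FormalFun k w →ₗ[k] FormalFun k w} (hQ : IsVectorField p Q) {f : FormalFun k w}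
    (hf : IsPotential f) :
    divergence p Q + Q f = 0 ↔ lieDer p Q (volumeForm f) = 0 := by
  rw [hQ.lieDer_volumeForm hf]
  refine ⟨fun h => by rw [h, zero_smul], fun h => ?_⟩
  have := congrArg Ber.coord h
  rw [map_zero, volumeForm, Ber.coord_smul, Ber.coord_smul, Ber.coord_Δ, mul_one] at this
  exact eq_zero_of_mul_eq_zero (by rw [coeff_exp_zero]; exact one_ne_zero) this

end UnimodularLInfty

/-! ### Power series as symmetric functions of lists of indices -/

namespace UnimodularLInfty

open FormalFun

/-! ### Lists of arguments -/

theorem ofFn_snoc {X : Type*} {n : ℕ} (β : Fin n → X) (a : X) :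
    List.ofFn (Fin.snoc (α := fun _ => X) β a) = List.ofFn β ++ [a] := by
  rw [List.ofFn_succ', List.concat_eq_append]
  simp

/-- A family of functions of several variables as a function of lists. -/
def onList {X W : Type*} (φ : ∀ n : ℕ, (Fin n → X) → W) (l : List X) : W := φ l.length l.get

/-- Lists absorb the dependence on the number of arguments: tuples indexed by `Fin n` and by `Fin
(I.card + 1)` can be compared as lists, without casts between index types. -/
theorem onList_ofFn {X W : Type*} (φ : ∀ n : ℕ, (Fin n → X) → W) {n : ℕ} (β : Fin n → X) :
    onList φ (List.ofFn β) = φ n β := by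
  have key : ∀ (l : List X) (h : l.length = n), (∀ i : Fin n, l.get (Fin.cast h.symm i) = β i) →
      onList φ l = φ n β := by
    rintro l rfl h
    rw [onList]
    congr 1
    exact funext h
  exact key _ (List.length_ofFn) fun i => by simp

theorem sum_filter_lt_snoc {n : ℕ} (p : Fin (n + 1) → ℤ) :
    ∑ x : Fin (n + 1) × Fin (n + 1) with x.1 < x.2, p x.1 * p x.2 =
      (∑ x : Fin n × Fin n with x.1 < x.2, p x.1.castSucc * p x.2.castSucc) +
        (∑ i : Fin n, p i.castSucc) * p (Fin.last n) := by
  simp only [Finset.sum_filter, Fintype.sum_prod_type, Fin.sum_univ_castSucc, Finset.sum_mul]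
  simp [Fin.castSucc_lt_last, Finset.sum_add_distrib, not_lt.2 (Fin.le_last _)]

variable {k : Type*} [Field k] {N : ℕ} {w : Fin N → ℤ}

/-! ### Taylor coefficients -/

variable (k w) in
/-- The iterated derivative `∂_{a 0} ⋯ ∂_{a (n-1)}`. -/
noncomputable def iterPd : List (Fin N) → FormalFun k w →ₗ[k] FormalFun k w
  | [] => LinearMap.id
  | a :: l => pd a ∘ₗ iterPd l

/-- The Taylor coefficients `∂_{a 0} ⋯ ∂_{a (n-1)} g` at the point `0`. -/
noncomputable def taylor (g : FormalFun k w) (l : List (Fin N)) : k := (iterPd k w l g).coeff 0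

theorem iterPd_append (l l' : List (Fin N)) (g : FormalFun k w) :
    iterPd k w (l ++ l') g = iterPd k w l (iterPd k w l' g) := by
  induction l with
  | nil => rfl
  | cons a l ih => exact congrArg (pd a) ih

theorem taylor_nil (g : FormalFun k w) : taylor g [] = g.coeff 0 := rfl

theorem taylor_append_singleton (g : FormalFun k w) (l : List (Fin N)) (c : Fin N) :
    taylor g (l ++ [c]) = taylor (pd c g) l := by
  rw [taylor, iterPd_append]; rfl

theorem taylor_add (g h : FormalFun k w) (l : List (Fin N)) :
    taylor (g + h) l = taylor g l + taylor h l := by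
  rw [taylor, map_add]; rfl

theorem taylor_smul (c : k) (g : FormalFun k w) (l : List (Fin N)) :
    taylor (c • g) l = c * taylor g l := by
  rw [taylor, map_smul]; rfl

theorem taylor_zero (l : List (Fin N)) : taylor (0 : FormalFun k w) l = 0 := by
  rw [taylor, map_zero]; rfl

theorem taylor_sum {ι : Type*} (s : Finset ι) (g : ι → FormalFun k w) (l : List (Fin N)) :
    taylor (∑ i ∈ s, g i) l = ∑ i ∈ s, taylor (g i) l := by
  simp only [taylor, map_sum, coeff_sum]

variable (w) in
/-- Graded symmetry of a function of lists, for exchanges of neighbours. -/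
def IsSymm (Φ : List (Fin N) → k) : Prop :=
  ∀ l a b l', Φ (l ++ a :: b :: l') = sgn k (w a * w b) * Φ (l ++ b :: a :: l')

theorem IsSymm.snoc {Φ : List (Fin N) → k} (h : IsSymm w Φ) (c : Fin N) :
    IsSymm w fun l => Φ (l ++ [c]) := fun l a b l' => by
  simpa using h l a b (l' ++ [c])

theorem isSymm_taylor (g : FormalFun k w) : IsSymm w (taylor g) := fun l a b l' => by
  rw [taylor, taylor, iterPd_append, iterPd_append]
  have : iterPd k w (a :: b :: l') g = sgn k (w a * w b) • iterPd k w (b :: a :: l') g :=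
    pd_comm a b _
  rw [this, map_smul, coeff_smul]

/-- Moving an argument from the end to the place in front of `l'`. -/
theorem IsSymm.move {Φ : List (Fin N) → k} (h : IsSymm w Φ) (l l' : List (Fin N)) (c : Fin N) :
    Φ (l ++ (l' ++ [c])) = sgn k (w c * (l'.map w).sum) * Φ (l ++ c :: l') := by
  induction l' generalizing l with
  | nil => simp [sgn_zero]
  | cons a l' ih =>
    have h1 := ih (l ++ [a])
    simp only [List.append_assoc, List.cons_append, List.nil_append] at h1 ⊢
    rw [h1, h l a c l', ← mul_assoc, ← sgn_add]
    congr 2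
    simp; ring

theorem isHomogeneous_iterPd {g : FormalFun k w} {r : ℤ} (hg : IsHomogeneous g r)
    (l : List (Fin N)) : IsHomogeneous (iterPd k w l g) (r - (l.map w).sum) := by
  induction l with
  | nil => rw [List.map_nil, List.sum_nil, sub_zero]; exact hg
  | cons a l ih =>
    have := ih.pd a
    rwa [sub_sub, add_comm _ (w a), ← List.sum_cons, ← List.map_cons] at this

theorem FormalFun.IsHomogeneous.sum_eq_of_taylor_ne_zero {g : FormalFun k w} {r : ℤ}
    (hg : IsHomogeneous g r) {l : List (Fin N)} (hl : taylor g l ≠ 0) : (l.map w).sum = r := by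
  have := isHomogeneous_iterPd hg l 0 hl
  rw [mdeg_zero] at this
  omega

/-! ### Functions with given Taylor coefficients -/

variable (w) in
/-- The homogeneous function of length `n` with given Taylor coefficients. -/
noncomputable def homPart (n : ℕ) (Φ : List (Fin N) → k) : FormalFun k w :=
  homogeneousPart w n fun β => Φ (List.ofFn β)

theorem isHomogeneous_prod_X (l : List (Fin N)) :
    IsHomogeneous ((l.map (X (k := k) (w := w))).prod) (l.map w).sum := by
  induction l with
  | nil => exact isHomogeneous_one
  | cons a l ih =>
    rw [List.map_cons, List.prod_cons, List.map_cons, List.sum_cons]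
    exact (isHomogeneous_X a).mul ih

theorem prod_ofFn_X_eq {n : ℕ} (β : Fin n → Fin N) :
    (List.ofFn fun i => X (k := k) (w := w) (β i)).prod =
      ((List.ofFn β).map X).prod := by
  rw [List.map_ofFn]; rfl

theorem sum_map_ofFn {n : ℕ} (β : Fin n → Fin N) :
    ((List.ofFn β).map w).sum = ∑ i, w (β i) := by
  rw [List.map_ofFn, List.sum_ofFn]; rfl

theorem homPart_zero (Φ : List (Fin N) → k) : homPart w 0 Φ = Φ [] • 1 := by
  simp [homPart, homogeneousPart, sgn_zero]

/-- Splits off the last argument. Moving `x^α` from the end of the monomial to its front costs the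
sign that the pairs involving the last position contribute to the definition, so no sign remains. -/
theorem homPart_succ (n : ℕ) (Φ : List (Fin N) → k) :
    homPart w (n + 1) Φ =
      ((n : k) + 1)⁻¹ • ∑ α, X α * homPart w n fun l => Φ (l ++ [α]) := by
  have h : ∀ (α : Fin N) (β : Fin n → Fin N),
      (sgn k (∑ x : Fin (n + 1) × Fin (n + 1) with x.1 < x.2,
        w (Fin.snoc (α := fun _ => Fin N) β α x.1) * w (Fin.snoc (α := fun _ => Fin N) β α x.2)) *
        Φ (List.ofFn (Fin.snoc (α := fun _ => Fin N) β α))) •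
      (List.ofFn fun i => X (k := k) (w := w) (Fin.snoc (α := fun _ => Fin N) β α i)).prod =
      X α * ((sgn k (∑ x : Fin n × Fin n with x.1 < x.2, w (β x.1) * w (β x.2)) *
        Φ (List.ofFn β ++ [α])) • (List.ofFn fun i => X (k := k) (w := w) (β i)).prod) := by
    intro α β
    rw [prod_ofFn_X_eq, prod_ofFn_X_eq, ofFn_snoc, List.map_append, List.prod_append,
      sum_filter_lt_snoc (fun i => w (Fin.snoc (α := fun _ => Fin N) β α i))]
    simp only [Fin.snoc_castSucc, Fin.snoc_last, List.map_cons, List.map_nil, List.prod_singleton]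
    rw [mul_comm_of_homogeneous (isHomogeneous_prod_X _), twist_of_homogeneous (isHomogeneous_X α),
      sum_map_ofFn, mul_smul_comm, smul_mul_assoc, smul_smul, sgn_add]
    congr 1
    have := sgn_mul_self (R := k) ((∑ i, w (β i)) * w α)
    linear_combination (sgn k (∑ x : Fin n × Fin n with x.1 < x.2, w (β x.1) * w (β x.2)) *
        Φ (List.ofFn β ++ [α])) * this
  rw [homPart, homogeneousPart, ← (Fin.snocEquiv fun _ : Fin (n + 1) => Fin N).sum_comp,
    Fintype.sum_prod_type, Nat.factorial_succ, Nat.cast_mul, mul_inv, mul_smul, Finset.smul_sum,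
    Nat.cast_succ]
  congr 1
  refine Finset.sum_congr rfl fun α _ => ?_
  rw [homPart, homogeneousPart, mul_smul_comm, Finset.mul_sum]
  congr 1
  exact Finset.sum_congr rfl fun β _ => h α β

theorem pd_X_mul (γ α : Fin N) (g : FormalFun k w) :
    pd γ (X α * g) = (if γ = α then g else 0) + sgn k (w γ * w α) • (X α * pd γ g) := by
  rw [pd_mul, pd_X, twist_of_homogeneous (isHomogeneous_X α), smul_mul_assoc, neg_mul, sgn_neg]
  split_ifs <;> simp

/-- In the recursion of `homPart_succ`, `∂_γ` either removes the front coordinate, giving the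
desired function once, or passes it. By induction and the symmetry of the last two arguments the
second case gives the same function as many times as there are remaining arguments. The total
multiplicity cancels the denominator. -/
theorem pd_homPart [CharZero k] (n : ℕ) {Φ : List (Fin N) → k} (hΦ : IsSymm w Φ) (γ : Fin N) :
    pd γ (homPart w (n + 1) Φ) = homPart w n fun l => Φ (l ++ [γ]) := by
  induction n generalizing Φ γ with
  | zero => simp [homPart_succ, homPart_zero, pd_X]
  | succ n ih =>
    have hne : ((n : k) + 1) ≠ 0 := by exact_mod_cast Nat.succ_ne_zero n
    have hne' : ((n : k) + 1 + 1) ≠ 0 := by exact_mod_cast Nat.succ_ne_zero (n + 1)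
    have h1 : ∑ α, X α * homPart w n (fun l => Φ (l ++ [α] ++ [γ])) =
        ((n : k) + 1) • homPart w (n + 1) fun l => Φ (l ++ [γ]) := by
      rw [homPart_succ, smul_smul, mul_inv_cancel₀ hne, one_smul]
    have h2 : ∀ α, pd γ (homPart w (n + 1) fun l => Φ (l ++ [α])) =
        sgn k (w γ * w α) • homPart w n fun l => Φ (l ++ [α] ++ [γ]) := by
      intro α
      rw [ih (hΦ.snoc α) γ, homPart, homPart, homogeneousPart, homogeneousPart, smul_comm]
      congr 1
      rw [Finset.smul_sum]
      refine Finset.sum_congr rfl fun β _ => ?_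
      rw [smul_smul]
      congr 1
      have := hΦ (List.ofFn β) γ α []
      simp only [List.append_assoc, List.cons_append, List.nil_append]
      rw [this]
      ring
    rw [homPart_succ, map_smul, map_sum, Finset.sum_congr rfl fun α _ => pd_X_mul γ α _,
      Finset.sum_add_distrib, Finset.sum_ite_eq, if_pos (Finset.mem_univ _)]
    have h3 : ∀ α, sgn k (w γ * w α) • (X α * pd γ (homPart w (n + 1) fun l => Φ (l ++ [α]))) =
        X α * homPart w n (fun l => Φ (l ++ [α] ++ [γ])) := by
      intro α
      rw [h2, mul_smul_comm, smul_smul, sgn_mul_self, one_smul]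
    rw [Finset.sum_congr rfl fun α _ => h3 α, h1, Nat.cast_succ, smul_add, smul_smul,
      ← add_smul, ← mul_one_add, add_comm 1, inv_mul_cancel₀ hne', one_smul]

variable (w) in
/-- The function with given Taylor coefficients. -/
noncomputable def ofTaylor (Φ : List (Fin N) → k) : FormalFun k w :=
  totalFunction w fun _ β => Φ (List.ofFn β)

theorem totalFunction_eq_ofTaylor (φ : ∀ n : ℕ, (Fin n → Fin N) → k) :
    totalFunction w φ = ofTaylor w (onList φ) := by
  rw [ofTaylor]
  congr 1
  funext n β
  exact (onList_ofFn φ β).symm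

theorem coeff_ofTaylor (Φ : List (Fin N) → k) (m : Fin N →₀ ℕ) :
    (ofTaylor w Φ).coeff m = (homPart w m.degree Φ).coeff m := by
  by_cases hm : Admissible w m
  · exact coeff_mk hm
  · rw [coeff_of_not hm, coeff_of_not hm]

theorem pd_ofTaylor [CharZero k] {Φ : List (Fin N) → k} (hΦ : IsSymm w Φ) (γ : Fin N) :
    pd γ (ofTaylor w Φ) = ofTaylor w fun l => Φ (l ++ [γ]) := by
  ext m
  rw [coeff_pd, coeff_ofTaylor, coeff_ofTaylor, ← pd_homPart _ hΦ, coeff_pd, map_add,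
    Finsupp.degree_single]

theorem taylor_ofTaylor [CharZero k] {Φ : List (Fin N) → k} (hΦ : IsSymm w Φ)
    (l : List (Fin N)) : taylor (ofTaylor w Φ) l = Φ l := by
  induction l using List.reverseRecOn generalizing Φ with
  | nil => rw [taylor_nil, coeff_ofTaylor, map_zero, homPart_zero, coeff_smul, coeff_one_zero,
      mul_one]
  | append_singleton l c ih => rw [taylor_append_singleton, pd_ofTaylor hΦ, ih (hΦ.snoc c)]

/-- By induction on the degree, the recursion for the homogeneous part becomes the Euler identity:
its summands have the coefficients of `x^α ∂_α g`, which are multiples of those of `g`. -/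
theorem ofTaylor_taylor [CharZero k] (g : FormalFun k w) : ofTaylor w (taylor g) = g := by
  have key : ∀ (n : ℕ) (g : FormalFun k w) (m : Fin N →₀ ℕ), m.degree = n →
      (homPart w n (taylor g)).coeff m = g.coeff m := by
    intro n
    induction n with
    | zero =>
      intro g m hm
      rw [Finsupp.degree_eq_zero_iff] at hm
      subst hm
      rw [homPart_zero, coeff_smul, coeff_one_zero, taylor_nil, mul_one]
    | succ n ih =>
      intro g m hm
      have h : ∀ α, (X α * homPart w n fun l => taylor g (l ++ [α])).coeff m =
          m α * g.coeff m := by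
        intro α
        rw [← coeff_X_mul_pd]
        simp only [taylor_append_singleton]
        by_cases h0 : m α = 0
        · rw [coeff_X_mul_of_eq_zero α _ h0, coeff_X_mul_of_eq_zero α _ h0]
        · obtain ⟨m, rfl⟩ := exists_eq_add_single h0
          by_cases hA : Admissible w (m + Finsupp.single α 1)
          · rw [coeff_X_mul _ _ _ hA, coeff_X_mul _ _ _ hA]
            rw [map_add, Finsupp.degree_single, Nat.add_right_cancel_iff] at hm
            rw [← ih (pd α g) m hm]
          · rw [coeff_of_not hA, coeff_of_not hA]
      rw [homPart_succ, coeff_smul, coeff_sum, Finset.sum_congr rfl fun α _ => h α,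
        ← Finset.sum_mul, ← Nat.cast_sum, ← Finsupp.degree_eq_sum, hm, ← mul_assoc, Nat.cast_succ,
        inv_mul_cancel₀ (by exact_mod_cast Nat.succ_ne_zero n), one_mul]
  ext m
  rw [coeff_ofTaylor, key _ g m rfl]

theorem taylor_injective [CharZero k] {g h : FormalFun k w} (H : ∀ l, taylor g l = taylor h l) :
    g = h := by
  rw [← ofTaylor_taylor g, ← ofTaylor_taylor h, funext H]

theorem isHomogeneous_ofTaylor {Φ : List (Fin N) → k} {r : ℤ}
    (h : ∀ l, Φ l ≠ 0 → (l.map w).sum = r) : IsHomogeneous (ofTaylor w Φ) r := by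
  intro m hm
  rw [coeff_ofTaylor] at hm
  refine IsHomogeneous.smul (IsHomogeneous.sum fun β _ => ?_) _ m hm
  by_cases h0 : Φ (List.ofFn β) = 0
  · simp only [h0, mul_zero, zero_smul]; exact isHomogeneous_zero r
  · rw [← h _ h0, prod_ofFn_X_eq]
    exact (isHomogeneous_prod_X _).smul _

theorem coeff_single_eq_taylor (g : FormalFun k w) (β : Fin N) :
    g.coeff (Finsupp.single β 1) = taylor g [β] := by
  have : taylor g [β] = (pd β g).coeff 0 := rfl
  rw [this, coeff_pd]
  simp [sgn_zero]

end UnimodularLInfty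

namespace UnimodularLInfty

open FormalFun

/-! ### The Leibniz rule for iterated derivatives -/

/-- Connects the increasing enumeration of `I` used for shuffles with the sublists that arise in an
induction over the list of derivatives. -/
theorem ofFn_restrict {X : Type*} {n : ℕ} (v : Fin n → X) (I : Finset (Fin n)) :
    List.ofFn (restrict v I) = ((List.finRange n).filter (· ∈ I)).map v := by
  have h : List.ofFn (I.orderEmbOfFin rfl) = (List.finRange n).filter (· ∈ I) := by
    refine List.SortedLT.eq_of_mem_iff ?_ ?_ fun a => ?_
    · exact List.sortedLT_ofFn_iff.2 (I.orderEmbOfFin rfl).strictMono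
    · exact ((List.pairwise_lt_finRange n).filter _).sortedLT
    · simp [List.mem_ofFn', Finset.range_orderEmbOfFin]
  rw [← h, List.map_ofFn]
  rfl

theorem sum_map_filter {n : ℕ} {L : List (Fin n)} (hL : L.Nodup) (t : Finset (Fin n))
    (f : Fin n → ℤ) : ((L.filter (· ∉ t)).map f).sum = ∑ j ∈ L.toFinset \ t, f j := by
  rw [← List.sum_toFinset f (hL.filter _), List.toFinset_filter]
  congr 1
  ext j
  simp

variable {k : Type*} [Field k] {N : ℕ} {w : Fin N → ℤ}

/-- Here `I` is the set of positions whose derivative falls on `h`. As `L` is increasing, later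
positions act first; so the derivative at `i ∈ I` passes `a` after it has been differentiated at the
positions `j > i` outside `I`, and the degree of that function appears in the sign. -/
theorem iterPd_mul {n : ℕ} (β : Fin n → Fin N) {a : FormalFun k w} {r : ℤ}
    (ha : IsHomogeneous a r) (h : FormalFun k w) (L : List (Fin n)) (hL : L.Pairwise (· < ·)) :
    iterPd k w (L.map β) (a * h) = ∑ I ∈ L.toFinset.powerset,
      sgn k (∑ i ∈ I, w (β i) * (r - ∑ j ∈ L.toFinset \ I with i < j, w (β j))) •
        (iterPd k w ((L.filter (· ∉ I)).map β) a * iterPd k w ((L.filter (· ∈ I)).map β) h) := by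
  induction L with
  | nil => simp [iterPd, sgn_zero]
  | cons i L ih =>
    rw [List.pairwise_cons] at hL
    have hi : i ∉ L := fun h => lt_irrefl _ (hL.1 i h)
    have hnd : L.Nodup := hL.2.sortedLT.nodup
    have hstep : iterPd k w ((i :: L).map β) (a * h) =
      pd (β i) (iterPd k w (L.map β) (a * h)) := rfl
    -- The two terms of the Leibniz rule for the new outermost derivative match the subsets without
    -- `i` and those with `i`.
    rw [hstep, ih hL.2, List.toFinset_cons, Finset.sum_powerset_insert (by simpa using hi),
      map_sum, ← Finset.sum_add_distrib]
    refine Finset.sum_congr rfl fun t ht => ?_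
    rw [Finset.mem_powerset] at ht
    have hit : i ∉ t := fun h => hi (by simpa using ht h)
    have hlt : ∀ x ∈ t, ¬ x < i := fun x hx =>
      (hL.1 x (by simpa using ht hx)).not_gt
    have hf1 : (i :: L).filter (· ∉ t) = i :: L.filter (· ∉ t) := by simp [hit]
    have hf2 : (i :: L).filter (· ∈ t) = L.filter (· ∈ t) := by simp [hit]
    have hf3 : (i :: L).filter (· ∉ insert i t) = L.filter (· ∉ t) := by
      rw [List.filter_cons_of_neg (by simp)]
      refine List.filter_congr fun x hx => ?_
      have : x ≠ i := fun h => hi (h ▸ hx)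
      simp [this]
    have hf4 : (i :: L).filter (· ∈ insert i t) = i :: L.filter (· ∈ t) := by
      rw [List.filter_cons_of_pos (by simp)]
      congr 1
      refine List.filter_congr fun x hx => ?_
      have : x ≠ i := fun h => hi (h ▸ hx)
      simp [this]
    have hs1 : ∀ x ∈ t, ∑ j ∈ insert i L.toFinset \ t with x < j, w (β j) =
        ∑ j ∈ L.toFinset \ t with x < j, w (β j) := by
      intro x hx
      rw [Finset.insert_sdiff_of_notMem _ hit, Finset.filter_insert, if_neg (hlt x hx)]
    have hs2 : insert i L.toFinset \ insert i t = L.toFinset \ t := by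
      ext x
      simp only [Finset.mem_sdiff, Finset.mem_insert, List.mem_toFinset]
      constructor
      · rintro ⟨h1 | h1, h2⟩
        · exact absurd (Or.inl h1) h2
        · exact ⟨h1, fun h => h2 (Or.inr h)⟩
      · rintro ⟨h1, h2⟩
        refine ⟨Or.inr h1, ?_⟩
        rintro (h | h)
        · exact hi (h ▸ h1)
        · exact h2 h
    have hs3 : ∑ j ∈ L.toFinset \ t with i < j, w (β j) = ∑ j ∈ L.toFinset \ t, w (β j) := by
      rw [Finset.filter_true_of_mem]
      intro x hx
      exact hL.1 x (by simpa using (Finset.mem_sdiff.1 hx).1)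
    rw [hf1, hf2, hf3, hf4, hs2, Finset.sum_insert hit, hs3, map_smul, pd_mul,
      twist_of_homogeneous (isHomogeneous_iterPd ha _), List.map_map, sum_map_filter hnd,
      smul_add, smul_mul_assoc, smul_smul, ← sgn_add]
    congr 2
    · congr 1
      exact Finset.sum_congr rfl fun x hx => by rw [hs1 x hx]
    · refine sgn_eq_of_eq (-(w (β i) * (r - ∑ j ∈ L.toFinset \ t, w (β j)))) ?_
      simp only [Function.comp_apply]
      ring

/-- At the origin only those derivatives of `c γ` survive whose total degree is that of `c γ`. The
degree still carried by `c γ` when a derivative at `i ∈ I` passes it is then the sum over the `j <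
i` outside `I`, which is the Koszul sign of the shuffle. -/
theorem taylor_vectorFieldOf {c : Fin N → FormalFun k w} {p : ℤ}
    (hc : ∀ α, IsHomogeneous (c α) (p + w α)) (g : FormalFun k w) {n : ℕ} (β : Fin n → Fin N) :
    taylor (vectorFieldOf c g) (List.ofFn β) = ∑ I : Finset (Fin n),
      sgn k (shuffleKoszul (w ∘ β) I) * ∑ γ, taylor (c γ) (List.ofFn (restrict β Iᶜ)) *
        taylor g (List.ofFn (restrict β I) ++ [γ]) := by
  have h : ∀ γ, taylor (c γ * pd γ g) (List.ofFn β) = ∑ I : Finset (Fin n),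
      sgn k (shuffleKoszul (w ∘ β) I) * (taylor (c γ) (List.ofFn (restrict β Iᶜ)) *
        taylor g (List.ofFn (restrict β I) ++ [γ])) := by
    intro γ
    have hl : List.ofFn β = (List.finRange n).map β := by
      rw [List.finRange, List.map_ofFn]; rfl
    rw [taylor, hl, iterPd_mul β (hc γ) _ _ (List.pairwise_lt_finRange n),
      List.toFinset_finRange, Finset.powerset_univ, coeff_sum]
    refine Finset.sum_congr rfl fun I _ => ?_
    rw [coeff_smul, coeff_mul_zero, ofFn_restrict, ofFn_restrict, taylor_append_singleton,
      taylor, taylor]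
    have hcompl : (List.finRange n).filter (· ∈ Iᶜ) = (List.finRange n).filter (· ∉ I) :=
      List.filter_congr fun x _ => by simp
    rw [hcompl]
    by_cases h0 : (iterPd k w (((List.finRange n).filter (· ∉ I)).map β) (c γ)).coeff 0 = 0
    · rw [h0]; simp
    · congr 1
      have hr := (hc γ).sum_eq_of_taylor_ne_zero h0
      rw [List.map_map, sum_map_filter (List.nodup_finRange n), List.toFinset_finRange] at hr
      rw [← hr]
      congr 1
      rw [shuffleKoszul, Finset.sum_filter, Fintype.sum_prod_type, ← Finset.univ_inter I,
        ← Finset.sum_ite_mem, Finset.univ_inter]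
      refine Finset.sum_congr rfl fun x _ => ?_
      by_cases hx : x ∈ I
      · have hI : Finset.univ \ I = Finset.univ.filter (· ∉ I) := by ext; simp
        rw [if_pos hx, hI, Finset.filter_filter, Finset.sum_filter, Finset.sum_filter,
          ← Finset.sum_sub_distrib, Finset.mul_sum]
        refine Finset.sum_congr rfl fun y _ => ?_
        by_cases hy : y ∈ I
        · simp [hy]
        · have hne : x ≠ y := fun h => hy (h ▸ hx)
          rcases hne.lt_or_gt with h | h
          · simp [hx, hy, h, h.not_gt]
          · simp [hx, hy, h, h.not_gt]
      · simp [hx]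
  rw [vectorFieldOf_apply, taylor_sum, Finset.sum_congr rfl fun γ _ => h γ, Finset.sum_comm]
  exact Finset.sum_congr rfl fun I _ => (Finset.mul_sum _ _ _).symm

end UnimodularLInfty

/-! ### Sign rules for permutations, shuffles and the degree shift -/

namespace UnimodularLInfty

open FormalFun

/-! ### Koszul signs of permutations -/

section Koszul

variable {n : ℕ}

theorem koszul_eq (σ : Equiv.Perm (Fin n)) (p : Fin n → ℤ) :
    koszul σ p = ∑ x, ∑ y, if x < y ∧ σ y < σ x then p (σ x) * p (σ y) else 0 := by
  rw [koszul, Finset.sum_filter, Fintype.sum_prod_type]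

theorem koszul_one (p : Fin n → ℤ) : koszul (1 : Equiv.Perm (Fin n)) p = 0 := by
  rw [koszul]
  refine Finset.sum_eq_zero fun x hx => ?_
  have := (Finset.mem_filter.1 hx).2
  exact absurd this.1 this.2.not_gt

/-- The sum over ordered pairs of a symmetric function with zero diagonal is twice the sum over `x <
y`, and the former is invariant under permutations. -/
theorem sum_lt_comp_perm (F : Fin n → Fin n → ℤ) (hF : ∀ x y, F x y = F y x)
    (h0 : ∀ x, F x x = 0) (τ : Equiv.Perm (Fin n)) :
    (∑ x, ∑ y, if x < y then F (τ x) (τ y) else 0) = ∑ x, ∑ y, if x < y then F x y else 0 := by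
  have key : ∀ G : Fin n → Fin n → ℤ, (∀ x y, G x y = G y x) → (∀ x, G x x = 0) →
      ∑ x, ∑ y, G x y = 2 * ∑ x, ∑ y, if x < y then G x y else 0 := by
    intro G hG hG0
    have h1 : ∀ x y, G x y = (if x < y then G x y else 0) + if y < x then G y x else 0 := by
      intro x y
      rcases lt_trichotomy x y with h | h | h
      · simp [h, h.not_gt]
      · simp [h, hG0]
      · simp [h, h.not_gt, hG x y]
    rw [two_mul]
    nth_rewrite 3 [Finset.sum_comm]
    rw [← Finset.sum_add_distrib]
    refine Finset.sum_congr rfl fun x _ => ?_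
    rw [← Finset.sum_add_distrib]
    exact Finset.sum_congr rfl fun y _ => h1 x y
  have h2 := key (fun x y => F (τ x) (τ y)) (fun _ _ => hF _ _) fun _ => h0 _
  have h3 := key F hF h0
  have h4 : ∑ x, ∑ y, F (τ x) (τ y) = ∑ x, ∑ y, F x y := by
    rw [← Equiv.sum_comp τ (fun x => ∑ y, F x y)]
    exact Finset.sum_congr rfl fun x _ => Equiv.sum_comp τ (fun y => F (τ x) y)
  omega

/-- A pair is inverted by `σ * τ` exactly when one, but not both, of the two steps inverts it; the
pairs inverted twice contribute an even amount. -/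
theorem sgn_koszul_mul (R : Type*) [Ring R] (σ τ : Equiv.Perm (Fin n)) (p : Fin n → ℤ) :
    sgn R (koszul (σ * τ) p) = sgn R (koszul σ p) * sgn R (koszul τ (p ∘ σ)) := by
  -- The weight of an inversion of `σ`, made symmetric in the pair so that the pairs may be
  -- relabelled by `τ`.
  let F : Fin n → Fin n → ℤ := fun u v =>
    if (u < v ∧ σ v < σ u) ∨ (v < u ∧ σ u < σ v) then p (σ u) * p (σ v) else 0
  have hF : ∀ x y, F x y = F y x := fun x y => by
    simp only [F, or_comm (a := x < y ∧ _), mul_comm (p (σ x))]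
  have h1 : koszul σ p = ∑ x, ∑ y, if x < y then F (τ x) (τ y) else 0 := by
    rw [sum_lt_comp_perm F hF (fun x => by simp [F]), koszul_eq]
    refine Finset.sum_congr rfl fun x _ => Finset.sum_congr rfl fun y _ => ?_
    by_cases h : x < y
    · simp [F, h, h.not_gt]
    · simp [h]
  rw [← sgn_add]
  refine sgn_eq_of_eq (-∑ x, ∑ y, if x < y ∧ τ y < τ x then F (τ x) (τ y) else 0) ?_
  rw [h1, koszul_eq, koszul_eq, mul_neg, Finset.mul_sum, ← Finset.sum_add_distrib,
    ← sub_eq_add_neg, ← Finset.sum_sub_distrib]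
  refine Finset.sum_congr rfl fun x _ => ?_
  rw [Finset.mul_sum, ← Finset.sum_add_distrib, ← Finset.sum_sub_distrib]
  refine Finset.sum_congr rfl fun y _ => ?_
  by_cases h : x < y
  · have hne : τ x ≠ τ y := fun h' => h.ne (τ.injective h')
    have hne' : σ (τ x) ≠ σ (τ y) := fun h' => hne (σ.injective h')
    rcases hne.lt_or_gt with h2 | h2 <;> rcases hne'.lt_or_gt with h3 | h3 <;>
      simp [F, h, h2, h2.not_gt, h3, h3.not_gt]
    ring
  · simp [h]

theorem koszul_swap {i : ℕ} (hi : i + 1 < n) (p : Fin n → ℤ) :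
    koszul (Equiv.swap (⟨i, by omega⟩ : Fin n) ⟨i + 1, hi⟩) p =
      p ⟨i, by omega⟩ * p ⟨i + 1, hi⟩ := by
  have : (Finset.univ.filter fun x : Fin n × Fin n => x.1 < x.2 ∧
      Equiv.swap (⟨i, by omega⟩ : Fin n) ⟨i + 1, hi⟩ x.2 <
        Equiv.swap (⟨i, by omega⟩ : Fin n) ⟨i + 1, hi⟩ x.1) =
      {((⟨i, by omega⟩ : Fin n), (⟨i + 1, hi⟩ : Fin n))} := by
    ext ⟨x, y⟩
    simp only [Finset.mem_filter, Finset.mem_univ, true_and, Finset.mem_singleton, Prod.mk.injEq,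
      Equiv.swap_apply_def, Fin.ext_iff, Fin.lt_def]
    split_ifs <;> (try simp only) <;> omega
  rw [koszul, this, Finset.sum_singleton, Equiv.swap_apply_left, Equiv.swap_apply_right, mul_comm]

/-- Adjacent transpositions generate the symmetric group. -/
theorem perm_induction {P : Equiv.Perm (Fin n) → Prop} (h1 : P 1)
    (hmul : ∀ σ τ, P σ → P τ → P (σ * τ))
    (hswap : ∀ (i : ℕ) (hi : i + 1 < n), P (Equiv.swap ⟨i, by omega⟩ ⟨i + 1, hi⟩))
    (σ : Equiv.Perm (Fin n)) : P σ := by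
  cases n with
  | zero => rwa [Subsingleton.elim σ 1]
  | succ n =>
    have hσ : σ ∈ Submonoid.closure
        (Set.range fun i : Fin n => Equiv.swap i.castSucc i.succ) := by
      rw [Equiv.Perm.mclosure_swap_castSucc_succ]; trivial
    induction hσ using Submonoid.closure_induction with
    | mem x hx =>
      obtain ⟨i, rfl⟩ := hx
      exact hswap i (by omega)
    | one => exact h1
    | mul x y _ _ hx hy => exact hmul x y hx hy

theorem ofFn_swap {X : Type*} (β : Fin n → X) {i : ℕ} (hi : i + 1 < n) :
    List.ofFn β = (List.ofFn β).take i ++ β ⟨i, by omega⟩ :: β ⟨i + 1, hi⟩ ::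
      (List.ofFn β).drop (i + 2) ∧
    List.ofFn (β ∘ Equiv.swap (⟨i, by omega⟩ : Fin n) ⟨i + 1, hi⟩) =
      (List.ofFn β).take i ++ β ⟨i + 1, hi⟩ :: β ⟨i, by omega⟩ ::
      (List.ofFn β).drop (i + 2) := by
  have hlen : ∀ a b, n = ((List.ofFn β).take i ++ a :: b :: (List.ofFn β).drop (i + 2)).length := by
    intro a b
    simp; omega
  constructor
  · refine List.ext_getElem (by rw [List.length_ofFn]; exact hlen _ _) fun j h1 h2 => ?_
    simp only [List.length_ofFn] at h1
    rw [List.getElem_append]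
    simp only [List.getElem_cons, List.length_take, List.length_ofFn, List.getElem_ofFn,
      List.getElem_take, List.getElem_drop]
    split_ifs <;> congr 2 <;> omega
  · refine List.ext_getElem (by rw [List.length_ofFn]; exact hlen _ _) fun j h1 h2 => ?_
    simp only [List.length_ofFn] at h1
    rw [List.getElem_append]
    simp only [List.getElem_cons, List.length_take, List.length_ofFn, List.getElem_ofFn,
      List.getElem_take, List.getElem_drop, Function.comp_apply, Equiv.swap_apply_def,
      Fin.mk.injEq]
    split_ifs <;> congr 2 <;> omega

end Koszul

/-! ### Shifting signs -/

section Shift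

variable {N : ℕ} (deg : Fin N → ℤ)

/-- The coefficient `n - 1 - x` counts the positions after `x`. As a sum over pairs, the exponent
can be compared with shuffle exponents term by term. -/
theorem shiftExp_eq {n : ℕ} (β : Fin n → Fin N) :
    shiftExp deg β = ∑ x, ∑ y, if x < y then deg (β x) - 1 else 0 := by
  refine Finset.sum_congr rfl fun x _ => ?_
  rw [← Finset.sum_filter, Finset.sum_const, nsmul_eq_mul]
  congr 1
  have : (Finset.univ.filter fun y => x < y) = Finset.Ioi x := by ext; simp
  rw [this, Fin.card_Ioi]
  have := x.2
  omega

theorem sum_orderEmbOfFin {n : ℕ} (I : Finset (Fin n)) (f : Fin n → ℤ) :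
    ∑ a, f (I.orderEmbOfFin rfl a) = ∑ x, if x ∈ I then f x else 0 := by
  rw [Finset.sum_ite_mem, Finset.univ_inter]
  have : I = Finset.univ.map (I.orderEmbOfFin rfl).toEmbedding := by
    ext x
    simp
  conv_rhs => rw [this]
  rw [Finset.sum_map]
  rfl

theorem shiftExp_restrict {n : ℕ} (β : Fin n → Fin N) (I : Finset (Fin n)) :
    shiftExp deg (restrict β I) =
      ∑ x, ∑ y, if x ∈ I ∧ y ∈ I ∧ x < y then deg (β x) - 1 else 0 := by
  have h : ∀ a, (∑ b, if a < b then deg (restrict β I a) - 1 else 0) =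
      ∑ y, if y ∈ I then (if I.orderEmbOfFin rfl a < y then
        deg (β (I.orderEmbOfFin rfl a)) - 1 else 0) else 0 := by
    intro a
    rw [← sum_orderEmbOfFin]
    refine Finset.sum_congr rfl fun b _ => ?_
    simp [restrict]
  rw [shiftExp_eq, Finset.sum_congr rfl fun a _ => h a,
    sum_orderEmbOfFin I fun x => ∑ y, if y ∈ I then (if x < y then deg (β x) - 1 else 0) else 0]
  refine Finset.sum_congr rfl fun x _ => ?_
  by_cases hx : x ∈ I
  · rw [if_pos hx]
    refine Finset.sum_congr rfl fun y _ => ?_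
    by_cases hy : y ∈ I <;> simp [hx, hy]
  · simp [hx]

theorem shiftExp_snoc {n : ℕ} (β : Fin n → Fin N) (a : Fin N) :
    shiftExp deg (Fin.snoc (α := fun _ => Fin N) β a) =
      shiftExp deg β - ∑ i, coordDeg deg (β i) := by
  rw [shiftExp, shiftExp, Fin.sum_univ_castSucc, ← Finset.sum_sub_distrib]
  simp only [Fin.snoc_castSucc, Fin.snoc_last, Fin.val_castSucc, Fin.val_last]
  push_cast
  rw [add_sub_cancel_right, sub_self, zero_mul, add_zero]
  exact Finset.sum_congr rfl fun i _ => by rw [coordDeg]; ring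

theorem shiftExp_swap {n : ℕ} (β : Fin n → Fin N) {i : ℕ} (hi : i + 1 < n) :
    shiftExp deg (β ∘ Equiv.swap (⟨i, by omega⟩ : Fin n) ⟨i + 1, hi⟩) =
      shiftExp deg β + (deg (β ⟨i + 1, hi⟩) - deg (β ⟨i, by omega⟩)) := by
  set a : Fin n := ⟨i, by omega⟩ with ha
  set b : Fin n := ⟨i + 1, hi⟩ with hb
  have hab : a ≠ b := by simp [ha, hb]
  have h1 : shiftExp deg (β ∘ Equiv.swap a b) =
      ∑ x : Fin n, ((n : ℤ) - 1 - (Equiv.swap a b x : Fin n)) * (deg (β x) - 1) := by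
    rw [shiftExp, ← Equiv.sum_comp (Equiv.swap a b)]
    simp
  rw [h1, shiftExp, ← sub_eq_iff_eq_add', ← Finset.sum_sub_distrib,
    Finset.sum_eq_add a b hab]
  · rw [Equiv.swap_apply_left, Equiv.swap_apply_right]
    simp only [ha, hb]
    push_cast
    ring
  · intro c _ hc
    rw [Equiv.swap_apply_of_ne_of_ne hc.1 hc.2, sub_self]
  · simp
  · simp

theorem card_mul_eq {n : ℕ} (I : Finset (Fin n)) (f : Fin n → ℤ) :
    (Iᶜ.card : ℤ) * ∑ i ∈ I, f i = ∑ x, ∑ y, if x ∈ I ∧ y ∉ I then f x else 0 := by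
  rw [Finset.mul_sum, ← Finset.univ_inter I, ← Finset.sum_ite_mem, Finset.univ_inter]
  refine Finset.sum_congr rfl fun x _ => ?_
  by_cases hx : x ∈ I
  · have : (Finset.univ.filter fun y => y ∉ I) = Iᶜ := by ext; simp
    simp only [hx, if_true, true_and]
    rw [← Finset.sum_filter, Finset.sum_const, this, nsmul_eq_mul]
  · simp [hx]

/-- The comparison of the signs on `V[1]` and on `V` for the insertion of an operation. -/
theorem sgn_shuffleKoszul_mul (R : Type*) [CommRing R] {n : ℕ} (β : Fin n → Fin N)
    (I : Finset (Fin n)) :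
    sgn R (shuffleKoszul (coordDeg deg ∘ β) I) * sgn R (shiftExp deg (restrict β Iᶜ)) *
      sgn R (shiftExp deg (restrict β I)) = sgn R (shiftExp deg β) *
      sgn R (insertExp (deg ∘ β) I) := by
  -- The pairs of positions lie inside `I`, inside its complement, or are mixed in one of the two
  -- orders.
  have hsplit : shiftExp deg β = shiftExp deg (restrict β I) + shiftExp deg (restrict β Iᶜ) +
      (∑ x, ∑ y, if x ∈ I ∧ y ∉ I ∧ x < y then deg (β x) - 1 else 0) +
      ∑ x, ∑ y, if x ∈ I ∧ y ∉ I ∧ y < x then deg (β y) - 1 else 0 := by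
    rw [shiftExp_restrict, shiftExp_restrict, shiftExp_eq,
      Finset.sum_comm (f := fun x y => if x ∈ I ∧ y ∉ I ∧ y < x then deg (β y) - 1 else 0)]
    simp only [← Finset.sum_add_distrib]
    refine Finset.sum_congr rfl fun x _ => Finset.sum_congr rfl fun y _ => ?_
    by_cases hx : x ∈ I <;> by_cases hy : y ∈ I <;> simp [hx, hy]
  have hcard : (I.card : ℤ) * (Iᶜ.card : ℤ) = ∑ x, ∑ y, if x ∈ I ∧ y ∉ I then 1 else 0 := by
    rw [← card_mul_eq I fun _ => 1]; simp [mul_comm]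
  rw [← sgn_add, ← sgn_add, ← sgn_add]
  refine sgn_eq_of_eq (-(∑ x, ∑ y, if x ∈ I ∧ y ∉ I ∧ y < x then deg (β y) else 0) -
    ∑ i ∈ I, deg (β i)) ?_
  have hins : insertExp (deg ∘ β) I = shuffleExp I + (I.card : ℤ) * (Iᶜ.card : ℤ) +
      shuffleKoszul (deg ∘ β) I + 2 * ∑ i ∈ I, deg (β i) -
      ∑ x, ∑ y, if x ∈ I ∧ y ∉ I then deg (β x) else 0 := by
    rw [insertExp, ← card_mul_eq I fun i => deg (β i)]
    simp only [Function.comp_apply]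
    ring
  -- Only mixed pairs are left, and the identity holds for each pair separately.
  have key : shuffleKoszul (coordDeg deg ∘ β) I -
      (∑ x, ∑ y, if x ∈ I ∧ y ∉ I ∧ x < y then deg (β x) - 1 else 0) -
      (∑ x, ∑ y, if x ∈ I ∧ y ∉ I ∧ y < x then deg (β y) - 1 else 0) - shuffleExp I -
      (I.card : ℤ) * (Iᶜ.card : ℤ) - shuffleKoszul (deg ∘ β) I +
      (∑ x, ∑ y, if x ∈ I ∧ y ∉ I then deg (β x) else 0) +
      2 * (∑ x, ∑ y, if x ∈ I ∧ y ∉ I ∧ y < x then deg (β y) else 0) = 0 := by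
    rw [hcard, shuffleKoszul, shuffleKoszul, shuffleExp]
    simp only [Finset.sum_filter, Fintype.sum_prod_type, Finset.mul_sum,
      ← Finset.sum_add_distrib, ← Finset.sum_sub_distrib]
    refine Finset.sum_eq_zero fun x _ => Finset.sum_eq_zero fun y _ => ?_
    by_cases hx : x ∈ I
    · by_cases hy : y ∈ I
      · simp [hy]
      · have hne : x ≠ y := fun h => hy (h ▸ hx)
        rcases hne.lt_or_gt with h | h
        · simp [hx, hy, h, h.not_gt]
        · simp [hx, hy, h, h.not_gt, coordDeg]
          ring
    · simp [hx]
  rw [hins, hsplit]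
  linear_combination key

end Shift

/-! ### Skew-symmetric forms on `V` and symmetric forms on `V[1]` -/

section Skew

variable {k : Type*} [Field k] {N : ℕ} {deg : Fin N → ℤ}

variable (deg) in
/-- Graded skew-symmetry of a family of functions of basis vectors. -/
def IsSkew (ψ : ∀ n : ℕ, (Fin n → Fin N) → k) : Prop :=
  ∀ (n : ℕ) (β : Fin n → Fin N) (σ : Equiv.Perm (Fin n)),
    ψ n (β ∘ σ) = (((Equiv.Perm.sign σ : ℤ) : k) * sgn k (koszul σ (deg ∘ β))) * ψ n β

/-- The core of the comparison between `V` and `V[1]`: the change of the shift sign, the sign of a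
transposition and the Koszul sign on `V` combine to the Koszul sign for the shifted degrees. -/
theorem sgn_swap_aux (a b : ℤ) :
    sgn k (b - a) * (-1) * sgn k (a * b) = sgn k ((1 - a) * (1 - b)) := by
  rw [← sgn_one (R := k), ← sgn_add, ← sgn_add]
  exact sgn_eq_of_eq b (by ring)

theorem IsSkew.isSymm {ψ : ∀ n : ℕ, (Fin n → Fin N) → k} (h : IsSkew deg ψ) :
    IsSymm (coordDeg deg) (onList fun n β => sgn k (shiftExp deg β) * ψ n β) := by
  intro l a b l'
  obtain ⟨n, β, hβ⟩ : ∃ (n : ℕ) (β : Fin n → Fin N), List.ofFn β = l ++ a :: b :: l' :=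
    ⟨_, _, List.ofFn_get _⟩
  have hn : n = l.length + (l'.length + 2) := by
    have := congrArg List.length hβ
    simpa using this
  have hi : l.length + 1 < n := by omega
  obtain ⟨h1, h2⟩ := ofFn_swap β hi
  have ha : β ⟨l.length, by omega⟩ = a := by
    have : (List.ofFn β)[l.length]'(by simp; omega) = a := by simp [hβ]
    simpa using this
  have hb : β ⟨l.length + 1, hi⟩ = b := by
    have : (List.ofFn β)[l.length + 1]'(by simp; omega) = b := by
      simp [hβ]
    simpa using this
  have ht : (List.ofFn β).take l.length = l := by rw [hβ]; simp
  have hd : (List.ofFn β).drop (l.length + 2) = l' := by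
    rw [hβ, List.drop_append]; simp
  rw [ha, hb, ht, hd] at h2
  rw [← h2, ← hβ, onList_ofFn, onList_ofFn, h, shiftExp_swap, koszul_swap, Equiv.Perm.sign_swap
    (by simp), sgn_add]
  simp only [Function.comp_apply, ha, hb, coordDeg]
  rw [← sgn_swap_aux]
  push_cast
  have e1 := sgn_mul_self (R := k) (deg b - deg a)
  have e2 := sgn_mul_self (R := k) (deg a * deg b)
  linear_combination (-(sgn k (shiftExp deg β) * ψ n β * sgn k (deg b - deg a) ^ 2)) * e2 -
    sgn k (shiftExp deg β) * ψ n β * e1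

/-- Symmetry is given for neighbours only. Adjacent transpositions generate all permutations, and
both the signature and the Koszul sign are compatible with products. -/
theorem IsSymm.isSkew {Φ : List (Fin N) → k} (h : IsSymm (coordDeg deg) Φ) :
    IsSkew deg fun _ β => sgn k (shiftExp deg β) * Φ (List.ofFn β) := by
  intro n β σ
  induction σ using perm_induction generalizing β with
  | h1 =>
    rw [koszul_one]
    simp [sgn_zero]
  | hmul σ τ hσ hτ =>
    have : β ∘ ⇑(σ * τ) = (β ∘ σ) ∘ τ := rfl
    rw [this, hτ, hσ, sgn_koszul_mul, Equiv.Perm.sign_mul, Function.comp_assoc]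
    push_cast
    ring
  | hswap i hi =>
    obtain ⟨h1, h2⟩ := ofFn_swap β hi
    beta_reduce
    rw [h2, h _ _ _ _, ← h1, shiftExp_swap, koszul_swap, Equiv.Perm.sign_swap (by simp), sgn_add]
    simp only [Function.comp_apply, coordDeg]
    set a := deg (β ⟨i, by omega⟩)
    set b := deg (β ⟨i + 1, hi⟩)
    rw [mul_comm (1 - b), ← sgn_swap_aux]
    push_cast
    have e1 := sgn_mul_self (R := k) (b - a)
    linear_combination (-(sgn k (shiftExp deg β) * Φ (List.ofFn β) * sgn k (a * b))) * e1

end Skew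

end UnimodularLInfty

/-! ### Insertions of brackets evaluated on a homogeneous basis -/

namespace UnimodularLInfty

open FormalFun

/-! ### Homogeneous bases -/

section HomogeneousBasis

variable {k V : Type*} [Field k] [AddCommGroup V] [Module k V]
  {𝒱 : ℤ → Submodule k V} [DirectSum.Decomposition 𝒱]
  {N : ℕ} {e : Module.Basis (Fin N) k V} {deg : Fin N → ℤ}

/-- The projection to degree `p` fixes `v` and annihilates every basis vector of another degree. -/
theorem deg_eq_of_repr_ne_zero (he : ∀ α, e α ∈ 𝒱 (deg α)) {p : ℤ} {v : V} (hv : v ∈ 𝒱 p)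
    {β : Fin N} (h : e.repr v β ≠ 0) : deg β = p := by
  by_contra hne
  apply h
  let P : V →ₗ[k] V := (𝒱 p).subtype ∘ₗ DirectSum.component k ℤ (fun i => 𝒱 i) p ∘ₗ
    (DirectSum.decomposeLinearEquiv 𝒱).toLinearMap
  have hP : ∀ x, P x = (DirectSum.decompose 𝒱 x p : V) := fun _ => rfl
  have hPe : ∀ α, P (e α) = if deg α = p then e α else 0 := by
    intro α
    rw [hP]
    split_ifs with h
    · exact DirectSum.decompose_of_mem_same 𝒱 (h ▸ he α)
    · exact DirectSum.decompose_of_mem_ne 𝒱 (he α) h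
  have h1 : P v = v := by rw [hP]; exact DirectSum.decompose_of_mem_same 𝒱 hv
  rw [← h1, ← e.sum_repr v, map_sum]
  simp only [map_smul, hPe]
  rw [map_sum, Finset.sum_apply']
  refine Finset.sum_eq_zero fun α _ => ?_
  split_ifs with h2
  · have : α ≠ β := fun h3 => hne (h3 ▸ h2)
    simp [this]
  · simp

theorem parity_apply (he : ∀ α, e α ∈ 𝒱 (deg α)) (α : Fin N) :
    parity 𝒱 (e α) = sgn k (deg α) • e α := by
  rw [parity, LinearMap.comp_apply, LinearEquiv.coe_coe, DirectSum.decomposeLinearEquiv_apply,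
    DirectSum.decompose_of_mem 𝒱 (he α)]
  exact DirectSum.toModule_lof k (deg α) _

theorem gradedTrace_eq (he : ∀ α, e α ∈ 𝒱 (deg α)) (F : V →ₗ[k] V) :
    gradedTrace 𝒱 F = ∑ α, sgn k (deg α) * e.repr (F (e α)) α := by
  rw [gradedTrace, LinearMap.trace_eq_matrix_trace k e, Matrix.trace]
  refine Finset.sum_congr rfl fun α _ => ?_
  rw [Matrix.diag_apply, LinearMap.toMatrix_apply, LinearMap.comp_apply]
  generalize F (e α) = y
  conv_lhs => rw [← e.sum_repr y, map_sum, map_sum, Finset.sum_apply']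
  rw [Finset.sum_eq_single α]
  · rw [map_smul, parity_apply he, map_smul, map_smul]
    simp [mul_comm]
  · intro β _ hβ
    rw [map_smul, parity_apply he, map_smul, map_smul]
    simp [hβ]
  · simp

end HomogeneousBasis

/-! ### Operations on basis vectors -/

section Operations

variable {k V : Type*} [Field k] [AddCommGroup V] [Module k V]

theorem multilinear_snoc_repr {N : ℕ} (e : Module.Basis (Fin N) k V) {n : ℕ}
    (ψ : MultilinearMap k (fun _ : Fin (n + 1) => V) k) (v : Fin n → V) (y : V) :
    ψ (Fin.snoc (α := fun _ => V) v y) =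
      ∑ γ, e.repr y γ * ψ (Fin.snoc (α := fun _ => V) v (e γ)) := by
  have h : ∀ x, ψ (Fin.snoc (α := fun _ => V) v x) = ψ.curryRight v x := fun _ => rfl
  simp only [h]
  conv_lhs => rw [← e.sum_repr y]
  rw [map_sum]
  exact Finset.sum_congr rfl fun γ _ => by rw [map_smul, smul_eq_mul]

theorem multilinear_update_repr {N : ℕ} (e : Module.Basis (Fin N) k V) {n : ℕ}
    (ψ : MultilinearMap k (fun _ : Fin n => V) k) (v : Fin n → V) (j : Fin n) (y : V) :
    ψ (Function.update v j y) = ∑ γ, e.repr y γ * ψ (Function.update v j (e γ)) := by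
  have h : ∀ x, ψ (Function.update v j x) = ψ.toLinearMap v j x := fun _ => rfl
  simp only [h]
  conv_lhs => rw [← e.sum_repr y]
  rw [map_sum]
  exact Finset.sum_congr rfl fun γ _ => by rw [map_smul, smul_eq_mul]

theorem restrict_eq_onList {X W : Type*} (φ : ∀ n : ℕ, (Fin n → X) → W) {n : ℕ} (v : Fin n → X)
    {J : Finset (Fin n)} {j : Fin n} (hJ : J = {j}) :
    φ J.card (restrict v J) = onList φ [v j] := by
  have hf : (List.finRange n).filter (· ∈ J) = [j] := by
    refine List.SortedLT.eq_of_mem_iff ?_ ?_ fun a => ?_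
    · exact ((List.pairwise_lt_finRange n).filter _).sortedLT
    · exact (List.pairwise_singleton _ _).sortedLT
    · simp [hJ]
  rw [← onList_ofFn φ (restrict v J), ofFn_restrict, hf, List.map_singleton]

theorem bracket_restrict_singleton (s : Operations k V) {n : ℕ} (v : Fin n → V)
    {J : Finset (Fin n)} {j : Fin n} (hJ : J = {j}) :
    bracket s J.card (restrict v J) = -s.d (v j) :=
  restrict_eq_onList (bracket s) v hJ

theorem bracket_of_ne_one (s : Operations k V) {n : ℕ} (hn : n ≠ 1) (v : Fin n → V) :
    bracket s n v = s.ℓ n v := by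
  match n with
  | 0 => rfl
  | 1 => exact absurd rfl hn
  | n + 2 => rfl

/-- Splitting off the terms with the differential from a sum over all insertions of brackets. -/
theorem sum_insert_bracket (s : Operations k V) (h1 : s.ℓ 1 = 0)
    (ψ : ∀ n : ℕ, MultilinearMap k (fun _ : Fin n => V) k) {n : ℕ} (v : Fin n → V)
    (p : Fin n → ℤ) :
    ∑ I : Finset (Fin n), sgn k (insertExp p I) * ψ (I.card + 1)
      (Fin.snoc (α := fun _ => V) (restrict v I) (bracket s Iᶜ.card (restrict v Iᶜ))) =
    insertSum s ψ v p - ∑ j : Fin n, sgn k (insertExp p {j}ᶜ) * ψ (({j}ᶜ : Finset (Fin n)).card + 1)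
      (Fin.snoc (α := fun _ => V) (restrict v {j}ᶜ) (s.d (v j))) := by
  -- The two sums of insertions differ only where the inner operation is unary, that is, for `I` the
  -- complement of a point `j`; there `bracket` is `-d` while `ℓ 1 = 0`.
  rw [eq_sub_iff_add_eq', ← eq_sub_iff_add_eq, insertSum, ← Finset.sum_sub_distrib]
  refine Finset.sum_of_injOn (fun j => {j}ᶜ) ?_ (fun _ _ => Finset.mem_coe.2 (Finset.mem_univ _))
    ?_ ?_
  · intro i _ j _ h
    simpa using h
  · intro I _ hI
    have hcard : Iᶜ.card ≠ 1 := by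
      intro h
      obtain ⟨j, hj⟩ := Finset.card_eq_one.1 h
      exact hI ⟨j, by simp, compl_eq_comm.1 hj⟩
    rw [bracket_of_ne_one s hcard, smul_eq_mul, sub_self]
  · intro j _
    have hJ : (({j}ᶜ : Finset (Fin n))ᶜ) = {j} := compl_compl _
    have hℓ : s.ℓ (({j}ᶜ : Finset (Fin n))ᶜ).card (restrict v ({j}ᶜ)ᶜ) = 0 := by
      have := restrict_eq_onList (fun n v => s.ℓ n v) v hJ
      beta_reduce at this
      rw [this]
      change s.ℓ 1 _ = 0
      rw [h1]; rfl
    have hsnoc : ∀ y, ψ (({j}ᶜ : Finset (Fin n)).card + 1)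
        (Fin.snoc (α := fun _ => V) (restrict v {j}ᶜ) y) =
        (ψ (({j}ᶜ : Finset (Fin n)).card + 1)).curryRight (restrict v {j}ᶜ) y := fun _ => rfl
    rw [bracket_restrict_singleton s v hJ, hℓ, hsnoc, hsnoc, hsnoc, map_neg, map_zero]
    simp

variable {N : ℕ} {e : Module.Basis (Fin N) k V} {deg : Fin N → ℤ}

theorem mem_of_repr_ne_zero {𝒱 : ℤ → Submodule k V} (he : ∀ α, e α ∈ 𝒱 (deg α)) {p : ℤ} {v : V}
    (h : ∀ α, e.repr v α ≠ 0 → deg α = p) : v ∈ 𝒱 p := by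
  rw [← e.sum_repr v]
  refine Submodule.sum_mem _ fun α _ => ?_
  by_cases h0 : e.repr v α = 0
  · rw [h0, zero_smul]; exact Submodule.zero_mem _
  · rw [← h α h0]; exact Submodule.smul_mem _ _ (he α)

theorem finRange_eq_append {n : ℕ} (j : Fin n) :
    List.finRange n =
      (List.finRange n).filter (· < j) ++ j :: (List.finRange n).filter (j < ·) := by
  refine List.SortedLT.eq_of_mem_iff (List.sortedLT_finRange n) ?_ fun a => ?_
  · refine List.Pairwise.sortedLT (List.pairwise_append.2
      ⟨(List.pairwise_lt_finRange n).filter _, List.pairwise_cons.2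
        ⟨fun a ha => by simpa using ha, (List.pairwise_lt_finRange n).filter _⟩, ?_⟩)
    intro a ha b hb
    have ha' : a < j := by simpa using ha
    rcases List.mem_cons.1 hb with rfl | hb
    · exact ha'
    · exact ha'.trans (by simpa using hb)
  · simp only [List.mem_finRange, List.mem_append, List.mem_filter, List.mem_cons, true_and,
      decide_eq_true_eq, true_iff]
    exact lt_trichotomy a j

theorem filter_compl_singleton {n : ℕ} (j : Fin n) :
    (List.finRange n).filter (· ∈ ({j}ᶜ : Finset (Fin n))) =
      (List.finRange n).filter (· < j) ++ (List.finRange n).filter (j < ·) := by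
  conv_lhs => rw [finRange_eq_append j]
  rw [List.filter_append, List.filter_cons_of_neg (by simp), List.filter_filter, List.filter_filter]
  congr 1 <;> refine List.filter_congr fun x _ => ?_
  · by_cases h : x < j
    · simp [h, h.ne]
    · simp [h]
  · by_cases h : j < x
    · simp [h, h.ne']
    · simp [h]

theorem ofFn_update {n : ℕ} (β : Fin n → Fin N) (j : Fin n) (γ : Fin N) :
    List.ofFn (Function.update β j γ) = ((List.finRange n).filter (· < j)).map β ++
      γ :: ((List.finRange n).filter (j < ·)).map β := by
  have : List.ofFn (Function.update β j γ) = (List.finRange n).map (Function.update β j γ) := by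
    rw [List.finRange, List.map_ofFn]; rfl
  rw [this]
  conv_lhs => rw [finRange_eq_append j]
  rw [List.map_append, List.map_cons, Function.update_self]
  congr 1
  · refine List.map_congr_left fun x hx => ?_
    have hx' : x < j := by simpa using hx
    exact Function.update_of_ne hx'.ne _ _
  · congr 1
    refine List.map_congr_left fun x hx => ?_
    have hx' : j < x := by simpa using hx
    exact Function.update_of_ne hx'.ne' _ _

theorem shiftExp_update {n : ℕ} (β : Fin n → Fin N) (j : Fin n) (γ : Fin N) :
    shiftExp deg (Function.update β j γ) =
      shiftExp deg β + ((n : ℤ) - 1 - (j : ℕ)) * (deg γ - deg (β j)) := by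
  rw [shiftExp, shiftExp, ← sub_eq_iff_eq_add', ← Finset.sum_sub_distrib, Finset.sum_eq_single j]
  · rw [Function.update_self]; ring
  · intro x _ hx
    rw [Function.update_of_ne hx, sub_self]
  · simp

theorem sum_compl_singleton {n : ℕ} (j : Fin n) (f : Fin n → ℤ) :
    ((((List.finRange n).filter (· ∈ ({j}ᶜ : Finset (Fin n)))).map f)).sum =
      (∑ i with i < j, f i) + ∑ i with j < i, f i := by
  rw [filter_compl_singleton, List.map_append, List.sum_append,
    ← List.sum_toFinset f ((List.nodup_finRange n).filter _),
    ← List.sum_toFinset f ((List.nodup_finRange n).filter _)]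
  congr 2 <;> ext <;> simp

theorem sum_map_filter_gt {n : ℕ} (j : Fin n) (f : Fin n → ℤ) :
    (((List.finRange n).filter (j < ·)).map f).sum = ∑ i with j < i, f i := by
  rw [← List.sum_toFinset f ((List.nodup_finRange n).filter _)]
  congr 1
  ext; simp

theorem shuffleKoszul_compl_singleton {n : ℕ} (p : Fin n → ℤ) (j : Fin n) :
    shuffleKoszul p {j}ᶜ = (∑ i with j < i, p i) * p j := by
  rw [shuffleKoszul, Finset.sum_filter, Fintype.sum_prod_type, Finset.sum_filter, Finset.sum_mul]
  refine Finset.sum_congr rfl fun x _ => ?_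
  rw [Finset.sum_eq_single j]
  · by_cases h : j < x
    · simp [h, h.ne']
    · simp [h]
  · intro y _ hy
    simp [hy]
  · simp

theorem shiftExp_singleton {n : ℕ} (β : Fin n → Fin N) (j : Fin n) :
    shiftExp deg (restrict β ({j}ᶜ)ᶜ) = 0 := by
  rw [compl_compl, shiftExp_restrict]
  refine Finset.sum_eq_zero fun x _ => Finset.sum_eq_zero fun y _ => if_neg ?_
  rintro ⟨hx, hy, hlt⟩
  rw [Finset.mem_singleton] at hx hy
  exact hlt.ne (hx.trans hy.symm)

/-- Moving an argument `y` of degree `deg (β j) + 1` from the last place to the place `j`. -/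
theorem snoc_eq_update {ψ : ∀ n : ℕ, MultilinearMap k (fun _ : Fin n => V) k}
    (hψ : IsSkew deg fun n β => ψ n (e ∘ β)) {n : ℕ} (β : Fin n → Fin N) (j : Fin n) {y : V}
    (hy : ∀ γ, e.repr y γ ≠ 0 → deg γ = deg (β j) + 1) :
    sgn k (insertExp (deg ∘ β) {j}ᶜ) * ψ (({j}ᶜ : Finset (Fin n)).card + 1)
      (Fin.snoc (α := fun _ => V) (restrict (e ∘ β) {j}ᶜ) y) =
    sgn k ((n : ℤ) - 1) * (sgn k (∑ i with i < j, deg (β i)) *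
      ψ n (Function.update (e ∘ β) j y)) := by
  rw [multilinear_snoc_repr e, multilinear_update_repr e, Finset.mul_sum, Finset.mul_sum,
    Finset.mul_sum]
  refine Finset.sum_congr rfl fun γ _ => ?_
  by_cases h0 : e.repr y γ = 0
  · simp [h0]
  have hγ := hy γ h0
  set I : Finset (Fin n) := {j}ᶜ with hI
  -- On `V[1]` the form is symmetric, so moving `γ` from the end to place `j` costs only a Koszul
  -- sign; the shift exponents translate this back to `V`.
  have hmove := hψ.isSymm.move (((List.finRange n).filter (· < j)).map β)
    (((List.finRange n).filter (j < ·)).map β) γ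
  rw [← ofFn_update, ← List.append_assoc, ← List.map_append, ← filter_compl_singleton,
    ← ofFn_restrict, ← ofFn_snoc, onList_ofFn, onList_ofFn, List.map_map, sum_map_filter_gt,
    ← hI] at hmove
  have hc1 : e ∘ Fin.snoc (α := fun _ => Fin N) (restrict β I) γ =
      Fin.snoc (α := fun _ => V) (restrict (e ∘ β) I) (e γ) := Fin.comp_snoc e _ γ
  have hc2 : e ∘ Function.update β j γ = Function.update (e ∘ β) j (e γ) :=
    Function.comp_update e β j γ
  rw [hc1, hc2] at hmove
  set A := ψ (I.card + 1) (Fin.snoc (α := fun _ => V) (restrict (e ∘ β) I) (e γ))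
  set B := ψ n (Function.update (e ∘ β) j (e γ))
  have hsum : ∑ i, coordDeg deg (restrict β I i) =
      (∑ i with i < j, coordDeg deg (β i)) + ∑ i with j < i, coordDeg deg (β i) := by
    rw [← sum_map_ofFn (w := coordDeg deg), ofFn_restrict, List.map_map, hI, sum_compl_singleton]
    rfl
  -- For `I = {j}ᶜ` this computes the insertion sign, because the shift exponent of a single
  -- argument is `0`.
  have hsgn := sgn_shuffleKoszul_mul deg k β I
  rw [hI, shuffleKoszul_compl_singleton, shiftExp_singleton, ← hI, sgn_zero, mul_one] at hsgn
  have hwγ : coordDeg deg γ = coordDeg deg (β j) - 1 := by rw [coordDeg, coordDeg, hγ]; ring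
  have hlt : ∑ i with i < j, coordDeg deg (β i) = (j : ℕ) - ∑ i with i < j, deg (β i) := by
    simp only [coordDeg, Finset.sum_sub_distrib, Finset.sum_const, nsmul_eq_mul, mul_one]
    congr 2
    have : (Finset.univ.filter fun i => i < j) = Finset.Iio j := by ext; simp
    rw [this, Fin.card_Iio]
  have hA : A = sgn k (shiftExp deg (Fin.snoc (α := fun _ => Fin N) (restrict β I) γ)) *
      (sgn k (coordDeg deg γ * ∑ i with j < i, (coordDeg deg ∘ β) i) *
        (sgn k (shiftExp deg (Function.update β j γ)) * B)) := by
    rw [← hmove, sgn_mul_sgn_mul]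
  have hE : sgn k (insertExp (deg ∘ β) I) = sgn k (shiftExp deg β) *
      (sgn k ((∑ i with j < i, (coordDeg deg ∘ β) i) * (coordDeg deg ∘ β) j) *
        sgn k (shiftExp deg (restrict β I))) := by
    rw [hsgn, sgn_mul_sgn_mul]
  have hs : sgn k (insertExp (deg ∘ β) I) * A =
      sgn k ((n : ℤ) - 1) * (sgn k (∑ i with i < j, deg (β i)) * B) := by
    rw [hA, hE, shiftExp_snoc, shiftExp_update, hsum, hwγ, hlt, hγ]
    simp only [Function.comp_apply]
    simp only [← mul_assoc, ← sgn_add]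
    congr 1
    refine sgn_eq_of_eq (shiftExp deg β + shiftExp deg (restrict β I) +
      (∑ i with j < i, coordDeg deg (β i)) * (coordDeg deg (β j) - 1) - (j : ℕ)) ?_
    ring
  rw [mul_left_comm, hs]
  ring

end Operations

end UnimodularLInfty

/-! ### Taylor coefficients of `Q`, of `f` and of derivatives along `Q` -/

namespace UnimodularLInfty

open FormalFun

section Equations

variable {k V : Type*} [Field k] [AddCommGroup V] [Module k V]
  {𝒱 : ℤ → Submodule k V} {N : ℕ} {e : Module.Basis (Fin N) k V} {deg : Fin N → ℤ}
  {s : Operations k V}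

/-! ### The vector field and the function of a family of operations -/

/-- All brackets of the structure, as multilinear maps. -/
noncomputable def bracketMap (s : Operations k V) :
    ∀ n : ℕ, MultilinearMap k (fun _ : Fin n => V) V
  | 1 => MultilinearMap.ofSubsingleton k V V (0 : Fin 1) (-s.d)
  | n => s.ℓ n

theorem bracketMap_apply (s : Operations k V) (n : ℕ) (v : Fin n → V) :
    bracketMap s n v = bracket s n v := by
  match n with
  | 0 => rfl
  | 1 => rfl
  | n + 2 => rfl

theorem IsGraded.bracket_mem (hs : IsGraded 𝒱 s) {n : ℕ} {v : Fin n → V} {p : Fin n → ℤ}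
    (hv : ∀ i, v i ∈ 𝒱 (p i)) : bracket s n v ∈ 𝒱 (2 - n + ∑ i, p i) := by
  by_cases hn : n = 1
  · subst hn
    have := Submodule.neg_mem _ (hs.d_mem _ _ (hv 0))
    have h2 : p 0 + 1 = 2 - ((1 : ℕ) : ℤ) + ∑ i, p i := by
      rw [Fin.sum_univ_one]; push_cast; ring
    rw [← h2]
    exact this
  · rw [bracket_of_ne_one s hn]; exact hs.ℓ_mem n v p hv

theorem IsGraded.bracket_skew (hs : IsGraded 𝒱 s) {n : ℕ} {v : Fin n → V} {p : Fin n → ℤ}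
    (hv : ∀ i, v i ∈ 𝒱 (p i)) (σ : Equiv.Perm (Fin n)) :
    bracket s n (v ∘ σ) = (((Equiv.Perm.sign σ : ℤ) : k) * sgn k (koszul σ p)) • bracket s n v := by
  by_cases hn : n = 1
  · subst hn
    rw [Subsingleton.elim σ 1, koszul_one]
    simp [sgn_zero]
  · rw [bracket_of_ne_one s hn, bracket_of_ne_one s hn]; exact hs.ℓ_skew n v p hv σ

theorem IsGraded.isSkew_bracket (hs : IsGraded 𝒱 s) (he : ∀ α, e α ∈ 𝒱 (deg α)) (α : Fin N) :
    IsSkew deg fun n β => e.repr (bracket s n (e ∘ β)) α := fun n β σ => by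
  have := hs.bracket_skew (v := e ∘ β) (p := deg ∘ β) (fun i => he (β i)) σ
  rw [Function.comp_assoc] at this
  simp only [this, map_smul, Finsupp.smul_apply, smul_eq_mul]

theorem IsGraded.isSkew_q (hs : IsGraded 𝒱 s) (he : ∀ α, e α ∈ 𝒱 (deg α)) :
    IsSkew deg fun n β => s.q n (e ∘ β) := fun n β σ => by
  have := hs.q_skew n (e ∘ β) (deg ∘ β) (fun i => he (β i)) σ
  rw [Function.comp_assoc] at this
  simp only [this, smul_eq_mul]

theorem assocField_X (s : Operations k V) (α : Fin N) :
    assocField e deg s (X α) = sgn k (coordDeg deg α) •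
      ofTaylor (coordDeg deg) (onList (shiftedBracket e deg s α)) := by
  rw [assocField, vectorFieldOf_X, totalFunction_eq_ofTaylor]

theorem taylor_assocField_X [CharZero k] (hs : IsGraded 𝒱 s) (he : ∀ α, e α ∈ 𝒱 (deg α))
    (α : Fin N) (l : List (Fin N)) :
    taylor (assocField e deg s (X α)) l =
      sgn k (coordDeg deg α) * onList (shiftedBracket e deg s α) l := by
  rw [assocField_X, taylor_smul, taylor_ofTaylor]
  exact (hs.isSkew_bracket he α).isSymm

theorem taylor_assocFunction [CharZero k] (hs : IsGraded 𝒱 s) (he : ∀ α, e α ∈ 𝒱 (deg α))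
    (l : List (Fin N)) :
    taylor (assocFunction e deg s) l = onList (shiftedQ e deg s) l := by
  rw [assocFunction, totalFunction_eq_ofTaylor, taylor_ofTaylor]
  exact (hs.isSkew_q he).isSymm

theorem sum_coordDeg {n : ℕ} (β : Fin n → Fin N) :
    ∑ i, coordDeg deg (β i) = n - ∑ i, deg (β i) := by
  simp [coordDeg]

theorem IsGraded.deg_of_shiftedQ_ne_zero (hs : IsGraded 𝒱 s)
    (he : ∀ α, e α ∈ 𝒱 (deg α)) {l : List (Fin N)}
    (h : onList (shiftedQ e deg s) l ≠ 0) : (l.map (coordDeg deg)).sum = 0 := by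
  obtain ⟨n, β, rfl⟩ : ∃ (n : ℕ) (β : Fin n → Fin N), List.ofFn β = l := ⟨_, _, List.ofFn_get _⟩
  rw [onList_ofFn] at h
  by_contra h0
  refine right_ne_zero_of_mul h (hs.q_deg n (e ∘ β) (deg ∘ β) (fun i => he (β i)) fun h1 => h0 ?_)
  rw [sum_map_ofFn, sum_coordDeg]
  simp only [Function.comp_apply] at h1
  omega

theorem IsGraded.vanishesAtZero [CharZero k] (hs : IsGraded 𝒱 s) (he : ∀ α, e α ∈ 𝒱 (deg α)) :
    VanishesAtZero (assocField e deg s) := by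
  refine vanishesAtZero_iff.2 fun α => ?_
  have h := taylor_assocField_X (deg := deg) hs he α []
  rw [assocField, vectorFieldOf_X] at h
  rw [← taylor_nil, h]
  have : onList (shiftedBracket e deg s α) [] =
    sgn k (shiftExp deg ([] : List (Fin N)).get) * e.repr (s.ℓ 0 (e ∘ [].get)) α := rfl
  rw [this, hs.ℓ_zero]
  simp

theorem IsGraded.isPotential [CharZero k] (hs : IsGraded 𝒱 s) (he : ∀ α, e α ∈ 𝒱 (deg α)) :
    IsPotential (assocFunction e deg s) where
  homogeneous := by
    rw [assocFunction, totalFunction_eq_ofTaylor]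
    exact isHomogeneous_ofTaylor fun l hl => hs.deg_of_shiftedQ_ne_zero he hl
  vanishes := by
    rw [← taylor_nil, taylor_assocFunction hs he]
    have : onList (shiftedQ e deg s) [] =
      sgn k (shiftExp deg ([] : List (Fin N)).get) * s.q 0 (e ∘ [].get) := rfl
    rw [this, hs.q_zero]
    simp

/-- Differentiating `Q (x^α)` by `x^α` appends `α` as the last argument, so the sum over `α` is a
trace. The sign `(-1)^{|x^α|}` in `Q (x^α)` equals `-(-1)^{deg α}`, which makes it a supertrace. -/
theorem taylor_divergence [CharZero k] (hs : IsGraded 𝒱 s) (he : ∀ α, e α ∈ 𝒱 (deg α))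
    {n : ℕ} (β : Fin n → Fin N) :
    taylor (divergence 1 (assocField e deg s)) (List.ofFn β) =
      -(sgn k (∑ i, coordDeg deg (β i)) * sgn k (shiftExp deg β)) *
      ∑ α, sgn k (deg α) *
        e.repr (bracket s (n + 1) (Fin.snoc (α := fun _ => V) (e ∘ β) (e α))) α := by
  rw [divergence_eq, taylor_sum, Finset.mul_sum]
  refine Finset.sum_congr rfl fun α _ => ?_
  have hcomp : e ∘ Fin.snoc (α := fun _ => Fin N) β α =
    Fin.snoc (α := fun _ => V) (e ∘ β) (e α) := Fin.comp_snoc e _ α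
  rw [sgn_mul_succ, one_smul, ← taylor_append_singleton, ← ofFn_snoc, taylor_assocField_X hs he,
    onList_ofFn, shiftedBracket, hcomp, shiftExp_snoc, sgn_sub, coordDeg, sgn_sub, sgn_one]
  ring

variable [DirectSum.Decomposition 𝒱]

theorem IsGraded.deg_of_shiftedBracket_ne_zero (hs : IsGraded 𝒱 s)
    (he : ∀ α, e α ∈ 𝒱 (deg α)) {α : Fin N} {l : List (Fin N)}
    (h : onList (shiftedBracket e deg s α) l ≠ 0) :
    (l.map (coordDeg deg)).sum = 1 + coordDeg deg α := by
  obtain ⟨n, β, rfl⟩ : ∃ (n : ℕ) (β : Fin n → Fin N), List.ofFn β = l := ⟨_, _, List.ofFn_get _⟩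
  rw [onList_ofFn] at h
  have := deg_eq_of_repr_ne_zero he
    (hs.bracket_mem (v := e ∘ β) (p := deg ∘ β) fun i => he (β i)) (right_ne_zero_of_mul h)
  rw [sum_map_ofFn, sum_coordDeg, coordDeg, this]
  simp only [Function.comp_apply]
  ring

theorem IsGraded.homogeneous_component (hs : IsGraded 𝒱 s) (he : ∀ α, e α ∈ 𝒱 (deg α))
    (α : Fin N) : IsHomogeneous (sgn k (coordDeg deg α) •
      totalFunction (coordDeg deg) (shiftedBracket e deg s α)) (1 + coordDeg deg α) := by
  rw [totalFunction_eq_ofTaylor]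
  exact (isHomogeneous_ofTaylor fun l hl => hs.deg_of_shiftedBracket_ne_zero he hl).smul _

theorem IsGraded.isVectorField (hs : IsGraded 𝒱 s) (he : ∀ α, e α ∈ 𝒱 (deg α)) :
    IsVectorField 1 (assocField e deg s) :=
  isVectorField_vectorFieldOf (hs.homogeneous_component he)

/-! ### Taylor coefficients of derivatives along the vector field -/

/-- Applying `Q` inserts every bracket into the form that represents `g`. The constant `c` allows
for the sign `(-1)^{|x^α|}` when `g = Q (x^α)`; for `g = f` it is `1`. -/
theorem taylor_assocField_eq_sum [CharZero k] (hs : IsGraded 𝒱 s) (he : ∀ α, e α ∈ 𝒱 (deg α))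
    {g : FormalFun k (coordDeg deg)} {c : k}
    {ψ : ∀ n : ℕ, MultilinearMap k (fun _ : Fin n => V) k}
    (hg : ∀ (n : ℕ) (β : Fin n → Fin N),
      taylor g (List.ofFn β) = c * (sgn k (shiftExp deg β) * ψ n (e ∘ β)))
    {n : ℕ} (β : Fin n → Fin N) :
    taylor (assocField e deg s g) (List.ofFn β) =
      -(c * sgn k (∑ i, coordDeg deg (β i)) * sgn k (shiftExp deg β)) *
      ∑ I : Finset (Fin n), sgn k (insertExp (deg ∘ β) I) * ψ (I.card + 1)
        (Fin.snoc (α := fun _ => V) (restrict (e ∘ β) I)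
          (bracket s Iᶜ.card (restrict (e ∘ β) Iᶜ))) := by
  rw [assocField, taylor_vectorFieldOf (hs.homogeneous_component he), Finset.mul_sum]
  refine Finset.sum_congr rfl fun I _ => ?_
  rw [multilinear_snoc_repr e, Finset.mul_sum, Finset.mul_sum, Finset.mul_sum]
  refine Finset.sum_congr rfl fun γ _ => ?_
  have h1 := taylor_assocField_X (deg := deg) hs he γ (List.ofFn (restrict β Iᶜ))
  rw [assocField, vectorFieldOf_X] at h1
  have hcomp : e ∘ Fin.snoc (α := fun _ => Fin N) (restrict β I) γ =
    Fin.snoc (α := fun _ => V) (restrict (e ∘ β) I) (e γ) := Fin.comp_snoc e _ γ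
  rw [h1, ← ofFn_snoc, hg, shiftExp_snoc, hcomp]
  by_cases h0 : onList (shiftedBracket e deg s γ) (List.ofFn (restrict β Iᶜ)) = 0
  · have h2 := h0
    rw [onList_ofFn, shiftedBracket, mul_eq_zero, or_iff_right (sgn_ne_zero _)] at h2
    have h3 : e.repr (bracket s Iᶜ.card (restrict (e ∘ β) Iᶜ)) γ = 0 := h2
    rw [h0, h3]
    simp
  · have hd := hs.deg_of_shiftedBracket_ne_zero he h0
    rw [sum_map_ofFn] at hd
    rw [onList_ofFn, shiftedBracket]
    have hb : e.repr (bracket s Iᶜ.card (e ∘ restrict β Iᶜ)) γ =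
      e.repr (bracket s Iᶜ.card (restrict (e ∘ β) Iᶜ)) γ := rfl
    rw [hb]
    have hsum : ∑ i, coordDeg deg (β i) =
        (∑ i, coordDeg deg (restrict β I i)) + ∑ i, coordDeg deg (restrict β Iᶜ i) := by
      have h4 : ∀ J : Finset (Fin n), ∑ i, coordDeg deg (restrict β J i) =
          ∑ x, if x ∈ J then coordDeg deg (β x) else 0 := fun J =>
        sum_orderEmbOfFin J fun x => coordDeg deg (β x)
      rw [h4, h4, ← Finset.sum_add_distrib]
      refine Finset.sum_congr rfl fun x _ => ?_
      by_cases hx : x ∈ I <;> simp [hx]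
    have hsgn := sgn_shuffleKoszul_mul deg k β I
    -- The inner bracket is nonzero only if its arguments have total degree `1 + |x^γ|`. Hence the
    -- sign of `Q (x^γ)` and the one from appending `γ` together depend on the total degree of `β`
    -- only, not on `I` or `γ`.
    have hm : sgn k (coordDeg deg γ) * sgn k (∑ i, coordDeg deg (restrict β I i)) =
        -sgn k (∑ i, coordDeg deg (β i)) := by
      rw [hsum, hd, ← sgn_add, ← neg_one_mul, ← sgn_one (R := k), ← sgn_add]
      exact sgn_eq_of_eq (-1) (by ring)
    rw [sgn_sub]
    linear_combination
      (e.repr (bracket s Iᶜ.card (restrict (e ∘ β) Iᶜ)) γ * c *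
        ψ (I.card + 1) (Fin.snoc (α := fun _ => V) (restrict (e ∘ β) I) (e γ))) *
      (sgn k (coordDeg deg γ) * sgn k (∑ i, coordDeg deg (restrict β I i)) * hsgn +
        sgn k (shiftExp deg β) * sgn k (insertExp (deg ∘ β) I) * hm)

theorem taylor_assocField [CharZero k] (hs : IsGraded 𝒱 s) (he : ∀ α, e α ∈ 𝒱 (deg α))
    {g : FormalFun k (coordDeg deg)} {c : k}
    {ψ : ∀ n : ℕ, MultilinearMap k (fun _ : Fin n => V) k}
    (hψ : IsSkew deg fun n β => ψ n (e ∘ β))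
    (hg : ∀ (n : ℕ) (β : Fin n → Fin N),
      taylor g (List.ofFn β) = c * (sgn k (shiftExp deg β) * ψ n (e ∘ β)))
    {n : ℕ} (β : Fin n → Fin N) :
    taylor (assocField e deg s g) (List.ofFn β) =
      -(c * sgn k (∑ i, coordDeg deg (β i)) * sgn k (shiftExp deg β)) *
      (insertSum s ψ (e ∘ β) (deg ∘ β) +
        sgn k n * precompD s (ψ n) (e ∘ β) (deg ∘ β)) := by
  rw [taylor_assocField_eq_sum hs he hg, sum_insert_bracket s hs.ℓ_one, precompD, Finset.mul_sum,
    sub_eq_add_neg, ← Finset.sum_neg_distrib]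
  congr 2
  refine Finset.sum_congr rfl fun j _ => ?_
  have hd : ∀ γ, e.repr (s.d ((e ∘ β) j)) γ ≠ 0 → deg γ = deg (β j) + 1 := fun γ hγ =>
    deg_eq_of_repr_ne_zero he (hs.d_mem _ _ (he (β j))) hγ
  rw [snoc_eq_update hψ β j hd, sgn_sub, sgn_one, smul_eq_mul]
  simp only [Function.comp_apply]
  ring

theorem traceLast_eq (he : ∀ α, e α ∈ 𝒱 (deg α)) {n : ℕ}
    (φ : MultilinearMap k (fun _ : Fin (n + 1) => V) V) (v : Fin n → V) :
    traceLast 𝒱 φ v =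
      ∑ α, sgn k (deg α) * e.repr (φ (Fin.snoc (α := fun _ => V) v (e α))) α := by
  rw [traceLast, gradedTrace_eq he]
  simp [Fin.update_snoc_last]

end Equations

end UnimodularLInfty

namespace UnimodularLInfty

open FormalFun

/-! ### Multilinear maps and homogeneous bases -/

section Extension

variable {k V W : Type*} [Field k] [AddCommGroup V] [Module k V] [AddCommGroup W] [Module k W]
  {N n : ℕ}

theorem multilinear_eq_sum (e : Module.Basis (Fin N) k V)
    (M : MultilinearMap k (fun _ : Fin n => V) W) (v : Fin n → V) :
    M v = ∑ β : Fin n → Fin N, (∏ i, e.repr (v i) (β i)) • M (e ∘ β) := by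
  have hv : v = fun i => ∑ γ, e.repr (v i) γ • e γ := funext fun i => (e.sum_repr (v i)).symm
  conv_lhs => rw [hv]
  rw [MultilinearMap.map_sum]
  exact Finset.sum_congr rfl fun β _ =>
    M.map_smul_univ (fun i => e.repr (v i) (β i)) (fun i => e (β i))

/-- `F` is multilinear. -/
def IsMultilinear (k : Type*) {V W : Type*} [Field k] [AddCommGroup V] [Module k V]
    [AddCommGroup W] [Module k W] {n : ℕ} (F : (Fin n → V) → W) : Prop :=
  ∃ M : MultilinearMap k (fun _ : Fin n => V) W, ∀ v, F v = M v

theorem IsMultilinear.add {F G : (Fin n → V) → W} (hF : IsMultilinear k F)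
    (hG : IsMultilinear k G) : IsMultilinear k fun v => F v + G v := by
  obtain ⟨M, hM⟩ := hF
  obtain ⟨M', hM'⟩ := hG
  exact ⟨M + M', fun v => congrArg₂ (· + ·) (hM v) (hM' v)⟩

theorem IsMultilinear.smul {F : (Fin n → V) → W} (hF : IsMultilinear k F) (c : k) :
    IsMultilinear k fun v => c • F v := by
  obtain ⟨M, hM⟩ := hF
  exact ⟨c • M, fun v => congrArg (c • ·) (hM v)⟩

theorem IsMultilinear.sum {ι : Type*} {t : Finset ι} {F : ι → (Fin n → V) → W}
    (hF : ∀ i, IsMultilinear k (F i)) : IsMultilinear k fun v => ∑ i ∈ t, F i v := by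
  choose M hM using hF
  exact ⟨∑ i ∈ t, M i, fun v => by
    rw [sum_apply]; exact Finset.sum_congr rfl fun i _ => hM i v⟩

theorem isMultilinear_precompD (s : Operations k V) (φ : MultilinearMap k (fun _ : Fin n => V) W)
    (p : Fin n → ℤ) : IsMultilinear k fun v => precompD s φ v p := by
  refine IsMultilinear.sum fun j => IsMultilinear.smul
    ⟨φ.compLinearMap fun i => if i = j then s.d else LinearMap.id, fun v => ?_⟩ _
  rw [MultilinearMap.compLinearMap_apply]
  congr 1
  funext i
  by_cases h : i = j
  · subst h; simp
  · simp [h]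

theorem isMultilinear_insertSum (s : Operations k V)
    (φ : ∀ n : ℕ, MultilinearMap k (fun _ : Fin n => V) W) (p : Fin n → ℤ) :
    IsMultilinear k fun v => insertSum s φ v p := by
  refine IsMultilinear.sum fun I => IsMultilinear.smul ?_ _
  -- Precomposition of the last slot with the inner bracket; `curryFinFinset` then merges the
  -- arguments in `I` and in its complement into a single multilinear map.
  let L : (V →ₗ[k] W) →ₗ[k] MultilinearMap k (fun _ : Fin Iᶜ.card => V) W :=
    { toFun := fun f => f.compMultilinearMap (s.ℓ Iᶜ.card)
      map_add' := fun _ _ => rfl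
      map_smul' := fun _ _ => rfl }
  exact ⟨(MultilinearMap.curryFinFinset k W V rfl rfl).symm
    (L.compMultilinearMap (φ (I.card + 1)).curryRight), fun v => rfl⟩

theorem isMultilinear_traceLast (𝒱 : ℤ → Submodule k V) [DirectSum.Decomposition 𝒱]
    (φ : MultilinearMap k (fun _ : Fin (n + 1) => V) V) :
    IsMultilinear k fun v => traceLast 𝒱 φ v := by
  let L : (V →ₗ[k] V) →ₗ[k] k :=
    { toFun := fun f => gradedTrace 𝒱 f
      map_add' := fun f g => by
        simp only [gradedTrace, LinearMap.comp_add, map_add]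
      map_smul' := fun c f => by
        simp only [gradedTrace, LinearMap.comp_smul, map_smul, RingHom.id_apply] }
  refine ⟨L.compMultilinearMap φ.curryRight, fun v => ?_⟩
  change gradedTrace 𝒱 _ = gradedTrace 𝒱 _
  congr 1
  ext x
  simp [Fin.update_snoc_last]

variable {𝒱 : ℤ → Submodule k V} [DirectSum.Decomposition 𝒱] {e : Module.Basis (Fin N) k V}
  {deg : Fin N → ℤ}

/-- The signs inside `F` depend on the degrees `p`, so multilinearity is used with `p` fixed. This
is enough: vectors of degrees `p` expand only in basis tuples of the same degrees. -/
theorem IsMultilinear.mem_of_basis (he : ∀ α, e α ∈ 𝒱 (deg α)) {F : (Fin n → V) → W}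
    (hF : IsMultilinear k F) {S : Submodule k W} {p : Fin n → ℤ}
    (h : ∀ β : Fin n → Fin N, deg ∘ β = p → F (e ∘ β) ∈ S) {v : Fin n → V}
    (hv : ∀ i, v i ∈ 𝒱 (p i)) : F v ∈ S := by
  obtain ⟨M, hM⟩ := hF
  rw [hM, multilinear_eq_sum e]
  refine Submodule.sum_mem _ fun β _ => ?_
  by_cases h0 : ∏ i, e.repr (v i) (β i) = 0
  · rw [h0, zero_smul]; exact Submodule.zero_mem _
  · refine Submodule.smul_mem _ _ ?_
    rw [← hM]
    exact h β (funext fun i => deg_eq_of_repr_ne_zero he (hv i)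
      (Finset.prod_ne_zero_iff.1 h0 i (Finset.mem_univ i)))

theorem IsMultilinear.eq_zero_of_basis (he : ∀ α, e α ∈ 𝒱 (deg α)) {F : (Fin n → V) → W}
    (hF : IsMultilinear k F) {p : Fin n → ℤ}
    (h : ∀ β : Fin n → Fin N, deg ∘ β = p → F (e ∘ β) = 0) {v : Fin n → V}
    (hv : ∀ i, v i ∈ 𝒱 (p i)) : F v = 0 :=
  (Submodule.mem_bot k).1 (hF.mem_of_basis he (fun β hβ => (Submodule.mem_bot k).2 (h β hβ)) hv)

theorem skew_of_basis (he : ∀ α, e α ∈ 𝒱 (deg α)) (M : MultilinearMap k (fun _ : Fin n => V) W)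
    (σ : Equiv.Perm (Fin n))
    (h : ∀ β : Fin n → Fin N, M (e ∘ β ∘ σ) =
      (((Equiv.Perm.sign σ : ℤ) : k) * sgn k (koszul σ (deg ∘ β))) • M (e ∘ β))
    {v : Fin n → V} {p : Fin n → ℤ} (hv : ∀ i, v i ∈ 𝒱 (p i)) :
    M (v ∘ σ) = (((Equiv.Perm.sign σ : ℤ) : k) * sgn k (koszul σ p)) • M v := by
  have hF : IsMultilinear k fun v => M (v ∘ σ) +
      (-(((Equiv.Perm.sign σ : ℤ) : k) * sgn k (koszul σ p))) • M v :=
    IsMultilinear.add ⟨M.domDomCongr σ, fun _ => rfl⟩ (IsMultilinear.smul ⟨M, fun _ => rfl⟩ _)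
  have := hF.eq_zero_of_basis he (fun β hβ => by
    rw [Function.comp_assoc, h, hβ, neg_smul, add_neg_cancel]) hv
  rwa [neg_smul, add_neg_eq_zero] at this

end Extension

/-! ### The equations on basis vectors -/

section Equations

variable {k V : Type*} [Field k] [AddCommGroup V] [Module k V]
  {N : ℕ} {e : Module.Basis (Fin N) k V} {deg : Fin N → ℤ} {s : Operations k V}

/-- The failure of the `n`-th equation of an L-infinity algebra, including `d² = 0`. -/
noncomputable def obstruction (s : Operations k V) {n : ℕ} (v : Fin n → V) (p : Fin n → ℤ) : V :=
  insertSum s (bracketMap s) v p + sgn k n • precompD s (bracketMap s n) v p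

theorem multilinear_snoc_restrict_empty
    (φ : ∀ n : ℕ, MultilinearMap k (fun _ : Fin n => V) V) {n : ℕ} (v : Fin n → V) (y : V) :
    φ ((∅ : Finset (Fin n)).card + 1) (Fin.snoc (α := fun _ => V) (restrict v ∅) y) =
      onList (fun n v => φ n v) [y] := by
  rw [← onList_ofFn (fun n v => φ n v) (Fin.snoc (α := fun _ => V) (restrict v ∅) y), ofFn_snoc,
    ofFn_restrict]
  simp

theorem restrict_univ_eq {X W : Type*} (φ : ∀ n : ℕ, (Fin n → X) → W) {n : ℕ} (v : Fin n → X) :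
    φ (∅ᶜ : Finset (Fin n)).card (restrict v ∅ᶜ) = φ n v := by
  rw [← onList_ofFn φ (restrict v ∅ᶜ), ofFn_restrict, ← onList_ofFn φ v]
  congr 1
  simp [List.finRange, List.map_ofFn]
  rfl

theorem insertExp_empty {n : ℕ} (p : Fin n → ℤ) : insertExp p ∅ = 0 := by
  simp [insertExp, shuffleExp, shuffleKoszul]

/-- The outer operation is unary only for `I = ∅`, and there `-d` takes the place of `ℓ 1 = 0`. This
single term is the part `d ∘ ℓ_n` of `∂ ℓ_n`. -/
theorem insertSum_bracketMap (h1 : s.ℓ 1 = 0) {n : ℕ} (v : Fin n → V) (p : Fin n → ℤ) :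
    insertSum s (bracketMap s) v p = insertSum s s.ℓ v p - s.d (s.ℓ n v) := by
  rw [eq_sub_iff_add_eq, ← eq_sub_iff_add_eq', insertSum, insertSum, ← Finset.sum_sub_distrib,
    Finset.sum_eq_single ∅]
  · rw [multilinear_snoc_restrict_empty (bracketMap s), multilinear_snoc_restrict_empty s.ℓ,
      restrict_univ_eq (fun n v => s.ℓ n v), insertExp_empty, sgn_zero, one_smul, one_smul]
    have ha : onList (fun n v => s.ℓ n v) [s.ℓ n v] = 0 := by
      change s.ℓ 1 _ = 0
      rw [h1]; rfl
    have hb : onList (fun n v => bracketMap s n v) [s.ℓ n v] = -s.d (s.ℓ n v) := rfl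
    rw [ha, hb, sub_neg_eq_add, zero_add]
  · intro I _ hI
    have hc : I.card + 1 ≠ 1 := by
      rw [Ne, Nat.add_eq_right, Finset.card_eq_zero]
      exact hI
    rw [bracketMap_apply, bracket_of_ne_one s hc, sub_self]
  · simp

theorem insertSum_of_lt_two (h0 : s.ℓ 0 = 0) (h1 : s.ℓ 1 = 0) {W : Type*} [AddCommGroup W]
    [Module k W] (φ : ∀ n : ℕ, MultilinearMap k (fun _ : Fin n => V) W) {n : ℕ} (hn : n < 2)
    (v : Fin n → V) (p : Fin n → ℤ) : insertSum s φ v p = 0 := by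
  refine Finset.sum_eq_zero fun I _ => ?_
  have hz : s.ℓ Iᶜ.card (restrict v Iᶜ) = 0 := by
    have hc : Iᶜ.card < 2 := (Finset.card_le_univ _).trans_lt (by simpa using hn)
    generalize restrict v Iᶜ = u
    generalize Iᶜ.card = m at hc u
    interval_cases m
    · rw [h0]; rfl
    · rw [h1]; rfl
  have hsnoc : φ (I.card + 1) (Fin.snoc (α := fun _ => V) (restrict v I) 0) =
    (φ (I.card + 1)).curryRight (restrict v I) 0 := rfl
  rw [hz, hsnoc, map_zero, smul_zero]

theorem obstruction_zero (h0 : s.ℓ 0 = 0) (h1 : s.ℓ 1 = 0) (v : Fin 0 → V) (p : Fin 0 → ℤ) :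
    obstruction s v p = 0 := by
  rw [obstruction, insertSum_of_lt_two h0 h1 _ (by norm_num)]
  simp [precompD]

theorem obstruction_one (h0 : s.ℓ 0 = 0) (h1 : s.ℓ 1 = 0) (v : Fin 1 → V) (p : Fin 1 → ℤ) :
    obstruction s v p = s.d (s.d (v 0)) := by
  rw [obstruction, insertSum_of_lt_two h0 h1 _ (by norm_num), precompD, Fin.sum_univ_one,
    bracketMap_apply]
  have : bracket s 1 (Function.update v 0 (s.d (v 0))) = -s.d (s.d (v 0)) := by
    change -s.d (Function.update v 0 (s.d (v 0)) 0) = _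
    rw [Function.update_self]
  rw [this]
  simp [sgn_zero, sgn_one]

theorem obstruction_of_two_le (h1 : s.ℓ 1 = 0) {n : ℕ} (hn : 2 ≤ n) (v : Fin n → V)
    (p : Fin n → ℤ) : obstruction s v p = insertSum s s.ℓ v p -
      (s.d (s.ℓ n v) - sgn k (2 - n) • precompD s (s.ℓ n) v p) := by
  have : bracketMap s n = s.ℓ n := by
    match n with
    | n + 2 => rfl
  rw [obstruction, insertSum_bracketMap h1, this,
    sgn_eq_of_eq (R := k) (a := 2 - n) (b := n) (1 - n) (by ring)]
  abel

theorem isMultilinear_obstruction (s : Operations k V) {n : ℕ} (p : Fin n → ℤ) :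
    IsMultilinear k fun v => obstruction s v p :=
  (isMultilinear_insertSum s _ p).add ((isMultilinear_precompD s _ p).smul _)

theorem repr_obstruction (e : Module.Basis (Fin N) k V) (α : Fin N) {n : ℕ} (v : Fin n → V)
    (p : Fin n → ℤ) :
    insertSum s (fun m => (e.coord α).compMultilinearMap (bracketMap s m)) v p +
      sgn k n * precompD s ((e.coord α).compMultilinearMap (bracketMap s n)) v p =
    e.repr (obstruction s v p) α := by
  rw [obstruction, map_add, Finsupp.add_apply, map_smul, Finsupp.smul_apply, smul_eq_mul,
    ← e.coord_apply, ← e.coord_apply]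
  simp only [insertSum, precompD, map_sum, map_smul, LinearMap.compMultilinearMap_apply]

variable {𝒱 : ℤ → Submodule k V} [DirectSum.Decomposition 𝒱]

/-- One family covers all equations: it is void for `n = 0`, gives `d² = 0` for `n = 1`, and the
Jacobi identities from `n = 2` on. -/
theorem isLInfty_iff_obstruction (he : ∀ α, e α ∈ 𝒱 (deg α)) (hs : IsGraded 𝒱 s) :
    IsLInfty 𝒱 s ↔ ∀ (n : ℕ) (β : Fin n → Fin N), obstruction s (e ∘ β) (deg ∘ β) = 0 := by
  constructor
  · intro h n β
    rcases Nat.lt_or_ge n 2 with hn | hn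
    · interval_cases n
      · exact obstruction_zero hs.ℓ_zero hs.ℓ_one _ _
      · rw [obstruction_one hs.ℓ_zero hs.ℓ_one]
        exact LinearMap.congr_fun h.d_sq _
    · rw [obstruction_of_two_le hs.ℓ_one hn, sub_eq_zero]
      exact (h.jacobi n hn (e ∘ β) (deg ∘ β) fun i => he (β i)).symm
  · intro h
    refine ⟨hs, e.ext fun α => ?_, fun n hn v p hv => ?_⟩
    · have := h 1 fun _ => α
      rwa [obstruction_one hs.ℓ_zero hs.ℓ_one] at this
    · have := (isMultilinear_obstruction s p).eq_zero_of_basis he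
        (fun β hβ => by rw [← hβ]; exact h n β) hv
      rw [obstruction_of_two_le hs.ℓ_one hn, sub_eq_zero] at this
      exact this.symm

theorem isLInfty_iff [CharZero k] (he : ∀ α, e α ∈ 𝒱 (deg α)) (hs : IsGraded 𝒱 s) :
    IsLInfty 𝒱 s ↔ IsHomological (assocField e deg s) := by
  have hQ := hs.isVectorField he
  -- The general formula for derivatives along `Q`, applied to `g = Q (x^α)`, whose form is the
  -- `α`-component of the brackets.
  have key : ∀ (α : Fin N) (n : ℕ) (β : Fin n → Fin N),
      taylor (assocField e deg s (assocField e deg s (X α))) (List.ofFn β) =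
      -(sgn k (coordDeg deg α) * sgn k (∑ i, coordDeg deg (β i)) * sgn k (shiftExp deg β)) *
        e.repr (obstruction s (e ∘ β) (deg ∘ β)) α := by
    intro α n β
    rw [← repr_obstruction e α]
    refine taylor_assocField hs he ?_ ?_ β
    · intro n β σ
      have := hs.isSkew_bracket he α n β σ
      simpa only [LinearMap.compMultilinearMap_apply, bracketMap_apply, e.coord_apply] using this
    · intro n β
      rw [taylor_assocField_X hs he, onList_ofFn, shiftedBracket,
        LinearMap.compMultilinearMap_apply, bracketMap_apply, e.coord_apply]
  rw [isLInfty_iff_obstruction he hs]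
  constructor
  · intro h
    refine ⟨hQ, hs.vanishesAtZero he, (hQ.square_eq odd_one).2 fun α => ?_⟩
    refine taylor_injective fun l => ?_
    obtain ⟨n, β, rfl⟩ : ∃ (n : ℕ) (β : Fin n → Fin N), List.ofFn β = l := ⟨_, _, List.ofFn_get _⟩
    rw [key, h, taylor_zero]
    simp
  · intro h n β
    refine e.repr.injective (Finsupp.ext fun α => ?_)
    have h1 := key α n β
    rw [(hQ.square_eq odd_one).1 h.square α, taylor_zero] at h1
    rw [map_zero, Finsupp.zero_apply]
    refine (mul_eq_zero.1 h1.symm).resolve_left ?_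
    exact neg_ne_zero.2 (mul_ne_zero (mul_ne_zero (sgn_ne_zero _) (sgn_ne_zero _)) (sgn_ne_zero _))

theorem unimodular_iff [CharZero k] (he : ∀ α, e α ∈ 𝒱 (deg α)) (hs : IsGraded 𝒱 s) :
    (∀ (n : ℕ), 1 ≤ n → ∀ (v : Fin n → V) (p : Fin n → ℤ), (∀ i, v i ∈ 𝒱 (p i)) →
      - (sgn k (-n) • precompD s (s.q n) v p) =
        insertSum s s.q v p + traceLast 𝒱 (s.ℓ (n + 1)) v) ↔
    divergence 1 (assocField e deg s) + assocField e deg s (assocFunction e deg s) = 0 := by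
  have hQ := hs.isVectorField he
  have key : ∀ (n : ℕ) (β : Fin n → Fin N), 1 ≤ n →
      taylor (divergence 1 (assocField e deg s) +
        assocField e deg s (assocFunction e deg s)) (List.ofFn β) =
      -(sgn k (∑ i, coordDeg deg (β i)) * sgn k (shiftExp deg β)) *
        (insertSum s s.q (e ∘ β) (deg ∘ β) + traceLast 𝒱 (s.ℓ (n + 1)) (e ∘ β) +
          sgn k (-n) • precompD s (s.q n) (e ∘ β) (deg ∘ β)) := by
    intro n β hn
    have h1 : taylor (assocField e deg s (assocFunction e deg s)) (List.ofFn β) =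
        -(1 * sgn k (∑ i, coordDeg deg (β i)) * sgn k (shiftExp deg β)) *
          (insertSum s s.q (e ∘ β) (deg ∘ β) +
            sgn k n * precompD s (s.q n) (e ∘ β) (deg ∘ β)) := by
      refine taylor_assocField hs he (hs.isSkew_q he) (fun n β => ?_) β
      rw [taylor_assocFunction hs he, onList_ofFn, shiftedQ, one_mul]
    rw [taylor_add, h1, taylor_divergence hs he, traceLast_eq he, sgn_neg, smul_eq_mul]
    -- Here `1 ≤ n` is used: the trace is that of `ℓ (n + 1)` and not of the differential.
    simp only [bracket_of_ne_one s (show n + 1 ≠ 1 by omega)]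
    ring
  constructor
  · intro h
    refine taylor_injective fun l => ?_
    obtain ⟨n, β, rfl⟩ : ∃ (n : ℕ) (β : Fin n → Fin N), List.ofFn β = l := ⟨_, _, List.ofFn_get _⟩
    rw [taylor_zero]
    rcases Nat.eq_zero_or_pos n with rfl | hn
    -- There is no equation for `n = 0`, and none is needed: `Q f` vanishes at the origin, and the
    -- divergence has degree `1`, hence no constant term.
    · rw [List.ofFn_zero, taylor_nil, coeff_add, hs.vanishesAtZero he, add_zero]
      by_contra h0
      have := hQ.divergence_homogeneous 0 h0
      rw [mdeg_zero] at this
      exact zero_ne_one this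
    · rw [key n β hn, ← h n hn (e ∘ β) (deg ∘ β) fun i => he (β i), neg_add_cancel, mul_zero]
  · intro h n hn v p hv
    have hF : IsMultilinear k fun v => insertSum s s.q v p + traceLast 𝒱 (s.ℓ (n + 1)) v +
        sgn k (-n) • precompD s (s.q n) v p :=
      ((isMultilinear_insertSum s _ p).add (isMultilinear_traceLast 𝒱 _)).add
        ((isMultilinear_precompD s _ p).smul _)
    have := hF.eq_zero_of_basis he (fun β hβ => ?_) hv
    · exact (eq_neg_of_add_eq_zero_left this).symm
    · have h1 := key n β hn
      rw [h, taylor_zero] at h1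
      rw [← hβ]
      refine (mul_eq_zero.1 h1.symm).resolve_left ?_
      exact neg_ne_zero.2 (mul_ne_zero (sgn_ne_zero _) (sgn_ne_zero _))

theorem isUnimodular_iff [CharZero k] (he : ∀ α, e α ∈ 𝒱 (deg α)) (hs : IsGraded 𝒱 s) :
    IsUnimodular 𝒱 s ↔ IsHomological (assocField e deg s) ∧
      divergence 1 (assocField e deg s) + assocField e deg s (assocFunction e deg s) = 0 := by
  rw [← isLInfty_iff he hs, ← unimodular_iff he hs]
  exact ⟨fun h => ⟨h.toIsLInfty, h.unimodular⟩, fun h => ⟨h.1, h.2⟩⟩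

end Equations

end UnimodularLInfty

namespace UnimodularLInfty

open FormalFun

/-! ### Recovering the operations from a vector field and a function -/

section Reconstruction

variable {k V : Type*} [Field k] [AddCommGroup V] [Module k V]
  {N : ℕ} (e : Module.Basis (Fin N) k V) (deg : Fin N → ℤ)

/-- The multilinear map with given values on basis vectors. -/
noncomputable def multilinearOfBasis {W : Type*} [AddCommGroup W] [Module k W] {n : ℕ}
    (c : (Fin n → Fin N) → W) : MultilinearMap k (fun _ : Fin n => V) W :=
  ∑ β, ((MultilinearMap.mkPiAlgebra k (Fin n) k).compLinearMap fun i => e.coord (β i)).smulRight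
    (c β)

theorem multilinearOfBasis_apply {W : Type*} [AddCommGroup W] [Module k W] {n : ℕ}
    (c : (Fin n → Fin N) → W) (β : Fin n → Fin N) : multilinearOfBasis e c (e ∘ β) = c β := by
  rw [multilinearOfBasis, sum_apply, Finset.sum_eq_single β]
  · simp
  · intro γ _ hγ
    obtain ⟨i, hi⟩ := Function.ne_iff.1 hγ
    rw [MultilinearMap.smulRight_apply, MultilinearMap.compLinearMap_apply,
      MultilinearMap.mkPiAlgebra_apply, Finset.prod_eq_zero (Finset.mem_univ i), zero_smul]
    simp [hi.symm]
  · simp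

/-- The vector with components `(-1)^{|x^α|} ∂_{β 0} ⋯ ∂_{β (n-1)} Q (x^α)`, evaluated at `0`. -/
noncomputable def fieldCoeff (Q : FormalFun k (coordDeg deg) →ₗ[k] FormalFun k (coordDeg deg))
    (l : List (Fin N)) : V :=
  ∑ α, (sgn k (coordDeg deg α) * taylor (Q (X α)) l) • e α

/-- The operations associated with a vector field and a function. -/
noncomputable def operationsOf
    (Q : FormalFun k (coordDeg deg) →ₗ[k] FormalFun k (coordDeg deg))
    (f : FormalFun k (coordDeg deg)) : Operations k V where
  -- The sign undoes the convention that the unary bracket is `-d`; a single argument has no shift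
  -- sign. The lower brackets below are set to zero, as `IsGraded` demands.
  d := -e.constr k fun β => fieldCoeff e deg Q [β]
  ℓ n := if n < 2 then 0 else
    multilinearOfBasis e fun β => sgn k (shiftExp deg β) • fieldCoeff e deg Q (List.ofFn β)
  q _ := multilinearOfBasis e fun β => sgn k (shiftExp deg β) * taylor f (List.ofFn β)

variable {e deg} {Q : FormalFun k (coordDeg deg) →ₗ[k] FormalFun k (coordDeg deg)}
  {f : FormalFun k (coordDeg deg)}

theorem repr_fieldCoeff (l : List (Fin N)) (α : Fin N) :
    e.repr (fieldCoeff e deg Q l) α = sgn k (coordDeg deg α) * taylor (Q (X α)) l := by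
  rw [fieldCoeff, map_sum, Finset.sum_apply']
  simp [Finsupp.single_apply]

theorem bracket_operationsOf (hQ : VanishesAtZero Q) {n : ℕ} (β : Fin n → Fin N) :
    bracket (operationsOf e deg Q f) n (e ∘ β) =
      sgn k (shiftExp deg β) • fieldCoeff e deg Q (List.ofFn β) := by
  match n with
  | 0 =>
    have h : fieldCoeff e deg Q (List.ofFn β) = 0 := by
      rw [fieldCoeff]
      refine Finset.sum_eq_zero fun α _ => ?_
      rw [List.ofFn_zero, taylor_nil, hQ, mul_zero, zero_smul]
    rw [h, smul_zero]
    rfl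
  | 1 =>
    change -(-e.constr k (fun β => fieldCoeff e deg Q [β])) (e (β 0)) = _
    have h : shiftExp deg β = 0 := by simp [shiftExp]
    rw [LinearMap.neg_apply, neg_neg, e.constr_basis, h, sgn_zero, one_smul]
    simp
  | n + 2 =>
    change (if n + 2 < 2 then 0 else multilinearOfBasis e fun β => sgn k (shiftExp deg β) •
      fieldCoeff e deg Q (List.ofFn β) : MultilinearMap k (fun _ : Fin (n + 2) => V) V) (e ∘ β) = _
    rw [if_neg (by omega), multilinearOfBasis_apply]

theorem shiftedBracket_operationsOf (hQ : VanishesAtZero Q) (α : Fin N) {n : ℕ}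
    (β : Fin n → Fin N) : shiftedBracket e deg (operationsOf e deg Q f) α n β =
      sgn k (coordDeg deg α) * taylor (Q (X α)) (List.ofFn β) := by
  rw [shiftedBracket, bracket_operationsOf hQ, map_smul, Finsupp.smul_apply, repr_fieldCoeff,
    smul_eq_mul, sgn_mul_sgn_mul]

theorem assocField_operationsOf [CharZero k] (hQ : IsVectorField 1 Q) (hQ0 : VanishesAtZero Q) :
    assocField e deg (operationsOf e deg Q f) = Q := by
  rw [assocField]
  conv_rhs => rw [hQ.eq_vectorFieldOf]
  congr 1
  funext α
  have : shiftedBracket e deg (operationsOf e deg Q f) α =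
      fun _ β => (sgn k (coordDeg deg α) • taylor (Q (X α))) (List.ofFn β) := by
    funext n β
    exact shiftedBracket_operationsOf hQ0 α β
  have h2 : sgn k (coordDeg deg α) • taylor (Q (X α)) =
      taylor (sgn k (coordDeg deg α) • Q (X α)) := by
    funext l; rw [taylor_smul]; rfl
  rw [this, ← ofTaylor, h2, ofTaylor_taylor, smul_smul, sgn_mul_self, one_smul]

theorem q_operationsOf {n : ℕ} (β : Fin n → Fin N) :
    (operationsOf e deg Q f).q n (e ∘ β) = sgn k (shiftExp deg β) * taylor f (List.ofFn β) :=
  multilinearOfBasis_apply e (fun β => sgn k (shiftExp deg β) * taylor f (List.ofFn β)) β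

theorem shiftedQ_operationsOf {n : ℕ} (β : Fin n → Fin N) :
    shiftedQ e deg (operationsOf e deg Q f) n β = taylor f (List.ofFn β) := by
  rw [shiftedQ, q_operationsOf, sgn_mul_sgn_mul]

theorem assocFunction_operationsOf [CharZero k] :
    assocFunction e deg (operationsOf e deg Q f) = f := by
  have : shiftedQ e deg (operationsOf e deg Q f) = fun _ β => taylor f (List.ofFn β) := by
    funext n β
    exact shiftedQ_operationsOf β
  rw [assocFunction, this, ← ofTaylor, ofTaylor_taylor]

variable {𝒱 : ℤ → Submodule k V}

/-- The operations are determined by the vector field and the function. -/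
theorem IsGraded.ext_of_assoc [CharZero k] (he : ∀ α, e α ∈ 𝒱 (deg α)) {s s' : Operations k V}
    (hs : IsGraded 𝒱 s) (hs' : IsGraded 𝒱 s')
    (hF : assocField e deg s = assocField e deg s')
    (hf : assocFunction e deg s = assocFunction e deg s') : s = s' := by
  have hb : ∀ {n : ℕ} (β : Fin n → Fin N), bracket s n (e ∘ β) = bracket s' n (e ∘ β) := by
    intro n β
    refine e.repr.injective (Finsupp.ext fun α => ?_)
    have h := taylor_assocField_X (deg := deg) hs he α (List.ofFn β)
    rw [hF, taylor_assocField_X hs' he, onList_ofFn, onList_ofFn, shiftedBracket,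
      shiftedBracket] at h
    exact (mul_left_cancel₀ (sgn_ne_zero _) (mul_left_cancel₀ (sgn_ne_zero _) h)).symm
  have hd : s.d = s'.d := e.ext fun α => neg_injective (hb fun _ : Fin 1 => α)
  have hℓ : s.ℓ = s'.ℓ := by
    funext n
    by_cases hn : n = 1
    · subst hn; rw [hs.ℓ_one, hs'.ℓ_one]
    · refine Module.Basis.ext_multilinear (fun _ => e) fun β => ?_
      have := hb β
      rwa [bracket_of_ne_one s hn, bracket_of_ne_one s' hn] at this
  have hq : s.q = s'.q := by
    funext n
    refine Module.Basis.ext_multilinear (fun _ => e) fun β => ?_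
    have h := taylor_assocFunction (deg := deg) hs he (List.ofFn β)
    rw [hf, taylor_assocFunction hs' he, onList_ofFn, onList_ofFn, shiftedQ, shiftedQ] at h
    exact (mul_left_cancel₀ (sgn_ne_zero _) h).symm
  exact Operations.ext hd hℓ hq

theorem coeff_single_assocField [CharZero k] (he : ∀ α, e α ∈ 𝒱 (deg α)) {s : Operations k V}
    (hs : IsGraded 𝒱 s) (α β : Fin N) :
    (assocField e deg s (X α)).coeff (Finsupp.single β 1) =
      -(sgn k (coordDeg deg α) * e.repr (s.d (e β)) α) := by
  rw [coeff_single_eq_taylor, taylor_assocField_X hs he]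
  have h1 : onList (shiftedBracket e deg s α) [β] =
      sgn k (shiftExp deg [β].get) * e.repr (-s.d (e β)) α := rfl
  have h2 : shiftExp deg [β].get = 0 := by simp [shiftExp]
  rw [h1, h2, sgn_zero, one_mul, map_neg, Finsupp.neg_apply, mul_neg]

variable [DirectSum.Decomposition 𝒱]

/-- Degrees come from homogeneity, since a Taylor coefficient is nonzero only in the right total
degree; skew-symmetry comes from the graded commutation of partial derivatives. -/
theorem isGraded_operationsOf (he : ∀ α, e α ∈ 𝒱 (deg α)) (hQ : IsVectorField 1 Q)
    (hQ0 : VanishesAtZero Q) (hf : IsPotential f) : IsGraded 𝒱 (operationsOf e deg Q f) := by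
  have hdeg : ∀ {n : ℕ} (β : Fin n → Fin N),
      bracket (operationsOf e deg Q f) n (e ∘ β) ∈ 𝒱 (2 - n + ∑ i, deg (β i)) := by
    intro n β
    refine mem_of_repr_ne_zero he fun α hα => ?_
    rw [bracket_operationsOf hQ0, map_smul, Finsupp.smul_apply, repr_fieldCoeff] at hα
    have := (hQ.homogeneous α).sum_eq_of_taylor_ne_zero
      (right_ne_zero_of_mul (right_ne_zero_of_mul hα))
    rw [sum_map_ofFn, sum_coordDeg, coordDeg] at this
    omega
  have hskew : ∀ {n : ℕ} (β : Fin n → Fin N) (σ : Equiv.Perm (Fin n)),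
      bracket (operationsOf e deg Q f) n (e ∘ β ∘ σ) =
        (((Equiv.Perm.sign σ : ℤ) : k) * sgn k (koszul σ (deg ∘ β))) •
          bracket (operationsOf e deg Q f) n (e ∘ β) := by
    intro n β σ
    refine e.repr.injective (Finsupp.ext fun α => ?_)
    have h := (isSymm_taylor (Q (X α))).isSkew n β σ
    beta_reduce at h
    rw [bracket_operationsOf hQ0, bracket_operationsOf hQ0]
    simp only [map_smul, Finsupp.smul_apply, repr_fieldCoeff, smul_eq_mul]
    linear_combination sgn k (coordDeg deg α) * h
  have hd : ∀ α, (operationsOf e deg Q f).d (e α) ∈ 𝒱 (deg α + 1) := by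
    intro α
    have h := Submodule.neg_mem _ (hdeg fun _ : Fin 1 => α)
    have h1 : -bracket (operationsOf e deg Q f) 1 (e ∘ fun _ : Fin 1 => α) =
        (operationsOf e deg Q f).d (e α) := neg_neg _
    rw [h1, Fin.sum_univ_one] at h
    convert h using 2
    push_cast
    ring
  have hℓ : ∀ n, n < 2 → (operationsOf e deg Q f).ℓ n = 0 := fun n hn => if_pos hn
  refine ⟨fun i v hv => ?_, hℓ 0 (by norm_num), hℓ 1 (by norm_num), ?_, fun n v p hv => ?_,
    fun n v p hv hp => ?_, fun n v p hv σ => ?_, fun n v p hv σ => ?_⟩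
  · rw [← e.sum_repr v, map_sum]
    refine Submodule.sum_mem _ fun α _ => ?_
    rw [map_smul]
    by_cases h0 : e.repr v α = 0
    · rw [h0, zero_smul]; exact Submodule.zero_mem _
    · rw [← deg_eq_of_repr_ne_zero he hv h0]
      exact Submodule.smul_mem _ _ (hd α)
  -- The operation `q 0` is the constant term of `f`, which vanishes.
  · refine Module.Basis.ext_multilinear (fun _ => e) fun β => ?_
    have h := q_operationsOf (e := e) (Q := Q) (f := f) β
    rw [List.ofFn_zero, taylor_nil, hf.vanishes, mul_zero] at h
    exact h
  · by_cases hn : n < 2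
    · rw [hℓ n hn]; exact Submodule.zero_mem _
    · refine IsMultilinear.mem_of_basis he ⟨(operationsOf e deg Q f).ℓ n, fun _ => rfl⟩
        (fun β hβ => ?_) hv
      rw [← bracket_of_ne_one _ (by omega), ← hβ]
      exact hdeg β
  · refine IsMultilinear.eq_zero_of_basis he ⟨(operationsOf e deg Q f).q n, fun _ => rfl⟩
      (fun β hβ => ?_) hv
    rw [q_operationsOf]
    by_contra h0
    have := hf.homogeneous.sum_eq_of_taylor_ne_zero (right_ne_zero_of_mul h0)
    rw [sum_map_ofFn, sum_coordDeg] at this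
    apply hp
    rw [← hβ]
    simp only [Function.comp_apply]
    omega
  · by_cases hn : n < 2
    · rw [hℓ n hn]; simp
    · refine skew_of_basis he _ σ (fun β => ?_) hv
      rw [← bracket_of_ne_one _ (by omega), ← bracket_of_ne_one _ (by omega)]
      exact hskew β σ
  · refine skew_of_basis he _ σ (fun β => ?_) hv
    rw [q_operationsOf, q_operationsOf]
    exact (isSymm_taylor f).isSkew n β σ

theorem bijOn_isGraded [CharZero k] (he : ∀ α, e α ∈ 𝒱 (deg α)) :
    Set.BijOn (fun s : Operations k V => (assocField e deg s, assocFunction e deg s))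
      {s | IsGraded 𝒱 s}
      {P | IsVectorField 1 P.1 ∧ VanishesAtZero P.1 ∧ IsPotential P.2} := by
  refine ⟨fun s hs => ⟨?_, ?_, ?_⟩, fun s hs s' hs' h => ?_, ?_⟩
  · exact IsGraded.isVectorField hs he
  · exact IsGraded.vanishesAtZero hs he
  · exact IsGraded.isPotential hs he
  · exact IsGraded.ext_of_assoc he hs hs' (congrArg Prod.fst h) (congrArg Prod.snd h)
  · rintro ⟨Q, f⟩ ⟨hQ, hQ0, hf⟩
    exact ⟨operationsOf e deg Q f, isGraded_operationsOf he hQ hQ0 hf,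
      Prod.ext (assocField_operationsOf hQ hQ0) assocFunction_operationsOf⟩

theorem bijOn_isUnimodular [CharZero k] (he : ∀ α, e α ∈ 𝒱 (deg α)) :
    Set.BijOn (fun s : Operations k V => (assocField e deg s, assocFunction e deg s))
      {s | IsUnimodular 𝒱 s}
      {P | IsHomological P.1 ∧ IsPotential P.2 ∧ divergence 1 P.1 + P.1 P.2 = 0} := by
  have hB := bijOn_isGraded (𝒱 := 𝒱) he
  refine ⟨fun s hs => ?_, hB.injOn.mono fun s hs => hs.graded, ?_⟩
  · have hg : IsGraded 𝒱 s := hs.graded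
    have h := (isUnimodular_iff he hg).1 hs
    exact ⟨h.1, hg.isPotential he, h.2⟩
  · rintro P ⟨hQ, hf, hdiv⟩
    obtain ⟨s, hs, rfl⟩ := hB.surjOn ⟨hQ.vectorField, hQ.vanishes, hf⟩
    exact ⟨s, (isUnimodular_iff he hs).2 ⟨hQ, hdiv⟩, rfl⟩

end Reconstruction

end UnimodularLInfty

/-! ### The theorem -/

open UnimodularLInfty in
theorem mainTheorem4 {k V : Type*} [Field k] [CharZero k] [AddCommGroup V] [Module k V]
    (𝒱 : ℤ → Submodule k V) [DirectSum.Decomposition 𝒱]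
    {N : ℕ} (e : Module.Basis (Fin N) k V) (deg : Fin N → ℤ) (he : ∀ α, e α ∈ 𝒱 (deg α)) :
    -- unimodular L-infinity structures are the same as pairs `(Q, f)` with `div Q + Q(f) = 0`
    Set.BijOn (fun s : Operations k V => (assocField e deg s, assocFunction e deg s))
      {s | IsUnimodular 𝒱 s}
      {P | IsHomological P.1 ∧ IsPotential P.2 ∧ divergence 1 P.1 + P.1 P.2 = 0} ∧
    -- equivalently, pairs `(Q, f)` such that `ρ_f` is `Q`-invariant
    Set.BijOn (fun s : Operations k V => (assocField e deg s, assocFunction e deg s))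
      {s | IsUnimodular 𝒱 s}
      {P | IsHomological P.1 ∧ IsPotential P.2 ∧ lieDer 1 P.1 (volumeForm P.2) = 0} ∧
    -- more precisely, all operations of the right degrees and symmetry correspond to all pairs
    Set.BijOn (fun s : Operations k V => (assocField e deg s, assocFunction e deg s))
      {s | IsGraded 𝒱 s}
      {P | IsVectorField 1 P.1 ∧ VanishesAtZero P.1 ∧ IsPotential P.2} ∧
    -- and the equations correspond to each other
    (∀ s : Operations k V, IsGraded 𝒱 s →
      (IsLInfty 𝒱 s ↔ IsHomological (assocField e deg s)) ∧
      (IsUnimodular 𝒱 s ↔ IsHomological (assocField e deg s) ∧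
        divergence 1 (assocField e deg s) +
          assocField e deg s (assocFunction e deg s) = 0) ∧
      (IsUnimodular 𝒱 s ↔ IsHomological (assocField e deg s) ∧
        lieDer 1 (assocField e deg s) (volumeForm (assocFunction e deg s)) = 0) ∧
      -- the linear part of `Q` is given by the differential
      (∀ α β, (assocField e deg s (FormalFun.X α)).coeff (Finsupp.single β 1) =
        - (sgn k (coordDeg deg α) * e.repr (s.d (e β)) α))) ∧
    -- the Lie derivative of the volume form
    (∀ (Q : FormalFun k (coordDeg deg) →ₗ[k] FormalFun k (coordDeg deg))
      (f : FormalFun k (coordDeg deg)), IsVectorField 1 Q → IsPotential f →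
      lieDer 1 Q (volumeForm f) = (divergence 1 Q + Q f) • volumeForm f ∧
      (divergence 1 Q + Q f = 0 ↔ lieDer 1 Q (volumeForm f) = 0)) ∧
    -- the Lie derivative is the action determined by its characteristic conditions
    IsLieAction (lieDer (k := k) (w := coordDeg deg)) ∧
    (∀ L, IsLieAction (k := k) (w := coordDeg deg) L → ∀ p Q, IsVectorField p Q →
      ∀ ρ, L p Q ρ = lieDer p Q ρ) := by
  have hinv : ∀ P : (FormalFun k (coordDeg deg) →ₗ[k] FormalFun k (coordDeg deg)) ×
      FormalFun k (coordDeg deg),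
      (IsHomological P.1 ∧ IsPotential P.2 ∧ divergence 1 P.1 + P.1 P.2 = 0) ↔
      (IsHomological P.1 ∧ IsPotential P.2 ∧ lieDer 1 P.1 (volumeForm P.2) = 0) :=
    fun P => and_congr_right fun hQ => and_congr_right fun hf =>
      hQ.vectorField.lieDer_volumeForm_eq_zero_iff hf
  have hunim := bijOn_isUnimodular (𝒱 := 𝒱) he
  refine ⟨hunim, ?_, bijOn_isGraded he, fun s hs => ⟨isLInfty_iff he hs, isUnimodular_iff he hs,
    ?_, coeff_single_assocField he hs⟩, fun Q f hQ hf => ⟨hQ.lieDer_volumeForm hf,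
    hQ.lieDer_volumeForm_eq_zero_iff hf⟩, isLieAction_lieDer, fun L hL p Q hQ ρ => ?_⟩
  · rwa [Set.ext hinv] at hunim
  · rw [isUnimodular_iff he hs,
      (hs.isVectorField he).lieDer_volumeForm_eq_zero_iff (hs.isPotential he)]
  -- Both actions are given by the same expression, in which the action itself does not occur.
  · rw [hL.apply_eq hQ, isLieAction_lieDer.apply_eq hQ]
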